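/- **Setting.** Let $1<\beta<2$, $c=\frac1{\beta-1}$, $I_\beta=[0,c]$, $L=[0,\frac1\beta)$, $S=[\frac1\beta,\frac{c}{\beta}]$, $R=(\frac{c}{\beta},c]$, $T_0(x)=\beta x$, $T_1(x)=\beta x-1$. Let $\Omega=\{0,1\}^{\mathbb N}$ with shift $\sigma$ and $(\frac12,\frac12)$-Bernoulli measure $m$, and let $\lambda$ be Lebesgue measure on $\mathbb R$. For a digit $b$ let $R_{\beta,b}$ be $T_0$ on $L$, $T_b$ on $S$ and $T_1$ on $R$. Put $R_\beta(\omega,x)=(\sigma\omega,R_{\beta,\omega_1}(x))$ and let $K_\beta(\omega,x)$ be $(\sigma\omega,R_{\beta,\omega_1}(x))$ if $x\in S$ and $(\omega,R_{\beta,\omega_1}(x))$ otherwise. Let $\mu_\beta$ be the absolutely continuous probability measure on $I_\beta$ for which $\hat\mu_\beta=m\times\mu_\beta$ is $K_\beta$-invariant. **Tower.** For a word $w=\omega_1\cdots\omega_n$ ($n\ge 0$) put $r(w)=R_{\beta,\omega_n}\circ\cdots\circ R_{\beta,\omega_1}(1)$, $v(w)=\sum_{k=0}^{n-1}\beta^{-k}+(2\beta)^{-n}\sum_{i=1}^n\omega_i2^{i-1}$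 and $$E_w=\Omega\times[0,r(w)]\times[v(w),v(w)+(2\beta)^{-n}),\qquad E=\bigcup_w E_w .$$ These sublevels are pairwise disjoint. Define $\psi$ on $E$ as follows. Let $(\tau,x,y)\in E_w$ with $w$ of length $n$, and $b=\tau_1$. Put $C_1(wb)=v(wb)-\frac{v(w)}{2\beta}$ and $$C_2(wb)=\sum (2\beta)^{-(|a|+1)}-\frac{v(w)}{2\beta},$$ the sum being over all pairs of a word $a$ (of length $|a|\ge0$) and a digit $d$ such that $R_{\beta,d}(r(a))=T_1(r(a))$ and either $v(a)<v(w)$, or $a=w$ and $d<b$. If $R_{\beta,b}(r(w))=T_0(r(w))$, then $\psi(\tau,x,y)=(\sigma\tau,T_0x,\frac y{2\beta}+C_1(wb))$. If $R_{\beta,b}(r(w))=T_1(r(w))$, then $\psi(\tau,x,y)=(\sigma\tau,T_1x,\frac y{2\beta}+C_1(wb))$ for $x\notin L$ and $\psi(\tau,x,y)=(\sigma\tau,T_0x,\frac y{2\beta}+C_2(wb))$ for $x\in L$. **Double tower.** Let $P(\omega,x,y)=(\overline\omega,c-x,-y)$ with $\overline\omega_i=1-\omega_i$, let $\overline E=P(E)$,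 and extend $\psi$ to $\overline E$ by $P\circ\psi\circ P^{-1}$ (on the null set $E\cap\overline E\subset\{y=0\}$ the rule of $E$ is used). Let $F$ be the set of $(\tau,x,y)\in E$ lying in some $E_w$ with $r(w)\in R$, $\tau_1=0$, $x\in S$. Let $Q(\omega,x,y)$ be $(\omega,x+1,-y)$ on $\psi(F)$, $(\omega,x-1,-y)$ on $P\psi(F)$, the image of $P(F)$ under $P\circ\psi\circ P^{-1}$, and $(\omega,x,y)$ elsewhere. Put $\tilde\psi=Q\circ\psi$ on $E\cup\overline E$ and let $\tilde\lambda=(m\times\lambda\times\lambda)|_{E\cup\overline E}$. **Theorem.** For every $\beta\in(1,2)$ the measure $\mu_\beta$ exists and is unique, $0<\tilde\lambda(E\cup\overline E)<\infty$, and $(E\cup\overline E,\tilde\psi,\tilde\lambda)$, with $\tilde\lambda$ normalised to a probability measure, is a natural extension of $(\Omega\times I_\beta,R_\beta,\hat\mu_\beta)$ with factor map $\pi(\omega,x,y)=(\omega,x)$. That is: 1. $\tilde\psi$ maps $E\cup\overline E$ into itself, preserves $\tilde\lambda$, and restricts to a bijection of a measurable subset of full measure onto itself; 2. $\pi(E\cup\overline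 E)\subset\Omega\times I_\beta$ and $\pi\circ\tilde\psi=R_\beta\circ\pi$ on $E\cup\overline E$; 3. $\pi$ sends $\tilde\lambda/\tilde\lambda(E\cup\overline E)$ to $\hat\mu_\beta$, and $R_\beta$ preserves $\hat\mu_\beta$; 4. modulo null sets, the measurable sets of $E\cup\overline E$ are generated by the $\sigma$-algebras $\tilde\psi^n\pi^{-1}\mathcal B$, $n\ge0$, where $\mathcal B$ is the Borel $\sigma$-algebra of $\Omega\times I_\beta$. -/

import Mathlib

open MeasureTheory Set
open scoped ENNReal

namespace RandomBeta

/-- The sequence space `Ω = {0,1}^ℕ`; `true` is the digit `1`, and `ω 0` is the first digit. -/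
abbrev Omega : Type := ℕ → Bool

/-- The left shift on `Ω`. -/
def shift (ω : Omega) : Omega := fun i => ω (i + 1)

/-- The fair coin on `{0,1}`. -/
noncomputable def coin : Measure Bool :=
  (2⁻¹ : ℝ≥0∞) • Measure.dirac false + (2⁻¹ : ℝ≥0∞) • Measure.dirac true

instance coin_isProbabilityMeasure : IsProbabilityMeasure coin :=
  ⟨by simp [coin, ENNReal.inv_two_add_inv_two]⟩

/-- The `(1/2,1/2)` Bernoulli measure on `Ω`. -/
noncomputable def bernoulli : Measure Omega := Measure.infinitePi fun _ : ℕ => coin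

/-! ### The random beta-transformation -/

/-- The interval `I_β = [0, 1/(β-1)]`. -/
def I (β : ℝ) : Set ℝ := Icc 0 (1 / (β - 1))

/-- `L = [0, 1/β)`. -/
def L (β : ℝ) : Set ℝ := Ico 0 (1 / β)

/-- `S = [1/β, 1/(β(β-1))]`. -/
def S (β : ℝ) : Set ℝ := Icc (1 / β) (1 / (β * (β - 1)))

/-- `R = (1/(β(β-1)), 1/(β-1)]`. -/
def R (β : ℝ) : Set ℝ := Ioc (1 / (β * (β - 1))) (1 / (β - 1))

def T0 (β x : ℝ) : ℝ := β * x

def T1 (β x : ℝ) : ℝ := β * x - 1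

open Classical in
/-- The fibre map `R_{β,b}` of the digit `b`: it is `T0` on `L`, `T1` on `R`, and `T_b` on `S`
(points outside `I_β` are fixed; they play no role). -/
noncomputable def fibreMap (β : ℝ) (b : Bool) (x : ℝ) : ℝ :=
  if x ∈ L β then T0 β x
  else if x ∈ S β then (if b = true then T1 β x else T0 β x)
  else if x ∈ R β then T1 β x
  else x

/-- The skew product `R_β (ω, x) = (σ ω, R_{β,ω₁} x)`. -/
noncomputable def skew (β : ℝ) (p : Omega × ℝ) : Omega × ℝ :=
  (shift p.1, fibreMap β (p.1 0) p.2)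

open Classical in
/-- The random beta-transformation `K_β`, which shifts `ω` only when `x ∈ S`. -/
noncomputable def randomMap (β : ℝ) (p : Omega × ℝ) : Omega × ℝ :=
  (if p.2 ∈ S β then shift p.1 else p.1, fibreMap β (p.1 0) p.2)

/-- `μ` is an absolutely continuous probability measure on `I_β` such that `m × μ` is invariant
under the random beta-transformation `K_β`. -/
structure IsInvariantDensityMeasure (β : ℝ) (μ : Measure ℝ) : Prop where
  isProbabilityMeasure : IsProbabilityMeasure μ
  compl_null : μ (I β)ᶜ = 0
  absolutelyContinuous : μ ≪ volume
  invariant : MeasurePreserving (randomMap β) (bernoulli.prod μ) (bernoulli.prod μ)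

/-! ### The tower

Finite words `ω₁ ⋯ ωₙ` are lists `[ω₁, …, ωₙ]`; the word `ω₁ ⋯ ωₙ ωₙ₊₁` is `w ++ [b]`. -/

/-- The rank `∑ ωᵢ 2^(i-1) ∈ {0, …, 2^n - 1}` of a word of length `n`. -/
def rank : List Bool → ℕ
  | [] => 0
  | b :: w => b.toNat + 2 * rank w

/-- The bottom `v(w)` of the sublevel of the word `w`. -/
noncomputable def height (β : ℝ) (w : List Bool) : ℝ :=
  (∑ k ∈ Finset.range w.length, (1 / β) ^ k) + (rank w : ℝ) / (2 * β) ^ w.length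

/-- The right end point `r(w) = R^n_{β,w}(1)` of the sublevel of the word `w`. -/
noncomputable def rightEnd (β : ℝ) (w : List Bool) : ℝ :=
  w.foldl (fun x b => fibreMap β b x) 1

/-- The sublevel `E_w = Ω × [0, r(w)] × [v(w), v(w) + (2β)^{-n})`; `E_[]` is the base
`Ω × [0,1] × [0,1)`. -/
def cell (β : ℝ) (w : List Bool) : Set (Omega × ℝ × ℝ) :=
  univ ×ˢ (Icc 0 (rightEnd β w) ×ˢ
    Ico (height β w) (height β w + 1 / (2 * β) ^ w.length))

/-- The tower `E`. -/
def tower (β : ℝ) : Set (Omega × ℝ × ℝ) := ⋃ w, cell β w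

/-- The digit `b` acts on the right end point of the sublevel `w` by `T1`. -/
def ActsByT1 (β : ℝ) (w : List Bool) (b : Bool) : Prop :=
  fibreMap β b (rightEnd β w) = T1 β (rightEnd β w)

/-- The vertical translation with which a piece of `E_w` is mapped up onto `E_{wb}`. -/
noncomputable def C1 (β : ℝ) (w : List Bool) (b : Bool) : ℝ :=
  height β (w ++ [b]) - height β w / (2 * β)

/-- The piece of `E_a` with digit `c` is sent down to the base, and precedes the piece of `E_w`
with digit `b`: the sublevel `E_a` lies below `E_w`, or it is the same sublevel and `c < b`. -/
def DescendsBefore (β : ℝ) (a : List Bool) (c : Bool) (w : List Bool) (b : Bool) : Prop :=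
  ActsByT1 β a c ∧ (height β a < height β w ∨ (a = w ∧ c < b))

open Classical in
/-- The vertical translation with which the piece of `E_w` with digit `b` is mapped down to the
base: its image lies exactly on top of the images of all preceding pieces. The sum has finitely
many non-zero terms. -/
noncomputable def C2 (β : ℝ) (w : List Bool) (b : Bool) : ℝ :=
  (∑' q : List Bool × Bool,
      if DescendsBefore β q.1 q.2 w b then 1 / (2 * β) ^ (q.1.length + 1) else 0)
    - height β w / (2 * β)

open Classical in
/-- The formula for `ψ` on the sublevel `E_w`. -/
noncomputable def psiOn (β : ℝ) (w : List Bool) (p : Omega × ℝ × ℝ) : Omega × ℝ × ℝ :=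
  if ActsByT1 β w (p.1 0) then
    (if p.2.1 ∈ L β then
      (shift p.1, T0 β p.2.1, p.2.2 / (2 * β) + C2 β w (p.1 0))
    else
      (shift p.1, T1 β p.2.1, p.2.2 / (2 * β) + C1 β w (p.1 0)))
  else
    (shift p.1, T0 β p.2.1, p.2.2 / (2 * β) + C1 β w (p.1 0))

open Classical in
/-- The map `ψ` on `E` (the sublevels are pairwise disjoint, so the word is determined by the
point); the identity off `E`. -/
noncomputable def psi (β : ℝ) (p : Omega × ℝ × ℝ) : Omega × ℝ × ℝ :=
  if h : ∃ w, p ∈ cell β w then psiOn β h.choose p else p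

/-! ### The double tower -/

/-- The reflection `P (ω, x, y) = (ω̄, 1/(β-1) - x, -y)`, an involution. -/
noncomputable def refl (β : ℝ) (p : Omega × ℝ × ℝ) : Omega × ℝ × ℝ :=
  (fun i => !(p.1 i), 1 / (β - 1) - p.2.1, -p.2.2)

/-- The second tower, the reflection of the tower `E`. -/
def towerBar (β : ℝ) : Set (Omega × ℝ × ℝ) := refl β '' tower β

/-- The double tower. -/
def doubleTower (β : ℝ) : Set (Omega × ℝ × ℝ) := tower β ∪ towerBar β

/-- The map `P ∘ ψ ∘ P⁻¹` on the second tower. -/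
noncomputable def psiBar (β : ℝ) (p : Omega × ℝ × ℝ) : Omega × ℝ × ℝ :=
  refl β (psi β (refl β p))

open Classical in
/-- `ψ` on the double tower. The two towers meet only in a subset of the null set `{y = 0}`, where
the rule of `E` is used. -/
noncomputable def psiDouble (β : ℝ) (p : Omega × ℝ × ℝ) : Omega × ℝ × ℝ :=
  if p ∈ tower β then psi β p else if p ∈ towerBar β then psiBar β p else p

/-- The set `F_w` of points of `E_w` on which `ψ` does not act as `R_β`. -/
def mismatch (β : ℝ) (w : List Bool) : Set (Omega × ℝ × ℝ) :=
  {p | p ∈ cell β w ∧ rightEnd β w ∈ R β ∧ p.1 0 = false ∧ p.2.1 ∈ S β}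

open Classical in
/-- The map `Q`, which swaps `ψ(F_w)` with the image under `ψ` of the reflection of `F_w`. -/
noncomputable def swap (β : ℝ) (p : Omega × ℝ × ℝ) : Omega × ℝ × ℝ :=
  if p ∈ ⋃ w, psi β '' mismatch β w then (p.1, p.2.1 + 1, -p.2.2)
  else if p ∈ ⋃ w, psiBar β '' (refl β '' mismatch β w) then (p.1, p.2.1 - 1, -p.2.2)
  else p

/-- The map `ψ̃ = Q ∘ ψ`. -/
noncomputable def psiTilde (β : ℝ) (p : Omega × ℝ × ℝ) : Omega × ℝ × ℝ :=
  swap β (psiDouble β p)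

/-- The measure `λ̃`, the restriction of `m × λ × λ` to the double tower. -/
noncomputable def towerMeasure (β : ℝ) : Measure (Omega × ℝ × ℝ) :=
  (bernoulli.prod (volume.prod volume)).restrict (doubleTower β)

/-- The projection to the first two coordinates. -/
def proj (p : Omega × ℝ × ℝ) : Omega × ℝ := (p.1, p.2.1)

/-! ### Natural extensions -/

/-- `(X, T', μ')` is a natural extension of the measure preserving system `(Y, T, μ)` with factor
map `π`: it is an invertible measure preserving system, `π` is a factor map, and the pull-back of
the σ-algebra of `Y` generates that of `X` under the forward iterates of `T'`, modulo null sets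
(with `U` the inverse of `T'`, the σ-algebra `T'^n π⁻¹ 𝓑` is the one pulled back by `π ∘ U^n`). -/
structure IsNaturalExtension {X Y : Type*} [MeasurableSpace X] [mY : MeasurableSpace Y]
    (T' : X → X) (μ' : Measure X) (π : X → Y) (T : Y → Y) (μ : Measure Y) : Prop where
  base_preserving : MeasurePreserving T μ μ
  preserving : MeasurePreserving T' μ' μ'
  factor : MeasurePreserving π μ' μ
  semiconj : ∀ᵐ x ∂μ', π (T' x) = T (π x)
  invertible_generating : ∃ U : X → X, MeasurePreserving U μ' μ' ∧
    (∀ᵐ x ∂μ', U (T' x) = x) ∧ (∀ᵐ x ∂μ', T' (U x) = x) ∧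
    ∀ A : Set X, MeasurableSet A →
      ∃ B : Set X, MeasurableSet[⨆ n : ℕ, mY.comap (π ∘ U^[n])] B ∧ A =ᵐ[μ'] B

end RandomBeta

/-!
# The natural extension of the random beta-transformation

Write `m` for the Bernoulli measure, `c = 1/(β-1)`, `r(w)` for the right end of the sublevel `E_w`,
and `U` for an almost everywhere inverse of the tower map `ψ̃`. The theorem has four ingredients.

*Invertibility.* On each piece of a sublevel with a fixed digit, `ψ` is an affine branch combined
with the shift: the shift doubles measure, the second coordinate is stretched by `β`, the third is
contracted by `2β`, so volumes of images are preserved (`vol_image_branch`). The pieces that go up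
fill disjoint sublevels. The pieces that descend are stacked in the base; they fit, since the
identity `(2β)^{-|w|} r(w) = ∑_b (2β)^{-|wb|} (r(wb) + [b acts by T1])` telescopes
(`tsum_descent_le_one`). So `ψ` is injective, and the exchange `Q` is an involution. A self-map of a
space of finite measure which is injective almost everywhere and preserves the measure of images is
measure preserving and almost everywhere invertible (`PreservesImages.measurePreserving`,
`MeasurePreserving.exists_inverse`).

*Factor.* `ψ` acts as `R_β` except on the sets `F_w`, where the second coordinate comes out too
small by `1`; `Q` corrects this (`proj_psiTilde`). So the projection of the tower measure is an
`R_β`-invariant measure `m × μ`, with `μ` absolutely continuous.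

*Uniqueness.* `K_β` and `R_β` move `m × μ` to the same measure (`map_randomMap`), so invariance
under either means that `μ` is stationary under the random choice of `R_{β,0}` and `R_{β,1}`. Given
two stationary densities, the set where one exceeds the other is forward invariant. A forward invariant
set of positive measure contains almost all of the switch region `S`, because small intervals
around a density point are expanded until they cover `S` (`volume_S_diff_le`). So two such sets
cannot be disjoint, and the densities agree. The same expansion shows that almost every `R_β`-orbit
visits any cylinder of positive measure (`Stationary.ae_exists_iterate_mem`).

*Generation.* It is enough that almost every point is determined by its projected backward orbit
`(π(Uⁿ p))ₙ`; the Lusin–Souslin theorem then gives the σ-algebra (`exists_ae_eq_of_injOn_orbit`).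
Two points with the same projections which lie in the same sublevel stay in the same sublevels,
with heights contracted by `2β` at each step (`Together.iterate`). So it suffices that two points
with the same projected backward orbit were together in the base arbitrarily long ago. There are
cylinders `V` over which all points of the double tower below a given level are brought to the base
by a fixed iterate (`exists_synchronising_cylinder`); the points above that level are a small
proportion `ε` of every fibre. Whether the backward orbit enters `π⁻¹ V` for the first time at time
`n` can be read off from the projection of the point of entry, so the point of entry is one of
the exceptional ones with probability at most `ε` (`measure_backwardEntry_le`), and backward orbits
do enter `π⁻¹ V` almost surely. The Borel–Cantelli lemma along a sequence of cylinders with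
`ε = 2^{-j}`, searched for from time at least `j` on, finishes the proof (`exists_injOn_history`).
-/

namespace RandomBeta

/-! ### The random beta-transformation on points -/

section fibre

variable {β : ℝ}

lemma beta_mul_inv (h1 : 1 < β) : β * (1 / β) = 1 := by
  field_simp

lemma beta_mul_c (h1 : 1 < β) : β * (1 / (β - 1)) = 1 / (β - 1) + 1 := by
  have : β - 1 ≠ 0 := by linarith
  field_simp
  ring

lemma S_right (h1 : 1 < β) : 1 / (β * (β - 1)) = 1 / (β - 1) - 1 / β := by
  have : β - 1 ≠ 0 := by linarith
  field_simp
  ring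

lemma one_lt_c (h1 : 1 < β) (h2 : β < 2) : 1 < 1 / (β - 1) := by
  rw [lt_div_iff₀ (by linarith)]
  linarith

lemma inv_lt_one' (h1 : 1 < β) : 1 / β < 1 := by
  rw [div_lt_one (by linarith)]
  exact h1

lemma inv_pos' (h1 : 1 < β) : 0 < 1 / β := by positivity

lemma inv_lt_S_right (h1 : 1 < β) (h2 : β < 2) : 1 / β < 1 / (β - 1) - 1 / β := by
  have := beta_mul_inv h1
  have := beta_mul_c h1
  have := one_lt_c h1 h2
  nlinarith

lemma fibreMap_of_lt {b : Bool} {x : ℝ} (h0 : 0 ≤ x) (hx : x < 1 / β) :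
    fibreMap β b x = β * x := by
  have : x ∈ L β := ⟨h0, hx⟩
  simp only [fibreMap, if_pos this, T0]

lemma fibreMap_of_gt (h1 : 1 < β) (h2 : β < 2) {b : Bool} {x : ℝ}
    (hx : 1 / (β - 1) - 1 / β < x) (hx' : x ≤ 1 / (β - 1)) :
    fibreMap β b x = β * x - 1 := by
  have a1 : x ∉ L β := fun h => by
    have := h.2
    have := inv_lt_S_right h1 h2
    linarith
  have a2 : x ∉ S β := fun h => by
    have := h.2
    rw [S_right h1] at this
    linarith
  have a3 : x ∈ R β := ⟨by rw [S_right h1]; exact hx, hx'⟩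
  simp only [fibreMap, if_neg a1, if_neg a2, if_pos a3, T1]

lemma fibreMap_false (h1 : 1 < β) {x : ℝ} (h0 : 0 ≤ x)
    (hx : x ≤ 1 / (β - 1) - 1 / β) : fibreMap β false x = β * x := by
  by_cases h : x < 1 / β
  · exact fibreMap_of_lt h0 h
  · have a1 : x ∉ L β := fun h' => h h'.2
    have a2 : x ∈ S β := ⟨not_lt.1 h, by rw [S_right h1]; exact hx⟩
    simp [fibreMap, a1, a2, T0]

lemma fibreMap_true (h1 : 1 < β) (h2 : β < 2) {x : ℝ} (hx : 1 / β ≤ x)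
    (hx' : x ≤ 1 / (β - 1)) : fibreMap β true x = β * x - 1 := by
  by_cases h : 1 / (β - 1) - 1 / β < x
  · exact fibreMap_of_gt h1 h2 h hx'
  · have a1 : x ∉ L β := fun h' => absurd h'.2 (not_lt.2 hx)
    have a2 : x ∈ S β := ⟨hx, by rw [S_right h1]; exact not_lt.1 h⟩
    simp [fibreMap, a1, a2, T1]

lemma fibreMap_mem_I (h1 : 1 < β) (h2 : β < 2) (b : Bool) {x : ℝ} (hx : x ∈ I β) :
    fibreMap β b x ∈ I β := by
  obtain ⟨h0, hc⟩ := hx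
  have e1 := beta_mul_inv h1
  have e2 := beta_mul_c h1
  have e3 := one_lt_c h1 h2
  have e4 := inv_lt_S_right h1 h2
  have low : ∀ x, 0 ≤ x → x ≤ 1 / (β - 1) - 1 / β → β * x ∈ I β := fun x h0 h =>
    ⟨by positivity, by nlinarith⟩
  have high : ∀ x, 1 / β ≤ x → x ≤ 1 / (β - 1) → β * x - 1 ∈ I β := fun x h0 h =>
    ⟨by nlinarith, by nlinarith⟩
  rcases lt_or_ge x (1 / β) with h | h
  · rw [fibreMap_of_lt h0 h]
    exact low x h0 (by linarith)
  rcases le_or_gt x (1 / (β - 1) - 1 / β) with h' | h'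
  · cases b
    · rw [fibreMap_false h1 h0 h']
      exact low x h0 h'
    · rw [fibreMap_true h1 h2 h hc]
      exact high x h hc
  · rw [fibreMap_of_gt h1 h2 h' hc]
    exact high x h hc

/-- The reflection `x ↦ 1/(β-1) - x` conjugates the fibre map of a digit to that of the opposite
digit. -/
lemma fibreMap_reflect (h1 : 1 < β) (h2 : β < 2) (b : Bool) {x : ℝ} (hx : x ∈ I β) :
    fibreMap β (!b) (1 / (β - 1) - x) = 1 / (β - 1) - fibreMap β b x := by
  obtain ⟨h0, hc⟩ := hx
  have e2 := beta_mul_c h1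
  have e4 := inv_lt_S_right h1 h2
  rcases lt_or_ge x (1 / β) with h | h
  · rw [fibreMap_of_lt h0 h, fibreMap_of_gt h1 h2 (by linarith) (by linarith)]
    linarith
  rcases le_or_gt x (1 / (β - 1) - 1 / β) with h' | h'
  · cases b
    · rw [fibreMap_false h1 h0 h', Bool.not_false,
        fibreMap_true h1 h2 (by linarith) (by linarith)]
      linarith
    · rw [fibreMap_true h1 h2 h hc, Bool.not_true,
        fibreMap_false h1 (by linarith) (by linarith)]
      linarith
  · rw [fibreMap_of_gt h1 h2 h' hc, fibreMap_of_lt (by linarith) (by linarith)]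
    linarith

end fibre

/-! ### Words, sublevels and the orbit of `1` -/

section words

variable {β : ℝ}

lemma rightEnd_nil : rightEnd β [] = 1 := rfl

lemma rightEnd_snoc (w : List Bool) (b : Bool) :
    rightEnd β (w ++ [b]) = fibreMap β b (rightEnd β w) := by
  simp [rightEnd]

lemma rightEnd_mem_I (h1 : 1 < β) (h2 : β < 2) (w : List Bool) : rightEnd β w ∈ I β := by
  induction w using List.reverseRecOn with
  | nil =>
    have := one_lt_c h1 h2
    exact ⟨by rw [rightEnd_nil]; norm_num, by rw [rightEnd_nil]; linarith⟩
  | append_singleton w b ih =>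
    rw [rightEnd_snoc]
    exact fibreMap_mem_I h1 h2 b ih

lemma actsByT1_iff (h1 : 1 < β) (h2 : β < 2) (w : List Bool) (b : Bool) :
    ActsByT1 β w b ↔ (b = true ∧ 1 / β ≤ rightEnd β w) ∨
      1 / (β - 1) - 1 / β < rightEnd β w := by
  obtain ⟨h0, hc⟩ := rightEnd_mem_I h1 h2 w
  have e4 := inv_lt_S_right h1 h2
  unfold ActsByT1 T1
  rcases lt_or_ge (rightEnd β w) (1 / β) with h | h
  · rw [fibreMap_of_lt h0 h]
    constructor
    · intro h; linarith
    · rintro (h' | h') <;> linarith [h']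
  rcases le_or_gt (rightEnd β w) (1 / (β - 1) - 1 / β) with h' | h'
  · cases b
    · rw [fibreMap_false h1 h0 h']
      simp only [Bool.false_eq_true, false_and, false_or]
      constructor <;> intro h <;> linarith
    · exact iff_of_true (fibreMap_true h1 h2 h hc) (Or.inl ⟨rfl, h⟩)
  · exact iff_of_true (fibreMap_of_gt h1 h2 h' hc) (Or.inr h')

lemma rightEnd_snoc_of_acts {w : List Bool} {b : Bool} (h : ActsByT1 β w b) :
    rightEnd β (w ++ [b]) = β * rightEnd β w - 1 := by
  rw [rightEnd_snoc]; exact h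

lemma rightEnd_snoc_of_not_acts (h1 : 1 < β) (h2 : β < 2) {w : List Bool} {b : Bool}
    (h : ¬ ActsByT1 β w b) : rightEnd β (w ++ [b]) = β * rightEnd β w := by
  obtain ⟨h0, hc⟩ := rightEnd_mem_I h1 h2 w
  rw [actsByT1_iff h1 h2] at h
  push Not at h
  rw [rightEnd_snoc]
  rcases lt_or_ge (rightEnd β w) (1 / β) with h' | h'
  · exact fibreMap_of_lt h0 h'
  · cases b
    · exact fibreMap_false h1 h0 h.2
    · exact absurd h' (not_le.2 (h.1 rfl))

lemma ActsByT1.inv_le (h1 : 1 < β) (h2 : β < 2) {w : List Bool} {b : Bool}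
    (h : ActsByT1 β w b) : 1 / β ≤ rightEnd β w := by
  have e4 := inv_lt_S_right h1 h2
  rcases (actsByT1_iff h1 h2 w b).1 h with h | h <;> linarith [h]

/-- The thickness `(2β)^{-n}` of the sublevel of a word of length `n`. -/
noncomputable def thick (β : ℝ) (w : List Bool) : ℝ := 1 / (2 * β) ^ w.length

lemma thick_pos (h1 : 1 < β) (w : List Bool) : 0 < thick β w := by
  unfold thick; positivity

lemma thick_snoc (w : List Bool) (b : Bool) :
    thick β (w ++ [b]) = thick β w / (2 * β) := by
  unfold thick
  rw [List.length_append, List.length_singleton, pow_succ, div_div]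

lemma thick_eq_snoc (w : List Bool) :
    1 / (2 * β) ^ (w.length + 1) = thick β w / (2 * β) := by
  unfold thick; rw [pow_succ, div_div]

lemma rank_lt (w : List Bool) : rank w + 1 ≤ 2 ^ w.length := by
  induction w with
  | nil => simp [rank]
  | cons b w ih =>
    rw [rank, List.length_cons, pow_succ]
    have := Bool.toNat_le b
    omega

lemma rank_inj {w w' : List Bool} (hl : w.length = w'.length) (h : rank w = rank w') :
    w = w' := by
  induction w generalizing w' with
  | nil => exact (List.length_eq_zero_iff.1 hl.symm).symm
  | cons b w ih =>
    cases w' with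
    | nil => simp at hl
    | cons b' w' =>
      simp only [rank] at h
      have h3 := Bool.toNat_le b
      have h4 := Bool.toNat_le b'
      have h5 : b.toNat = b'.toNat := by omega
      have h6 : rank w = rank w' := by omega
      have h7 : b = b' := by cases b <;> cases b' <;> simp_all
      rw [h7, ih (by simpa using hl) h6]

/-- The bottom `∑_{k<n} β^{-k}` of the `n`-th level. -/
noncomputable def levelBot (β : ℝ) (n : ℕ) : ℝ := ∑ k ∈ Finset.range n, (1 / β) ^ k

lemma levelBot_mono (h1 : 1 < β) : Monotone (levelBot β) := by
  apply monotone_nat_of_le_succ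
  intro n
  rw [levelBot, levelBot, Finset.sum_range_succ]
  have : 0 ≤ (1 / β) ^ n := by positivity
  linarith

lemma levelBot_eq (h1 : 1 < β) (n : ℕ) :
    levelBot β n = β / (β - 1) - β / (β - 1) * (1 / β) ^ n := by
  have : β - 1 ≠ 0 := by linarith
  induction n with
  | zero => simp [levelBot]
  | succ n ih =>
    rw [levelBot, Finset.sum_range_succ, ← levelBot, ih, pow_succ]
    field_simp
    ring

lemma levelBot_lt (h1 : 1 < β) (n : ℕ) : levelBot β n < β / (β - 1) := by
  rw [levelBot_eq h1]
  have : 0 < β / (β - 1) * (1 / β) ^ n :=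
    mul_pos (div_pos (by linarith) (by linarith)) (by positivity)
  linarith

lemma levelBot_le_height (h1 : 1 < β) (w : List Bool) : levelBot β w.length ≤ height β w := by
  unfold height
  rw [levelBot]
  have : 0 ≤ (rank w : ℝ) / (2 * β) ^ w.length := by positivity
  linarith

lemma height_add_thick_le (h1 : 1 < β) (w : List Bool) :
    height β w + thick β w ≤ levelBot β (w.length + 1) := by
  rw [levelBot, Finset.sum_range_succ, height, thick, add_assoc, ← add_div]
  gcongr
  rw [mul_pow, one_div_pow, div_le_div_iff₀ (by positivity) (by positivity), one_mul]
  gcongr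
  exact_mod_cast rank_lt w

lemma height_nil : height β [] = 0 := by simp [height, rank]

lemma thick_nil : thick β [] = 1 := by simp [thick]

lemma height_nonneg (h1 : 1 < β) (w : List Bool) : 0 ≤ height β w :=
  le_trans (by unfold levelBot; positivity) (levelBot_le_height h1 w)

lemma one_le_height (h1 : 1 < β) {w : List Bool} (hw : w ≠ []) : 1 ≤ height β w := by
  refine le_trans ?_ (levelBot_le_height h1 w)
  have : levelBot β 1 = 1 := by simp [levelBot]
  rw [← this]
  exact levelBot_mono h1 (List.length_pos_iff.2 hw)

/-- The sublevels are stacked: of two different ones, one lies below the other. -/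
lemma height_add_thick_le_or (h1 : 1 < β) {w w' : List Bool} (h : w ≠ w') :
    height β w + thick β w ≤ height β w' ∨ height β w' + thick β w' ≤ height β w := by
  rcases lt_trichotomy w.length w'.length with hl | hl | hl
  · exact Or.inl ((height_add_thick_le h1 w).trans
      ((levelBot_mono h1 hl).trans (levelBot_le_height h1 w')))
  · have key : ∀ u u' : List Bool, u.length = u'.length → rank u < rank u' →
        height β u + thick β u ≤ height β u' := by
      intro u u' hl hr
      rw [height, height, thick, add_assoc, ← add_div, hl]
      gcongr
      exact_mod_cast hr
    rcases lt_trichotomy (rank w) (rank w') with hr | hr | hr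
    · exact Or.inl (key _ _ hl hr)
    · exact absurd (rank_inj hl hr) h
    · exact Or.inr (key _ _ hl.symm hr)
  · exact Or.inr ((height_add_thick_le h1 w').trans
      ((levelBot_mono h1 hl).trans (levelBot_le_height h1 w)))

lemma height_lt_or (h1 : 1 < β) {w w' : List Bool} (h : w ≠ w') :
    height β w < height β w' ∨ height β w' < height β w := by
  have := thick_pos h1 w
  have := thick_pos h1 w'
  rcases height_add_thick_le_or h1 h with h | h
  · left; linarith
  · right; linarith

lemma mem_cell {w : List Bool} {p : Omega × ℝ × ℝ} :
    p ∈ cell β w ↔ (0 ≤ p.2.1 ∧ p.2.1 ≤ rightEnd β w) ∧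
      height β w ≤ p.2.2 ∧ p.2.2 < height β w + thick β w := by
  simp [cell, thick]

lemma cell_unique (h1 : 1 < β) {w w' : List Bool} {y : ℝ}
    (h : height β w ≤ y ∧ y < height β w + thick β w)
    (h' : height β w' ≤ y ∧ y < height β w' + thick β w') : w = w' := by
  by_contra hne
  rcases height_add_thick_le_or h1 hne with k | k <;> linarith [h.1, h.2, h'.1, h'.2]

lemma psi_of_mem (h1 : 1 < β) {w : List Bool} {p : Omega × ℝ × ℝ} (hp : p ∈ cell β w) :
    psi β p = psiOn β w p := by
  have hex : ∃ w, p ∈ cell β w := ⟨w, hp⟩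
  have : hex.choose = w :=
    cell_unique h1 (mem_cell.1 hex.choose_spec).2 (mem_cell.1 hp).2
  rw [psi, dif_pos hex, this]

lemma mem_tower {p : Omega × ℝ × ℝ} : p ∈ tower β ↔ ∃ w, p ∈ cell β w := by
  simp [tower]

lemma y_lt_of_mem_cell (h1 : 1 < β) {w : List Bool} {p : Omega × ℝ × ℝ} (hp : p ∈ cell β w) :
    p.2.2 < levelBot β (w.length + 1) :=
  lt_of_lt_of_le (mem_cell.1 hp).2.2 (height_add_thick_le h1 w)

lemma y_nonneg_of_mem_cell (h1 : 1 < β) {w : List Bool} {p : Omega × ℝ × ℝ}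
    (hp : p ∈ cell β w) : 0 ≤ p.2.2 :=
  (height_nonneg h1 w).trans (mem_cell.1 hp).2.1

lemma x_mem_of_mem_cell (h1 : 1 < β) (h2 : β < 2) {w : List Bool} {p : Omega × ℝ × ℝ}
    (hp : p ∈ cell β w) : p.2.1 ∈ I β :=
  ⟨(mem_cell.1 hp).1.1, (mem_cell.1 hp).1.2.trans (rightEnd_mem_I h1 h2 w).2⟩

lemma measurableSet_cell (w : List Bool) : MeasurableSet (cell β w) :=
  MeasurableSet.univ.prod (measurableSet_Icc.prod measurableSet_Ico)

lemma measurableSet_tower : MeasurableSet (tower β) :=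
  MeasurableSet.iUnion measurableSet_cell

/-- The sublevels have finite total thickness, as they are disjoint and the tower is bounded. -/
lemma tsum_thick_ne_top (h1 : 1 < β) :
    ∑' w : List Bool, ENNReal.ofReal (thick β w) ≠ ∞ := by
  have hd : Pairwise (Function.onFun Disjoint
      fun w : List Bool => Ico (height β w) (height β w + thick β w)) := by
    intro w w' hne
    refine Set.disjoint_left.2 fun y hy hy' => hne (cell_unique h1 hy hy')
  have hv : ∑' w : List Bool, ENNReal.ofReal (thick β w) =
      volume (⋃ w : List Bool, Ico (height β w) (height β w + thick β w)) := by
    rw [measure_iUnion hd fun _ => measurableSet_Ico]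
    simp [Real.volume_Ico]
  rw [hv]
  refine ne_top_of_le_ne_top (b := volume (Icc 0 (β / (β - 1)))) (by simp) (measure_mono ?_)
  refine iUnion_subset fun w y hy => ⟨(height_nonneg h1 w).trans hy.1, ?_⟩
  exact (hy.2.trans_le (height_add_thick_le h1 w)).le.trans (levelBot_lt h1 _).le

end words

/-! ### The pieces that descend to the base have total thickness at most `1` -/

section descent

variable {β : ℝ}

lemma tsum_words (f : List Bool → ℝ≥0∞) :
    ∑' w, f w = f [] + ∑' w, (f (w ++ [false]) + f (w ++ [true])) := by
  have hinj : Function.Injective fun q : List Bool × Bool => q.1 ++ [q.2] := by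
    rintro ⟨w, b⟩ ⟨w', b'⟩ h
    simpa using h
  have hr : range (fun q : List Bool × Bool => q.1 ++ [q.2]) = ({[]} : Set (List Bool))ᶜ := by
    ext w
    constructor
    · rintro ⟨q, rfl⟩
      simp
    · intro hw
      exact ⟨(w.dropLast, w.getLast hw), List.dropLast_append_getLast hw⟩
  rw [← ENNReal.summable.tsum_add_tsum_compl (s := {([] : List Bool)}) ENNReal.summable,
    tsum_singleton ([] : List Bool) f, ← hr, tsum_range f hinj, ENNReal.tsum_prod']
  simp [add_comm]

open Classical in
/-- The thickness of the image of the piece of `E_w` with digit `b` that is sent down to the base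
(zero if there is none). -/
noncomputable def descent (β : ℝ) (q : List Bool × Bool) : ℝ :=
  if ActsByT1 β q.1 q.2 then thick β q.1 / (2 * β) else 0

lemma descent_nonneg (h1 : 1 < β) (q : List Bool × Bool) : 0 ≤ descent β q := by
  have := thick_pos h1 q.1
  unfold descent
  split_ifs
  · positivity
  · exact le_rfl

lemma thick_mul_rightEnd (h1 : 1 < β) (h2 : β < 2) (w : List Bool) :
    thick β w * rightEnd β w =
      (thick β (w ++ [false]) * rightEnd β (w ++ [false]) + descent β (w, false)) +
      (thick β (w ++ [true]) * rightEnd β (w ++ [true]) + descent β (w, true)) := by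
  have key : ∀ b, thick β (w ++ [b]) * rightEnd β (w ++ [b]) + descent β (w, b) =
      thick β w * rightEnd β w / 2 := by
    intro b
    rw [thick_snoc, descent]
    by_cases h : ActsByT1 β w b
    · rw [rightEnd_snoc_of_acts h, if_pos h]
      field_simp
      ring
    · rw [rightEnd_snoc_of_not_acts h1 h2 h, if_neg h]
      field_simp
      ring
  rw [key, key]
  ring

/-- The telescoping identity `(2β)^{-|w|} r(w) = ∑_b (2β)^{-|wb|} (r(wb) + [b acts by T1])` bounds
the total thickness of the descending pieces by the area of the base. -/
lemma tsum_descent_le_one (h1 : 1 < β) (h2 : β < 2) :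
    ∑' q, ENNReal.ofReal (descent β q) ≤ 1 := by
  set f : List Bool → ℝ≥0∞ := fun w => ENNReal.ofReal (thick β w * rightEnd β w) with hf
  have hnn : ∀ w, 0 ≤ thick β w * rightEnd β w := fun w =>
    mul_nonneg (thick_pos h1 w).le (rightEnd_mem_I h1 h2 w).1
  have hfin : ∑' w, (f (w ++ [false]) + f (w ++ [true])) ≠ ∞ := by
    have h : ∑' w, f w ≠ ∞ := by
      have : ∑' w, f w ≤ ENNReal.ofReal (1 / (β - 1)) * ∑' w, ENNReal.ofReal (thick β w) := by
        rw [← ENNReal.tsum_mul_left]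
        refine ENNReal.tsum_le_tsum fun w => ?_
        simp only [hf]
        rw [mul_comm, ENNReal.ofReal_mul (rightEnd_mem_I h1 h2 w).1]
        gcongr
        exact (rightEnd_mem_I h1 h2 w).2
      exact ne_top_of_le_ne_top
        (ENNReal.mul_ne_top ENNReal.ofReal_ne_top (tsum_thick_ne_top h1)) this
    rw [tsum_words] at h
    exact ne_top_of_le_ne_top h le_add_self
  have hsplit : ∑' w, f w = ∑' w, (f (w ++ [false]) + f (w ++ [true])) +
      ∑' q, ENNReal.ofReal (descent β q) := by
    rw [ENNReal.tsum_prod', ← ENNReal.tsum_add]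
    refine tsum_congr fun w => ?_
    have d := fun b => descent_nonneg h1 (w, b)
    simp only [hf, tsum_bool]
    rw [thick_mul_rightEnd h1 h2, ENNReal.ofReal_add (add_nonneg (hnn _) (d _))
      (add_nonneg (hnn _) (d _)), ENNReal.ofReal_add (hnn _) (d _),
      ENNReal.ofReal_add (hnn _) (d _)]
    abel
  rw [tsum_words] at hsplit
  have h0 : f [] = 1 := by simp [hf, thick_nil, rightEnd_nil]
  rw [h0, add_comm] at hsplit
  exact ((ENNReal.add_right_inj hfin).1 hsplit).ge

lemma summable_descent (h1 : 1 < β) (h2 : β < 2) : Summable (descent β) := by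
  have h := ENNReal.summable_toReal
    (ne_top_of_le_ne_top ENNReal.one_ne_top (tsum_descent_le_one h1 h2))
  simpa [ENNReal.toReal_ofReal (descent_nonneg h1 _)] using h

open Classical in
/-- The total thickness of the images of the pieces that precede the piece of `E_w` with digit
`b`, that is the bottom of the image of this piece in the base. -/
noncomputable def descentBot (β : ℝ) (w : List Bool) (b : Bool) : ℝ :=
  ∑' q : List Bool × Bool,
    if DescendsBefore β q.1 q.2 w b then 1 / (2 * β) ^ (q.1.length + 1) else 0

lemma descentBot_eq (w : List Bool) (b : Bool) :
    descentBot β w b = ∑' q, indicator {q | DescendsBefore β q.1 q.2 w b} (descent β) q := by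
  classical
  refine tsum_congr fun q => ?_
  by_cases h : DescendsBefore β q.1 q.2 w b
  · rw [if_pos h, indicator_of_mem
      (show q ∈ {q : List Bool × Bool | DescendsBefore β q.1 q.2 w b} from h), descent,
      if_pos h.1, thick_eq_snoc]
  · rw [if_neg h, indicator_of_notMem
      (show q ∉ {q : List Bool × Bool | DescendsBefore β q.1 q.2 w b} from h)]

lemma descentBot_nonneg (h1 : 1 < β) (w : List Bool) (b : Bool) : 0 ≤ descentBot β w b := by
  rw [descentBot_eq]
  exact tsum_nonneg fun q => indicator_nonneg (fun q _ => descent_nonneg h1 q) q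

lemma descentBot_add_le (h1 : 1 < β) (h2 : β < 2) {w : List Bool} {b : Bool}
    (hb : ActsByT1 β w b) {s : Set (List Bool × Bool)}
    (hs : ∀ q, DescendsBefore β q.1 q.2 w b → q ∈ s) (hwb : (w, b) ∈ s) :
    descentBot β w b + thick β w / (2 * β) ≤ ∑' q, indicator s (descent β) q := by
  have hne : ¬ DescendsBefore β w b w b := by
    rintro ⟨-, h | h⟩
    · exact lt_irrefl _ h
    · exact lt_irrefl _ h.2
  have hd : descent β (w, b) = thick β w / (2 * β) := if_pos hb
  have hsing : ∑' q, indicator {(w, b)} (descent β) q = thick β w / (2 * β) := by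
    rw [← hd, tsum_eq_single (w, b)]
    · simp
    · intro q hq
      simp [hq]
  rw [descentBot_eq, ← hsing, ← ((summable_descent h1 h2).indicator _).tsum_add
    ((summable_descent h1 h2).indicator _)]
  refine Summable.tsum_le_tsum (fun q => ?_) (((summable_descent h1 h2).indicator _).add
    ((summable_descent h1 h2).indicator _)) ((summable_descent h1 h2).indicator _)
  by_cases hq : q = (w, b)
  · subst hq
    rw [indicator_of_notMem (show (w, b) ∉ {q : List Bool × Bool | DescendsBefore β q.1 q.2 w b}
      from hne), indicator_of_mem (mem_singleton _), indicator_of_mem hwb, zero_add]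
  · rw [indicator_of_notMem (show q ∉ {(w, b)} from hq), add_zero]
    exact indicator_le_indicator_of_subset (fun q h => hs q h) (descent_nonneg h1) q

lemma descentBot_add_le_one (h1 : 1 < β) (h2 : β < 2) {w : List Bool} {b : Bool}
    (hb : ActsByT1 β w b) : descentBot β w b + thick β w / (2 * β) ≤ 1 := by
  refine (descentBot_add_le h1 h2 hb (s := univ) (fun q _ => mem_univ q) (mem_univ _)).trans ?_
  rw [indicator_univ]
  have h := tsum_descent_le_one h1 h2
  rw [← ENNReal.ofReal_tsum_of_nonneg (descent_nonneg h1) (summable_descent h1 h2)] at h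
  simpa using h

/-- The images of different descending pieces are stacked in the base. -/
lemma descentBot_add_le_or (h1 : 1 < β) (h2 : β < 2) {w w' : List Bool} {b b' : Bool}
    (hb : ActsByT1 β w b) (hb' : ActsByT1 β w' b') (hne : (w, b) ≠ (w', b')) :
    descentBot β w b + thick β w / (2 * β) ≤ descentBot β w' b' ∨
      descentBot β w' b' + thick β w' / (2 * β) ≤ descentBot β w b := by
  have key : ∀ (u u' : List Bool) (d d' : Bool), DescendsBefore β u d u' d' →
      descentBot β u d + thick β u / (2 * β) ≤ descentBot β u' d' := by
    intro u u' d d' h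
    rw [descentBot_eq u']
    refine descentBot_add_le h1 h2 h.1 (fun q hq => ⟨hq.1, ?_⟩) h
    rcases h.2 with k | ⟨k, k'⟩ <;> rcases hq.2 with j | ⟨j, j'⟩
    · exact Or.inl (j.trans k)
    · exact Or.inl (j ▸ k)
    · exact Or.inl (k ▸ j)
    · exact Or.inr ⟨j.trans k, j'.trans k'⟩
  by_cases hw : w = w'
  · subst hw
    have hbb : b ≠ b' := fun h => hne (by rw [h])
    rcases lt_or_gt_of_ne hbb with h | h
    · exact Or.inl (key _ _ _ _ ⟨hb, Or.inr ⟨rfl, h⟩⟩)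
    · exact Or.inr (key _ _ _ _ ⟨hb', Or.inr ⟨rfl, h⟩⟩)
  · rcases height_lt_or h1 hw with h | h
    · exact Or.inl (key _ _ _ _ ⟨hb, Or.inl h⟩)
    · exact Or.inr (key _ _ _ _ ⟨hb', Or.inl h⟩)

end descent

/-! ### The map `ψ` on the tower -/

section psi

variable {β : ℝ}

lemma C1_eq (w : List Bool) (b : Bool) (y : ℝ) :
    y / (2 * β) + C1 β w b = height β (w ++ [b]) + (y - height β w) / (2 * β) := by
  unfold C1; ring

lemma C2_eq (w : List Bool) (b : Bool) (y : ℝ) :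
    y / (2 * β) + C2 β w b = descentBot β w b + (y - height β w) / (2 * β) := by
  unfold C2 descentBot; ring

/-- A point of `E_w` is sent down to the base. -/
def Descends (β : ℝ) (w : List Bool) (p : Omega × ℝ × ℝ) : Prop :=
  ActsByT1 β w (p.1 0) ∧ p.2.1 < 1 / β

lemma psi_descends (h1 : 1 < β) {w : List Bool} {p : Omega × ℝ × ℝ} (hp : p ∈ cell β w)
    (h : Descends β w p) : psi β p =
      (shift p.1, β * p.2.1, descentBot β w (p.1 0) + (p.2.2 - height β w) / (2 * β)) := by
  have hL : p.2.1 ∈ L β := ⟨(mem_cell.1 hp).1.1, h.2⟩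
  rw [psi_of_mem h1 hp, psiOn, if_pos h.1, if_pos hL, C2_eq, T0]

lemma psi_acts (h1 : 1 < β) {w : List Bool} {p : Omega × ℝ × ℝ} (hp : p ∈ cell β w)
    (h : ActsByT1 β w (p.1 0)) (hx : 1 / β ≤ p.2.1) : psi β p =
      (shift p.1, β * p.2.1 - 1, height β (w ++ [p.1 0]) + (p.2.2 - height β w) / (2 * β)) := by
  have hL : p.2.1 ∉ L β := fun h => absurd h.2 (not_lt.2 hx)
  rw [psi_of_mem h1 hp, psiOn, if_pos h, if_neg hL, C1_eq, T1]

lemma psi_not_acts (h1 : 1 < β) {w : List Bool} {p : Omega × ℝ × ℝ} (hp : p ∈ cell β w)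
    (h : ¬ ActsByT1 β w (p.1 0)) : psi β p =
      (shift p.1, β * p.2.1, height β (w ++ [p.1 0]) + (p.2.2 - height β w) / (2 * β)) := by
  rw [psi_of_mem h1 hp, psiOn, if_neg h, C1_eq, T0]

lemma psi_fst (h1 : 1 < β) {w : List Bool} {p : Omega × ℝ × ℝ} (hp : p ∈ cell β w) :
    (psi β p).1 = shift p.1 := by
  rw [psi_of_mem h1 hp, psiOn]
  split_ifs <;> rfl

/-- The offset of a point in its sublevel is divided by `2β`. -/
lemma offset_mem (h1 : 1 < β) {w : List Bool} {p : Omega × ℝ × ℝ} (hp : p ∈ cell β w) :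
    0 ≤ (p.2.2 - height β w) / (2 * β) ∧
      (p.2.2 - height β w) / (2 * β) < thick β w / (2 * β) := by
  have := (mem_cell.1 hp).2
  constructor
  · exact div_nonneg (by linarith) (by linarith)
  · exact div_lt_div_of_pos_right (by linarith) (by linarith)

lemma psi_mem_base (h1 : 1 < β) (h2 : β < 2) {w : List Bool} {p : Omega × ℝ × ℝ}
    (hp : p ∈ cell β w) (h : Descends β w p) : psi β p ∈ cell β [] := by
  have ho := offset_mem h1 hp
  have hb := descentBot_add_le_one h1 h2 h.1
  have h0 := descentBot_nonneg h1 w (p.1 0)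
  have hx := (mem_cell.1 hp).1.1
  have hu := beta_mul_inv h1
  have hx' := h.2
  rw [psi_descends h1 hp h, mem_cell, rightEnd_nil, height_nil, thick_nil]
  refine ⟨⟨by positivity, by nlinarith⟩, by linarith, by simp only; linarith⟩

lemma psi_mem_up (h1 : 1 < β) (h2 : β < 2) {w : List Bool} {p : Omega × ℝ × ℝ}
    (hp : p ∈ cell β w) (h : ¬ Descends β w p) : psi β p ∈ cell β (w ++ [p.1 0]) := by
  have ho := offset_mem h1 hp
  have hx := (mem_cell.1 hp).1
  have hu := beta_mul_inv h1
  by_cases ha : ActsByT1 β w (p.1 0)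
  · have hx' : 1 / β ≤ p.2.1 := not_lt.1 fun k => h ⟨ha, k⟩
    rw [psi_acts h1 hp ha hx', mem_cell, rightEnd_snoc_of_acts ha, thick_snoc]
    refine ⟨⟨by nlinarith, by nlinarith⟩, by linarith, by linarith⟩
  · rw [psi_not_acts h1 hp ha, mem_cell, rightEnd_snoc_of_not_acts h1 h2 ha, thick_snoc]
    refine ⟨⟨by nlinarith, by nlinarith⟩, by linarith, by linarith⟩

lemma mapsTo_psi (h1 : 1 < β) (h2 : β < 2) : MapsTo (psi β) (tower β) (tower β) := by
  intro p hp
  obtain ⟨w, hw⟩ := mem_tower.1 hp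
  by_cases h : Descends β w p
  · exact mem_tower.2 ⟨_, psi_mem_base h1 h2 hw h⟩
  · exact mem_tower.2 ⟨_, psi_mem_up h1 h2 hw h⟩

lemma omega_ext {ω τ : Omega} (h0 : ω 0 = τ 0) (h : shift ω = shift τ) : ω = τ := by
  funext i
  cases i with
  | zero => exact h0
  | succ i => exact congrFun h i

lemma injOn_psi (h1 : 1 < β) (h2 : β < 2) : InjOn (psi β) (tower β) := by
  intro p hp q hq hpq
  obtain ⟨w, hw⟩ := mem_tower.1 hp
  obtain ⟨u, hu⟩ := mem_tower.1 hq
  have hβ : β ≠ 0 := by linarith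
  -- The shifted sequences of the two points agree, so only the first digit and the coordinates have
  -- to be compared.
  have fin : p.1 0 = q.1 0 → p.2.1 = q.2.1 → p.2.2 = q.2.2 → p = q := by
    intro e0 e1 e2
    have : p.1 = q.1 := omega_ext e0 (by rw [← psi_fst h1 hw, ← psi_fst h1 hu, hpq])
    exact Prod.ext this (Prod.ext e1 e2)
  by_cases hdp : Descends β w p <;> by_cases hdq : Descends β u q
  · have hp' := offset_mem h1 hw
    have hq' := offset_mem h1 hu
    rw [psi_descends h1 hw hdp, psi_descends h1 hu hdq, Prod.ext_iff, Prod.ext_iff] at hpq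
    obtain ⟨-, e1, e2⟩ := hpq
    simp only at e1 e2
    have hwu : (w, p.1 0) = (u, q.1 0) := by
      by_contra hne
      rcases descentBot_add_le_or h1 h2 hdp.1 hdq.1 hne with k | k <;> linarith
    obtain ⟨rfl, hb⟩ := Prod.mk.inj hwu
    refine fin hb (mul_left_cancel₀ hβ e1) ?_
    rw [hb] at e2
    have := add_left_cancel e2
    field_simp at this
    linarith
  · have m1 := psi_mem_base h1 h2 hw hdp
    have m2 := psi_mem_up h1 h2 hu hdq
    rw [hpq] at m1
    simpa using cell_unique h1 (mem_cell.1 m1).2 (mem_cell.1 m2).2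
  · have m1 := psi_mem_up h1 h2 hw hdp
    have m2 := psi_mem_base h1 h2 hu hdq
    rw [hpq] at m1
    simpa using cell_unique h1 (mem_cell.1 m1).2 (mem_cell.1 m2).2
  · have m1 := psi_mem_up h1 h2 hw hdp
    have m2 := psi_mem_up h1 h2 hu hdq
    rw [hpq] at m1
    have hwu : w = u ∧ p.1 0 = q.1 0 := by
      simpa using cell_unique h1 (mem_cell.1 m1).2 (mem_cell.1 m2).2
    obtain ⟨rfl, hb⟩ := hwu
    have hy : ∀ k : ℝ, k + (p.2.2 - height β w) / (2 * β) =
        k + (q.2.2 - height β w) / (2 * β) → p.2.2 = q.2.2 := by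
      intro k hk
      have := add_left_cancel hk
      field_simp at this
      linarith
    by_cases ha : ActsByT1 β w (p.1 0)
    · have ha' : ActsByT1 β w (q.1 0) := hb ▸ ha
      rw [psi_acts h1 hw ha (not_lt.1 fun k => hdp ⟨ha, k⟩),
        psi_acts h1 hu ha' (not_lt.1 fun k => hdq ⟨ha', k⟩), Prod.ext_iff, Prod.ext_iff] at hpq
      obtain ⟨-, e1, e2⟩ := hpq
      simp only at e1 e2
      refine fin hb (mul_left_cancel₀ hβ (by linarith)) ?_
      rw [hb] at e2
      exact hy _ e2
    · have ha' : ¬ ActsByT1 β w (q.1 0) := hb ▸ ha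
      rw [psi_not_acts h1 hw ha, psi_not_acts h1 hu ha', Prod.ext_iff, Prod.ext_iff] at hpq
      obtain ⟨-, e1, e2⟩ := hpq
      simp only at e1 e2
      refine fin hb (mul_left_cancel₀ hβ e1) ?_
      rw [hb] at e2
      exact hy _ e2

/-- Off the set where `ψ` and `R_β` disagree, `ψ` acts as `R_β` on the first two coordinates; on
that set the second coordinate is too small by `1`. -/
lemma psi_x (h1 : 1 < β) (h2 : β < 2) {w : List Bool} {p : Omega × ℝ × ℝ} (hp : p ∈ cell β w) :
    (p ∈ mismatch β w → fibreMap β (p.1 0) p.2.1 = (psi β p).2.1 + 1 ∧ (psi β p).2.1 =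
      β * p.2.1 - 1) ∧
    (p ∉ mismatch β w → fibreMap β (p.1 0) p.2.1 = (psi β p).2.1) := by
  obtain ⟨hx0, hxr⟩ := (mem_cell.1 hp).1
  obtain ⟨-, hrc⟩ := rightEnd_mem_I h1 h2 w
  have e4 := inv_lt_S_right h1 h2
  have hm : p ∈ mismatch β w ↔ 1 / (β - 1) - 1 / β < rightEnd β w ∧ p.1 0 = false ∧
      1 / β ≤ p.2.1 ∧ p.2.1 ≤ 1 / (β - 1) - 1 / β := by
    simp only [mismatch, mem_ofPred_eq, hp, true_and, R, S, mem_Ioc, mem_Icc, hrc, and_true,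
      S_right h1]
  rw [hm]
  constructor
  · rintro ⟨k1, k2, k3, k4⟩
    have ha : ActsByT1 β w (p.1 0) := (actsByT1_iff h1 h2 _ _).2 (Or.inr k1)
    rw [psi_acts h1 hp ha k3, k2, fibreMap_false h1 hx0 k4]
    simp
  · intro hn
    by_cases hd : Descends β w p
    · rw [psi_descends h1 hp hd, fibreMap_of_lt hx0 hd.2]
    by_cases ha : ActsByT1 β w (p.1 0)
    · have hx : 1 / β ≤ p.2.1 := not_lt.1 fun k => hd ⟨ha, k⟩
      rw [psi_acts h1 hp ha hx]
      rcases (actsByT1_iff h1 h2 _ _).1 ha with ⟨hb, -⟩ | hr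
      · rw [hb, fibreMap_true h1 h2 hx (hxr.trans hrc)]
      · cases hb : p.1 0
        · refine fibreMap_of_gt h1 h2 ?_ (hxr.trans hrc)
          by_contra k
          exact hn ⟨hr, hb, hx, not_lt.1 k⟩
        · exact fibreMap_true h1 h2 hx (hxr.trans hrc)
    · rw [psi_not_acts h1 hp ha]
      rw [actsByT1_iff h1 h2] at ha
      push Not at ha
      cases hb : p.1 0
      · exact fibreMap_false h1 hx0 (hxr.trans ha.2)
      · exact fibreMap_of_lt hx0 (hxr.trans_lt (ha.1 hb))

/-- The image under `ψ` of the set of mismatch. -/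
def mismatchImage (β : ℝ) : Set (Omega × ℝ × ℝ) := ⋃ w, psi β '' mismatch β w

lemma mismatch_subset_tower (w : List Bool) : mismatch β w ⊆ tower β := fun _ hp =>
  mem_tower.2 ⟨w, hp.1⟩

/-- For `r(w) ∈ R` the image of the mismatched points of `E_w` is the part of `E_{w0}` to the left
of `1/(β-1) - 1`. As `r(w0) = β r(w) - 1` exceeds this, that part is a full rectangle, which makes
the exchange of the two copies possible. -/
lemma mem_mismatchImage_iff (h1 : 1 < β) (h2 : β < 2) {q : Omega × ℝ × ℝ} :
    q ∈ mismatchImage β ↔ ∃ w, rightEnd β w ∈ R β ∧ q ∈ cell β (w ++ [false]) ∧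
      q.2.1 ≤ 1 / (β - 1) - 1 := by
  have e1 := beta_mul_inv h1
  have e2 := beta_mul_c h1
  have e4 := inv_lt_S_right h1 h2
  simp only [mismatchImage, mem_iUnion]
  refine exists_congr fun w => ?_
  have hacts : ∀ {b}, rightEnd β w ∈ R β → ActsByT1 β w b := fun h =>
    (actsByT1_iff h1 h2 _ _).2 (Or.inr (by rw [← S_right h1]; exact h.1))
  constructor
  · rintro ⟨p, ⟨hp, hr, hb, hxl, hxr⟩, rfl⟩
    have ha := hacts (b := p.1 0) hr
    refine ⟨hr, ?_, ?_⟩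
    · rw [← hb]
      exact psi_mem_up h1 h2 hp fun h => absurd h.2 (not_lt.2 hxl)
    · rw [psi_acts h1 hp ha hxl]
      rw [S_right h1] at hxr
      simp only
      nlinarith
  · rintro ⟨hr, hq, hx⟩
    have ha := hacts (b := false) hr
    obtain ⟨⟨hq0, -⟩, hq2, hq3⟩ := mem_cell.1 hq
    have hβ : 0 < β := by linarith
    rw [thick_snoc] at hq3
    set p : Omega × ℝ × ℝ := (fun i => if i = 0 then false else q.1 (i - 1), (q.2.1 + 1) / β,
      (q.2.2 - height β (w ++ [false])) * (2 * β) + height β w) with hp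
    have hxl : 1 / β ≤ p.2.1 := by
      simp only [hp]
      gcongr
      linarith
    have hxr : p.2.1 ≤ 1 / (β - 1) - 1 / β := by
      simp only [hp]
      rw [div_le_iff₀ hβ]
      nlinarith
    have hpc : p ∈ cell β w := by
      rw [mem_cell]
      have hR := hr.1
      rw [S_right h1] at hR
      have := inv_pos' h1
      refine ⟨⟨by linarith, by linarith⟩, ?_, ?_⟩
      · simp only [hp]
        have : 0 ≤ (q.2.2 - height β (w ++ [false])) * (2 * β) :=
          mul_nonneg (by linarith) (by linarith)
        linarith
      · simp only [hp]
        have : q.2.2 - height β (w ++ [false]) < thick β w / (2 * β) := by linarith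
        rw [lt_div_iff₀ (by linarith)] at this
        linarith
    refine ⟨p, ⟨hpc, hr, by simp [hp], hxl, by rw [S_right h1]; exact hxr⟩, ?_⟩
    have hb : p.1 0 = false := by simp [hp]
    rw [psi_acts h1 hpc (hb ▸ ha) hxl, hb]
    refine Prod.ext (by funext i; simp [hp, shift]) (Prod.ext ?_ ?_)
    · simp only [hp]
      field_simp
      ring
    · simp only [hp]
      field_simp
      ring

lemma psi_mem_mismatchImage_iff (h1 : 1 < β) (h2 : β < 2) {w : List Bool}
    {p : Omega × ℝ × ℝ} (hp : p ∈ cell β w) :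
    psi β p ∈ mismatchImage β ↔ p ∈ mismatch β w := by
  refine ⟨fun h => ?_, fun h => mem_iUnion.2 ⟨w, mem_image_of_mem _ h⟩⟩
  obtain ⟨u, q, hq, hqp⟩ := mem_iUnion.1 h
  have := injOn_psi h1 h2 (mismatch_subset_tower u hq) (mem_tower.2 ⟨w, hp⟩) hqp
  subst this
  rwa [cell_unique h1 (mem_cell.1 hp).2 (mem_cell.1 hq.1).2]

lemma one_le_y_of_mem_mismatchImage (h1 : 1 < β) (h2 : β < 2) {q : Omega × ℝ × ℝ}
    (hq : q ∈ mismatchImage β) : 1 ≤ q.2.2 := by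
  obtain ⟨w, -, hc, -⟩ := (mem_mismatchImage_iff h1 h2).1 hq
  exact (one_le_height h1 (by simp)).trans (mem_cell.1 hc).2.1

end psi

/-! ### The double tower -/

section double

variable {β : ℝ}

lemma refl_refl (p : Omega × ℝ × ℝ) : refl β (refl β p) = p := by
  simp [refl]

lemma refl_injective : Function.Injective (refl β) :=
  Function.LeftInverse.injective refl_refl

lemma mem_refl_image {s : Set (Omega × ℝ × ℝ)} {p : Omega × ℝ × ℝ} :
    p ∈ refl β '' s ↔ refl β p ∈ s :=
  ⟨fun ⟨q, hq, hqp⟩ => by rwa [← hqp, refl_refl], fun h => ⟨refl β p, h, refl_refl p⟩⟩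

lemma mem_towerBar {p : Omega × ℝ × ℝ} : p ∈ towerBar β ↔ refl β p ∈ tower β :=
  mem_refl_image

lemma refl_image_eq_preimage (s : Set (Omega × ℝ × ℝ)) : refl β '' s = refl β ⁻¹' s :=
  Set.ext fun _ => mem_refl_image

lemma refl_y (p : Omega × ℝ × ℝ) : (refl β p).2.2 = -p.2.2 := rfl

lemma refl_x (p : Omega × ℝ × ℝ) : (refl β p).2.1 = 1 / (β - 1) - p.2.1 := rfl

lemma refl_digit (p : Omega × ℝ × ℝ) (i : ℕ) : (refl β p).1 i = !(p.1 i) := rfl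

lemma y_nonneg_of_mem_tower (h1 : 1 < β) {p : Omega × ℝ × ℝ} (hp : p ∈ tower β) :
    0 ≤ p.2.2 := by
  obtain ⟨w, hw⟩ := mem_tower.1 hp
  exact y_nonneg_of_mem_cell h1 hw

lemma swap_eq : swap β = fun p =>
    open Classical in
    if p ∈ mismatchImage β then (p.1, p.2.1 + 1, -p.2.2)
    else if refl β p ∈ mismatchImage β then (p.1, p.2.1 - 1, -p.2.2) else p := by
  have hM : (⋃ w, psiBar β '' (refl β '' mismatch β w)) = refl β ⁻¹' mismatchImage β := by
    have h : ∀ w, psiBar β '' (refl β '' mismatch β w) = refl β '' (psi β '' mismatch β w) := by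
      intro w
      simp only [image_image, psiBar, refl_refl]
    rw [iUnion_congr h, ← image_iUnion]
    exact refl_image_eq_preimage _
  funext p
  rw [swap, hM]
  rfl

lemma swap_of_mem {p : Omega × ℝ × ℝ} (hp : p ∈ mismatchImage β) :
    swap β p = (p.1, p.2.1 + 1, -p.2.2) := by
  rw [swap_eq]; exact if_pos hp

lemma swap_of_refl_mem (h1 : 1 < β) (h2 : β < 2) {p : Omega × ℝ × ℝ}
    (hp : refl β p ∈ mismatchImage β) : swap β p = (p.1, p.2.1 - 1, -p.2.2) := by
  have hn : p ∉ mismatchImage β := fun h => by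
    have a := one_le_y_of_mem_mismatchImage h1 h2 h
    have b := one_le_y_of_mem_mismatchImage h1 h2 hp
    rw [refl_y] at b
    linarith
  rw [swap_eq]
  simp only [if_neg hn, if_pos hp]

lemma swap_of_notMem {p : Omega × ℝ × ℝ} (hp : p ∉ mismatchImage β)
    (hp' : refl β p ∉ mismatchImage β) : swap β p = p := by
  rw [swap_eq]
  simp only [if_neg hp, if_neg hp']

lemma refl_swap_mem (h1 : 1 < β) (h2 : β < 2) {p : Omega × ℝ × ℝ}
    (hp : p ∈ mismatchImage β) : refl β (swap β p) ∈ mismatchImage β := by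
  rw [swap_of_mem hp]
  rw [mem_mismatchImage_iff h1 h2] at hp ⊢
  obtain ⟨w, hr, hc, hx⟩ := hp
  obtain ⟨⟨a, b⟩, c, d⟩ := mem_cell.1 hc
  have hR := hr.1
  rw [S_right h1] at hR
  have e1 := beta_mul_inv h1
  have e2 := beta_mul_c h1
  have hacts : ActsByT1 β w false :=
    (actsByT1_iff h1 h2 _ _).2 (Or.inr hR)
  have hr' := rightEnd_snoc_of_acts hacts
  refine ⟨w, hr, mem_cell.2 ⟨⟨?_, ?_⟩, ?_, ?_⟩, ?_⟩ <;> simp only [refl, neg_neg]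
  · linarith
  · rw [hr']
    nlinarith
  · exact c
  · exact d
  · linarith

lemma swap_mem (h1 : 1 < β) (h2 : β < 2) {p : Omega × ℝ × ℝ}
    (hp : refl β p ∈ mismatchImage β) : swap β p ∈ mismatchImage β := by
  have h : swap β p = refl β (swap β (refl β p)) := by
    rw [swap_of_mem hp, swap_of_refl_mem h1 h2 hp]
    simp only [refl, Bool.not_not, neg_neg]
    refine Prod.ext rfl (Prod.ext ?_ rfl)
    simp only
    ring
  rw [h]
  exact refl_swap_mem h1 h2 hp

lemma swap_swap (h1 : 1 < β) (h2 : β < 2) (p : Omega × ℝ × ℝ) : swap β (swap β p) = p := by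
  by_cases hp : p ∈ mismatchImage β
  · rw [swap_of_refl_mem h1 h2 (refl_swap_mem h1 h2 hp), swap_of_mem hp]
    simp
  by_cases hp' : refl β p ∈ mismatchImage β
  · rw [swap_of_mem (swap_mem h1 h2 hp'), swap_of_refl_mem h1 h2 hp']
    simp
  · rw [swap_of_notMem hp hp', swap_of_notMem hp hp']

lemma mismatchImage_subset_tower (h1 : 1 < β) (h2 : β < 2) : mismatchImage β ⊆ tower β :=
  iUnion_subset fun w => image_subset_iff.2 fun _ hp =>
    mapsTo_psi h1 h2 (mismatch_subset_tower w hp)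

lemma mapsTo_swap (h1 : 1 < β) (h2 : β < 2) :
    MapsTo (swap β) (doubleTower β) (doubleTower β) := by
  intro p hp
  by_cases hm : p ∈ mismatchImage β
  · exact Or.inr (mem_towerBar.2 (mismatchImage_subset_tower h1 h2 (refl_swap_mem h1 h2 hm)))
  by_cases hm' : refl β p ∈ mismatchImage β
  · exact Or.inl (mismatchImage_subset_tower h1 h2 (swap_mem h1 h2 hm'))
  · rwa [swap_of_notMem hm hm']

lemma psiDouble_of_mem {p : Omega × ℝ × ℝ} (hp : p ∈ tower β) : psiDouble β p = psi β p := by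
  rw [psiDouble, if_pos hp]

lemma psiDouble_of_mem_bar {p : Omega × ℝ × ℝ} (hp : p ∉ tower β) (hp' : p ∈ towerBar β) :
    psiDouble β p = refl β (psi β (refl β p)) := by
  rw [psiDouble, if_neg hp, if_pos hp', psiBar]

lemma mapsTo_psiDouble (h1 : 1 < β) (h2 : β < 2) :
    MapsTo (psiDouble β) (doubleTower β) (doubleTower β) := by
  intro p hp
  by_cases h : p ∈ tower β
  · rw [psiDouble_of_mem h]
    exact Or.inl (mapsTo_psi h1 h2 h)
  · have h' := hp.resolve_left h
    rw [psiDouble_of_mem_bar h h']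
    refine Or.inr (mem_towerBar.2 ?_)
    rw [refl_refl]
    exact mapsTo_psi h1 h2 (mem_towerBar.1 h')

lemma mapsTo_psiTilde (h1 : 1 < β) (h2 : β < 2) :
    MapsTo (psiTilde β) (doubleTower β) (doubleTower β) :=
  (mapsTo_swap h1 h2).comp (mapsTo_psiDouble h1 h2)

lemma refl_psi_notMem (h1 : 1 < β) (h2 : β < 2) {p : Omega × ℝ × ℝ} (hp : p ∈ tower β) :
    refl β (psi β p) ∉ mismatchImage β := fun h => by
  have := one_le_y_of_mem_mismatchImage h1 h2 h
  have := y_nonneg_of_mem_tower h1 (mapsTo_psi h1 h2 hp)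
  rw [refl_y] at *
  linarith

lemma psiTilde_of_notMem_mismatch (h1 : 1 < β) (h2 : β < 2) {w : List Bool}
    {p : Omega × ℝ × ℝ} (hp : p ∈ cell β w) (hm : p ∉ mismatch β w) :
    psiTilde β p = psi β p := by
  have ht : p ∈ tower β := mem_tower.2 ⟨w, hp⟩
  rw [psiTilde, psiDouble_of_mem ht]
  exact swap_of_notMem (fun h => hm ((psi_mem_mismatchImage_iff h1 h2 hp).1 h))
    (refl_psi_notMem h1 h2 ht)

lemma psiTilde_of_mem_mismatch (h1 : 1 < β) (h2 : β < 2) {w : List Bool}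
    {p : Omega × ℝ × ℝ} (hm : p ∈ mismatch β w) :
    psiTilde β p = ((psi β p).1, (psi β p).2.1 + 1, -(psi β p).2.2) := by
  rw [psiTilde, psiDouble_of_mem (mismatch_subset_tower w hm)]
  exact swap_of_mem ((psi_mem_mismatchImage_iff h1 h2 hm.1).2 hm)

lemma psiTilde_of_refl_notMem_mismatch (h1 : 1 < β) (h2 : β < 2) {w : List Bool}
    {p : Omega × ℝ × ℝ} (ht : p ∉ tower β) (hp : refl β p ∈ cell β w)
    (hm : refl β p ∉ mismatch β w) : psiTilde β p = refl β (psi β (refl β p)) := by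
  have hb : refl β p ∈ tower β := mem_tower.2 ⟨w, hp⟩
  rw [psiTilde, psiDouble_of_mem_bar ht (mem_towerBar.2 hb)]
  refine swap_of_notMem (refl_psi_notMem h1 h2 hb) ?_
  rw [refl_refl]
  exact fun h => hm ((psi_mem_mismatchImage_iff h1 h2 hp).1 h)

lemma psiTilde_of_refl_mem_mismatch (h1 : 1 < β) (h2 : β < 2) {w : List Bool}
    {p : Omega × ℝ × ℝ} (ht : p ∉ tower β) (hm : refl β p ∈ mismatch β w) :
    psiTilde β p = ((refl β (psi β (refl β p))).1,
      1 / (β - 1) - (psi β (refl β p)).2.1 - 1, (psi β (refl β p)).2.2) := by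
  rw [psiTilde, psiDouble_of_mem_bar ht (mem_towerBar.2 (mismatch_subset_tower w hm)),
    swap_of_refl_mem h1 h2 (by rw [refl_refl]; exact (psi_mem_mismatchImage_iff h1 h2 hm.1).2 hm)]
  simp [refl]

lemma shift_refl (p : Omega × ℝ × ℝ) : (fun i => !(shift (refl β p).1 i)) = shift p.1 := by
  funext i
  simp [shift, refl]

lemma x_mem_I (h1 : 1 < β) (h2 : β < 2) {p : Omega × ℝ × ℝ} (hp : p ∈ doubleTower β) :
    p.2.1 ∈ I β := by
  rcases hp with hp | hp
  · obtain ⟨w, hw⟩ := mem_tower.1 hp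
    exact x_mem_of_mem_cell h1 h2 hw
  · obtain ⟨w, hw⟩ := mem_tower.1 (mem_towerBar.1 hp)
    have := x_mem_of_mem_cell h1 h2 hw
    rw [refl_x] at this
    exact ⟨by linarith [this.2], by linarith [this.1]⟩

/-- Exchanging the images of the mismatched points makes the tower map act as `R_β`. -/
lemma proj_psiTilde (h1 : 1 < β) (h2 : β < 2) {p : Omega × ℝ × ℝ} (hp : p ∈ doubleTower β) :
    proj (psiTilde β p) = skew β (proj p) := by
  have hxI := x_mem_I h1 h2 hp
  by_cases ht : p ∈ tower β
  · obtain ⟨w, hw⟩ := mem_tower.1 ht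
    have hx := psi_x h1 h2 hw
    by_cases hm : p ∈ mismatch β w
    · rw [psiTilde_of_mem_mismatch h1 h2 hm]
      exact Prod.ext (psi_fst h1 hw) (hx.1 hm).1.symm
    · rw [psiTilde_of_notMem_mismatch h1 h2 hw hm]
      exact Prod.ext (psi_fst h1 hw) (hx.2 hm).symm
  · obtain ⟨w, hw⟩ := mem_tower.1 (mem_towerBar.1 (hp.resolve_left ht))
    have hx := psi_x h1 h2 hw
    have hf := fibreMap_reflect h1 h2 (p.1 0) hxI
    rw [refl_x, refl_digit, hf] at hx
    by_cases hm : refl β p ∈ mismatch β w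
    · rw [psiTilde_of_refl_mem_mismatch h1 h2 ht hm]
      refine Prod.ext ?_ ?_
      · change (fun i => !((psi β (refl β p)).1 i)) = shift p.1
        rw [psi_fst h1 hw]
        exact shift_refl p
      · simp only [proj, skew]
        linarith [(hx.1 hm).1]
    · rw [psiTilde_of_refl_notMem_mismatch h1 h2 ht hw hm]
      refine Prod.ext ?_ ?_
      · simp only [proj, skew]
        rw [refl, psi_fst h1 hw]
        exact shift_refl p
      · simp only [proj, skew, refl_x]
        linarith [hx.2 hm]

end double

end RandomBeta

/-! ### Invertibility of injective maps that preserve volumes of images -/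

namespace MeasureTheory

variable {X : Type*} [MeasurableSpace X]

/-- `T` maps the measurable subsets of `D` to sets of the same measure. -/
def PreservesImages (ν : Measure X) (T : X → X) (D : Set X) : Prop :=
  ∀ A ⊆ D, MeasurableSet A → ν (T '' A) = ν A

variable {ν : Measure X} {T S : X → X} {D : Set X}

lemma PreservesImages.mono (h : PreservesImages ν T D) {D' : Set X} (hD : D' ⊆ D) :
    PreservesImages ν T D' := fun A hA => h A (hA.trans hD)

lemma PreservesImages.congr (h : PreservesImages ν T D) (hTS : EqOn T S D) :
    PreservesImages ν S D := fun A hA hm => by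
  rw [← (hTS.mono hA).image_eq]
  exact h A hA hm

lemma PreservesImages.comp [StandardBorelSpace X] (hS : PreservesImages ν S univ)
    (hT : PreservesImages ν T D) (hTm : Measurable T) (hTi : InjOn T D) :
    PreservesImages ν (S ∘ T) D := fun A hA hm => by
  rw [image_comp, hS _ (subset_univ _) (hm.image_of_measurable_injOn hTm (hTi.mono hA)),
    hT A hA hm]

lemma PreservesImages.iUnion [StandardBorelSpace X] {ι : Type*} [Countable ι] {D : ι → Set X}
    (h : ∀ i, PreservesImages ν T (D i)) (hD : ∀ i, MeasurableSet (D i))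
    (hd : Pairwise (Function.onFun Disjoint D)) (hTm : Measurable T)
    (hTi : InjOn T (⋃ i, D i)) : PreservesImages ν T (⋃ i, D i) := by
  intro A hA hm
  have e : A = ⋃ i, A ∩ D i := by rw [← inter_iUnion, inter_eq_left.2 hA]
  have hm' : ∀ i, MeasurableSet (A ∩ D i) := fun i => hm.inter (hD i)
  have hd' : Pairwise (Function.onFun Disjoint fun i => A ∩ D i) := fun i j hij =>
    (hd hij).mono inter_subset_right inter_subset_right
  have hdT : Pairwise (Function.onFun Disjoint fun i => T '' (A ∩ D i)) := fun i j hij => by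
    refine Set.disjoint_left.2 ?_
    rintro _ ⟨a, ha, rfl⟩ ⟨b, hb, hab⟩
    rw [hTi (hA hb.1) (hA ha.1) hab] at hb
    exact Set.disjoint_left.1 (hd' hij) ha hb
  have hTm' : ∀ i, MeasurableSet (T '' (A ∩ D i)) := fun i =>
    (hm' i).image_of_measurable_injOn hTm (hTi.mono (inter_subset_left.trans hA))
  conv_lhs => rw [e]
  rw [image_iUnion, measure_iUnion hdT hTm']
  conv_rhs => rw [e, measure_iUnion hd' hm']
  exact tsum_congr fun i => h i _ inter_subset_right (hm' i)

/-- On a set of finite measure, a self-map that is almost everywhere injective and preserves the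
measure of images preserves the measure: `ν (T⁻¹ B) ≤ ν B` for all `B`, with equality for the
whole space. -/
lemma PreservesImages.measurePreserving {X₁ : Set X} (hT : PreservesImages ν T X₁)
    (hTm : Measurable T) (hfin : ν D ≠ ∞) (hmaps : MapsTo T D D)
    (hX₁ : MeasurableSet X₁) (hsub : X₁ ⊆ D) (hnull : ν (D \ X₁) = 0) :
    MeasurePreserving T (ν.restrict D) (ν.restrict D) := by
  have : IsFiniteMeasure (ν.restrict D) := isFiniteMeasure_restrict.2 hfin
  refine ⟨hTm, Measure.eq_of_le_of_measure_univ_eq (Measure.le_iff.2 fun B hB => ?_) ?_⟩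
  · rw [Measure.map_apply hTm hB, Measure.restrict_apply (hTm hB), Measure.restrict_apply hB]
    calc ν (T ⁻¹' B ∩ D) ≤ ν ((T ⁻¹' B ∩ X₁) ∪ (D \ X₁)) := by
          refine measure_mono fun p hp => ?_
          by_cases h : p ∈ X₁
          · exact Or.inl ⟨hp.1, h⟩
          · exact Or.inr ⟨hp.2, h⟩
      _ ≤ ν (T ⁻¹' B ∩ X₁) + ν (D \ X₁) := measure_union_le _ _
      _ = ν (T '' (T ⁻¹' B ∩ X₁)) := by
          rw [hnull, add_zero, hT _ inter_subset_right ((hTm hB).inter hX₁)]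
      _ ≤ ν (B ∩ D) := by
          refine measure_mono ?_
          rintro _ ⟨p, hp, rfl⟩
          exact ⟨hp.1, hmaps (hsub hp.2)⟩
  · rw [Measure.map_apply hTm MeasurableSet.univ, preimage_univ]

/-- An almost everywhere injective map preserving a finite measure on a standard Borel space is
invertible on an invariant set of full measure. -/
lemma MeasurePreserving.exists_inverse [StandardBorelSpace X] [IsFiniteMeasure ν] {X₁ : Set X}
    (hT : MeasurePreserving T ν ν) (hX₁ : MeasurableSet X₁) (hnull : ν X₁ᶜ = 0)
    (hinj : InjOn T X₁) :
    ∃ (U : X → X) (X₀ : Set X), MeasurePreserving U ν ν ∧ X₀ ⊆ X₁ ∧ MeasurableSet X₀ ∧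
      ν X₀ᶜ = 0 ∧ MapsTo T X₀ X₀ ∧ MapsTo U X₀ X₀ ∧ LeftInvOn U T X₀ ∧ LeftInvOn T U X₀ := by
  classical
  have hTm := hT.measurable
  have himg : MeasurableSet (T '' X₁) := hX₁.image_of_measurable_injOn hTm hinj
  -- `U` inverts `T` on the image of `X₁` and is the identity elsewhere.
  let U : X → X := fun p => if h : p ∈ T '' X₁ then h.choose else p
  have hUmem : ∀ p ∈ T '' X₁, U p ∈ X₁ ∧ T (U p) = p := by
    intro p hp
    simp only [U, dif_pos hp]
    exact hp.choose_spec
  have hUT : ∀ p ∈ X₁, U (T p) = p := fun p hp =>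
    hinj (hUmem _ (mem_image_of_mem T hp)).1 hp (hUmem _ (mem_image_of_mem T hp)).2
  have hUm : Measurable U := by
    intro B hB
    have : U ⁻¹' B = T '' (X₁ ∩ B) ∪ ((T '' X₁)ᶜ ∩ B) := by
      ext p
      by_cases hp : p ∈ T '' X₁
      · simp only [mem_preimage, mem_union, mem_inter_iff, mem_compl_iff, hp, not_true_eq_false,
          false_and, or_false]
        constructor
        · exact fun h => ⟨U p, ⟨(hUmem p hp).1, h⟩, (hUmem p hp).2⟩
        · rintro ⟨q, hq, rfl⟩
          rw [hUT q hq.1]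
          exact hq.2
      · have hp' : p ∉ T '' (X₁ ∩ B) := fun h => hp (image_mono inter_subset_left h)
        have : U p = p := by simp only [U, dif_neg hp]
        simp [hp, hp', this]
    rw [this]
    exact ((hX₁.inter hB).image_of_measurable_injOn hTm (hinj.mono inter_subset_left)).union
      (himg.compl.inter hB)
  have hX₁ae : ∀ᵐ p ∂ν, p ∈ X₁ := hnull
  have hU : MeasurePreserving U ν ν := by
    refine ⟨hUm, Measure.ext fun B hB => ?_⟩
    rw [Measure.map_apply hUm hB, ← hT.measure_preimage (hUm hB).nullMeasurableSet]
    refine measure_congr ?_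
    filter_upwards [hX₁ae] with p hp
    have : (T ⁻¹' (U ⁻¹' B)) p = (U (T p) ∈ B) := rfl
    rw [this, hUT p hp]
    rfl
  have himgae : ∀ᵐ p ∂ν, p ∈ T '' X₁ := by
    have h1 : ν (T '' X₁) = ν univ := by
      refine le_antisymm (measure_mono (subset_univ _)) ?_
      rw [← hT.measure_preimage himg.nullMeasurableSet]
      refine measure_mono_ae ?_
      filter_upwards [hX₁ae] with p hp _ using mem_image_of_mem T hp
    exact (ae_iff_measure_eq (p := fun p => p ∈ T '' X₁) himg.nullMeasurableSet).2 h1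
  let G : Set X := X₁ ∩ T '' X₁
  have hGm : MeasurableSet G := hX₁.inter himg
  have hGae : ∀ᵐ p ∂ν, p ∈ G := by filter_upwards [hX₁ae, himgae] with p h1 h2 using ⟨h1, h2⟩
  -- The points whose forward and backward orbits stay where `U` and `T` invert each other.
  let X₀ : Set X := {p | ∀ n, T^[n] p ∈ G ∧ U^[n] p ∈ G}
  have hX₀ : X₀ = ⋂ n, (T^[n] ⁻¹' G ∩ U^[n] ⁻¹' G) := by
    ext p
    simp [X₀]
  refine ⟨U, X₀, hU, fun p hp => (hp 0).1.1, ?_, ?_, ?_, ?_, ?_, ?_⟩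
  · rw [hX₀]
    exact MeasurableSet.iInter fun n =>
      ((hTm.iterate n) hGm).inter ((hUm.iterate n) hGm)
  · have : ∀ᵐ p ∂ν, p ∈ X₀ := by
      refine ae_all_iff.2 fun n => ?_
      filter_upwards [(hT.iterate n).quasiMeasurePreserving.ae hGae,
        (hU.iterate n).quasiMeasurePreserving.ae hGae] with p h1 h2 using ⟨h1, h2⟩
    exact this
  · intro p hp n
    refine ⟨by simpa only [Function.iterate_succ_apply] using (hp (n + 1)).1, ?_⟩
    cases n with
    | zero => exact (hp 1).1
    | succ n =>
      rw [Function.iterate_succ_apply, hUT p (hp 0).1.1]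
      exact (hp n).2
  · intro p hp n
    refine ⟨?_, by simpa only [Function.iterate_succ_apply] using (hp (n + 1)).2⟩
    cases n with
    | zero => exact (hp 1).2
    | succ n =>
      rw [Function.iterate_succ_apply, (hUmem p (hp 0).1.2).2]
      exact (hp n).1
  · exact fun p hp => hUT p (hp 0).1.1
  · exact fun p hp => (hUmem p (hp 0).1.2).2

end MeasureTheory

namespace RandomBeta

/-! ### The Bernoulli measure -/

section bernoulli

instance : IsProbabilityMeasure bernoulli := by unfold bernoulli; infer_instance

/-- The sequence with first digit `b` and shift `ω`. -/
def cons (b : Bool) (ω : Omega) : Omega := fun i => Nat.casesOn i b ω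

lemma cons_shift (ω : Omega) : cons (ω 0) (shift ω) = ω :=
  omega_ext rfl rfl

lemma measurable_cons (b : Bool) : Measurable (cons b) := by
  refine measurable_pi_iff.2 fun i => ?_
  cases i with
  | zero => exact measurable_const
  | succ i => exact measurable_pi_apply i

lemma measurable_shift : Measurable shift :=
  measurable_pi_iff.2 fun i => measurable_pi_apply (i + 1)

lemma coin_apply (A : Set Bool) : coin A =
    2⁻¹ * Measure.dirac false A + 2⁻¹ * Measure.dirac true A := by
  simp [coin]

/-- The first digit is a fair coin, independent of the other digits. -/
lemma bernoulli_eq : bernoulli =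
    (2⁻¹ : ℝ≥0∞) • bernoulli.map (cons false) + (2⁻¹ : ℝ≥0∞) • bernoulli.map (cons true) := by
  symm
  refine Measure.eq_infinitePi _ fun s t ht => ?_
  obtain ⟨n, hn⟩ : ∃ n, s ⊆ Finset.range (n + 1) := by
    obtain ⟨n, hn⟩ := s.exists_nat_subset_range
    exact ⟨n, hn.trans (Finset.range_mono n.le_succ)⟩
  classical
  set t' : ℕ → Set Bool := fun i => if i ∈ s then t i else univ with ht'
  have ht'm : ∀ i, MeasurableSet (t' i) := fun i => MeasurableSet.of_discrete
  have hpi : Set.pi (s : Set ℕ) t = Set.pi (Finset.range (n + 1) : Set ℕ) t' := by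
    ext ω
    simp only [Set.mem_pi, Finset.mem_coe, ht']
    constructor
    · intro h i _
      split_ifs with hi
      · exact h i hi
      · exact mem_univ _
    · intro h i hi
      have := h i (hn hi)
      rwa [if_pos hi] at this
  have hprod : ∏ i ∈ s, coin (t i) = ∏ i ∈ Finset.range (n + 1), coin (t' i) := by
    rw [← Finset.prod_subset hn]
    · exact Finset.prod_congr rfl fun i hi => by simp [ht', hi]
    · intro i _ hi
      rw [ht']
      simp only [if_neg hi]
      exact measure_univ
  have hmeas : MeasurableSet (Set.pi (Finset.range (n + 1) : Set ℕ) t') :=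
    MeasurableSet.pi (Finset.range (n + 1)).countable_toSet fun i _ => ht'm i
  have hcons : ∀ b, bernoulli.map (cons b) (Set.pi (Finset.range (n + 1) : Set ℕ) t') =
      Measure.dirac b (t' 0) * ∏ i ∈ Finset.range n, coin (t' (i + 1)) := by
    intro b
    rw [Measure.map_apply (measurable_cons b) hmeas]
    by_cases hb : b ∈ t' 0
    · have : cons b ⁻¹' (Set.pi (Finset.range (n + 1) : Set ℕ) t') =
          Set.pi (Finset.range n : Set ℕ) fun i => t' (i + 1) := by
        ext ω
        simp only [mem_preimage, Set.mem_pi, Finset.mem_coe, Finset.mem_range]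
        constructor
        · intro h i hi
          exact h (i + 1) (by omega)
        · intro h i hi
          cases i with
          | zero => exact hb
          | succ i => exact h i (by omega)
      rw [this, bernoulli, Measure.infinitePi_pi _ fun i _ => ht'm _]
      simp [hb]
    · have : cons b ⁻¹' (Set.pi (Finset.range (n + 1) : Set ℕ) t') = ∅ := by
        refine eq_empty_of_forall_notMem fun ω h => hb ?_
        exact h 0 (by simp)
      rw [this]
      simp [hb]
  rw [hpi, hprod, Finset.prod_range_succ', Measure.add_apply, Measure.smul_apply,
    Measure.smul_apply, hcons, hcons, coin_apply]
  simp only [smul_eq_mul]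
  ring

lemma map_not_bernoulli : bernoulli.map (fun ω i => !(ω i)) = bernoulli := by
  have h : coin.map not = coin := by
    rw [coin, Measure.map_add _ _ .of_discrete, Measure.map_smul, Measure.map_smul,
      Measure.map_dirac' .of_discrete, Measure.map_dirac' .of_discrete, add_comm]
    rfl
  have := Measure.infinitePi_map_pi (μ := fun _ : ℕ => coin) (f := fun _ => not)
    (fun _ => .of_discrete)
  rw [bernoulli, this]
  simp [h]

end bernoulli

/-! ### Measurability of the tower maps -/

section measurability

variable {β : ℝ}

lemma measurable_digit : Measurable fun p : Omega × ℝ × ℝ => p.1 0 :=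
  (measurable_pi_apply 0).comp measurable_fst

lemma measurable_psiOn (w : List Bool) : Measurable (psiOn β w) := by
  have hd : ∀ f : Bool → ℝ, Measurable fun p : Omega × ℝ × ℝ => f (p.1 0) := fun f =>
    (Measurable.of_discrete (f := f)).comp measurable_digit
  have hs : Measurable fun p : Omega × ℝ × ℝ => shift p.1 := measurable_shift.comp measurable_fst
  have hx : Measurable fun p : Omega × ℝ × ℝ => p.2.1 := by fun_prop
  have hC1 := hd (C1 β w)
  have hC2 := hd (C2 β w)
  have hL : MeasurableSet {p : Omega × ℝ × ℝ | p.2.1 ∈ L β} := hx measurableSet_Ico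
  have hA : MeasurableSet {p : Omega × ℝ × ℝ | ActsByT1 β w (p.1 0)} :=
    measurable_digit (MeasurableSet.of_discrete (s := {b | ActsByT1 β w b}))
  unfold psiOn T0 T1
  refine Measurable.ite hA (Measurable.ite hL ?_ ?_) ?_ <;> fun_prop

lemma measurable_psi (h1 : 1 < β) : Measurable (psi β) := by
  intro B hB
  have : psi β ⁻¹' B = (⋃ w, (cell β w ∩ psiOn β w ⁻¹' B)) ∪ ((tower β)ᶜ ∩ B) := by
    ext p
    simp only [mem_preimage, mem_union, mem_iUnion, mem_inter_iff, mem_compl_iff]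
    by_cases hp : p ∈ tower β
    · obtain ⟨w, hw⟩ := mem_tower.1 hp
      rw [psi_of_mem h1 hw]
      constructor
      · exact fun h => Or.inl ⟨w, hw, h⟩
      · rintro (⟨u, hu, h⟩ | h)
        · rwa [cell_unique h1 (mem_cell.1 hw).2 (mem_cell.1 hu).2]
        · exact absurd hp h.1
    · have hn : ∀ w, p ∉ cell β w := fun w h => hp (mem_tower.2 ⟨w, h⟩)
      have : psi β p = p := by
        rw [psi, dif_neg]
        rintro ⟨w, hw⟩
        exact hn w hw
      simp [this, hn, hp]
  rw [this]
  exact (MeasurableSet.iUnion fun w => (measurableSet_cell w).inter (measurable_psiOn w hB)).union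
    (measurableSet_tower.compl.inter hB)

lemma measurable_refl : Measurable (refl β) := by
  have : Measurable fun p : Omega × ℝ × ℝ => (fun i => !(p.1 i) : Omega) :=
    measurable_pi_iff.2 fun i => (Measurable.of_discrete (f := not)).comp
      ((measurable_pi_apply i).comp measurable_fst)
  unfold refl
  fun_prop

lemma measurableSet_towerBar : MeasurableSet (towerBar β) := by
  rw [towerBar, refl_image_eq_preimage]
  exact measurable_refl measurableSet_tower

lemma measurableSet_doubleTower : MeasurableSet (doubleTower β) :=
  measurableSet_tower.union measurableSet_towerBar

lemma measurable_psiDouble (h1 : 1 < β) : Measurable (psiDouble β) :=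
  Measurable.ite measurableSet_tower (measurable_psi h1)
    (Measurable.ite measurableSet_towerBar
      (measurable_refl.comp ((measurable_psi h1).comp measurable_refl)) measurable_id)

lemma measurableSet_mismatch (w : List Bool) : MeasurableSet (mismatch β w) := by
  have hx : Measurable fun p : Omega × ℝ × ℝ => p.2.1 := by fun_prop
  exact (measurableSet_cell w).inter ((MeasurableSet.const _).inter
    ((measurable_digit (measurableSet_singleton false)).inter (hx measurableSet_Icc)))

lemma measurableSet_mismatchImage (h1 : 1 < β) (h2 : β < 2) :
    MeasurableSet (mismatchImage β) :=
  MeasurableSet.iUnion fun w => (measurableSet_mismatch w).image_of_measurable_injOn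
    (measurable_psi h1) ((injOn_psi h1 h2).mono (mismatch_subset_tower w))

lemma measurable_swap (h1 : 1 < β) (h2 : β < 2) : Measurable (swap β) := by
  have hM := measurableSet_mismatchImage h1 h2
  rw [swap_eq]
  refine Measurable.ite hM ?_ (Measurable.ite (measurable_refl hM) ?_ measurable_id) <;> fun_prop

lemma measurable_psiTilde (h1 : 1 < β) (h2 : β < 2) : Measurable (psiTilde β) :=
  (measurable_swap h1 h2).comp (measurable_psiDouble h1)

end measurability

/-! ### The tower maps preserve the measure of images -/

section volumes

variable {β : ℝ}

/-- The measure `m × λ × λ`. -/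
noncomputable def vol : Measure (Omega × ℝ × ℝ) := bernoulli.prod (volume.prod volume)

lemma vol_eq : vol = (2⁻¹ : ℝ≥0∞) • (bernoulli.map (cons false)).prod (volume.prod volume) +
    (2⁻¹ : ℝ≥0∞) • (bernoulli.map (cons true)).prod (volume.prod volume) := by
  have h := bernoulli_eq
  rw [vol]
  conv_lhs => rw [h]
  have (b : Bool) : IsProbabilityMeasure (bernoulli.map (cons b)) :=
    Measure.isProbabilityMeasure_map (measurable_cons b).aemeasurable
  rw [Measure.add_prod, Measure.prod_smul_left, Measure.prod_smul_left]

lemma vol_of_digit {b : Bool} {A : Set (Omega × ℝ × ℝ)} (hA : MeasurableSet A)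
    (hb : ∀ p ∈ A, p.1 0 = b) :
    vol A = 2⁻¹ * (bernoulli.map (cons b)).prod (volume.prod volume) A := by
  have hz : ∀ d, d ≠ b → (bernoulli.map (cons d)).prod (volume.prod volume) A = 0 := by
    intro d hd
    have := Measure.map_prod_map bernoulli ((volume : Measure ℝ).prod (volume : Measure ℝ))
      (measurable_cons d) measurable_id
    rw [Measure.map_id] at this
    rw [this, Measure.map_apply ((measurable_cons d).prodMap measurable_id) hA]
    have : Prod.map (cons d) id ⁻¹' A = ∅ :=
      eq_empty_of_forall_notMem fun p hp => hd (hb _ hp)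
    rw [this, measure_empty]
  rw [vol_eq, Measure.add_apply, Measure.smul_apply, Measure.smul_apply]
  cases b
  · rw [hz true (by simp)]; simp
  · rw [hz false (by simp)]; simp

/-- The branches of the tower map preserve volumes of images: the shift doubles the measure, the
second coordinate is stretched by `β` and the third contracted by `2β`. -/
lemma vol_image_branch (h1 : 1 < β) {b : Bool} (e C : ℝ) {A : Set (Omega × ℝ × ℝ)}
    (hA : MeasurableSet A) (hb : ∀ p ∈ A, p.1 0 = b) :
    vol ((fun p : Omega × ℝ × ℝ => (shift p.1, β * p.2.1 - e, C + p.2.2 / (2 * β))) '' A) =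
      vol A := by
  have hβ : 0 < β := by linarith
  set G₁ : ℝ → ℝ := fun x => β⁻¹ * (x + e)
  set G₂ : ℝ → ℝ := fun y => (2 * β) * (y + -C)
  have hG₁ : (volume : Measure ℝ).map G₁ = ENNReal.ofReal β • volume := by
    have : G₁ = (fun x => β⁻¹ * x) ∘ fun x => x + e := rfl
    rw [this, ← Measure.map_map (by fun_prop) (by fun_prop), map_add_right_eq_self,
      Real.map_volume_mul_left (by positivity), inv_inv, abs_of_pos hβ]
  have hG₂ : (volume : Measure ℝ).map G₂ = ENNReal.ofReal (2 * β)⁻¹ • volume := by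
    have : G₂ = (fun x => (2 * β) * x) ∘ fun x => x + -C := rfl
    rw [this, ← Measure.map_map (by fun_prop) (by fun_prop), map_add_right_eq_self,
      Real.map_volume_mul_left (by positivity), abs_of_pos (by positivity)]
  have hm₁ : Measurable G₁ := by fun_prop
  have hm₂ : Measurable G₂ := by fun_prop
  have himg : (fun p : Omega × ℝ × ℝ => (shift p.1, β * p.2.1 - e, C + p.2.2 / (2 * β))) '' A =
      Prod.map (cons b) (Prod.map G₁ G₂) ⁻¹' A := by
    ext q
    constructor
    · rintro ⟨p, hp, rfl⟩
      have : Prod.map (cons b) (Prod.map G₁ G₂)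
          (shift p.1, β * p.2.1 - e, C + p.2.2 / (2 * β)) = p := by
        refine Prod.ext ?_ (Prod.ext ?_ ?_)
        · simp only [Prod.map]
          rw [← hb p hp, cons_shift]
        · simp only [Prod.map, G₁]
          field_simp
          ring
        · simp only [Prod.map, G₂]
          field_simp
          ring
      rw [mem_preimage, this]
      exact hp
    · intro hq
      refine ⟨_, hq, Prod.ext rfl (Prod.ext ?_ ?_)⟩
      · simp only [Prod.map, G₁]
        field_simp
        ring
      · simp only [Prod.map, G₂]
        field_simp
        ring
  have (b : Bool) : IsProbabilityMeasure (bernoulli.map (cons b)) :=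
    Measure.isProbabilityMeasure_map (measurable_cons b).aemeasurable
  rw [himg, ← Measure.map_apply ((measurable_cons b).prodMap (hm₁.prodMap hm₂)) hA, vol,
    ← Measure.map_prod_map _ _ (measurable_cons b) (hm₁.prodMap hm₂),
    ← Measure.map_prod_map _ _ hm₁ hm₂, hG₁, hG₂, Measure.prod_smul_left,
    Measure.prod_smul_right, Measure.prod_smul_right, Measure.prod_smul_right,
    ← vol, vol_of_digit hA hb, Measure.smul_apply, Measure.smul_apply, smul_eq_mul, smul_eq_mul,
    ← mul_assoc, ← ENNReal.ofReal_mul hβ.le]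
  congr 1
  have : β * (2 * β)⁻¹ = 2⁻¹ := by field_simp
  rw [this, ENNReal.ofReal_inv_of_pos (by norm_num)]
  simp

lemma preservesImages_psi (h1 : 1 < β) (h2 : β < 2) :
    PreservesImages vol (psi β) (tower β) := by
  let D : List Bool × Bool × Bool → Set (Omega × ℝ × ℝ) := fun i =>
    {p | p ∈ cell β i.1 ∧ p.1 0 = i.2.1 ∧ decide (p.2.1 < 1 / β) = i.2.2}
  have hD : tower β = ⋃ i, D i := by
    ext p
    rw [mem_tower, mem_iUnion]
    exact ⟨fun ⟨w, hw⟩ => ⟨(w, _, _), hw, rfl, rfl⟩, fun ⟨i, hi⟩ => ⟨i.1, hi.1⟩⟩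
  rw [hD]
  refine PreservesImages.iUnion (fun i => ?_) (fun i => ?_) ?_ (measurable_psi h1)
    (hD ▸ injOn_psi h1 h2)
  · obtain ⟨w, b, d⟩ := i
    intro A hA hm
    have hb : ∀ p ∈ A, p.1 0 = b := fun p hp => (hA hp).2.1
    -- On each piece `ψ` is one affine branch.
    have key : ∃ e C, EqOn (psi β)
        (fun p => (shift p.1, β * p.2.1 - e, C + p.2.2 / (2 * β))) A := by
      have hr : ∀ (k : ℝ) (p : Omega × ℝ × ℝ), k + (p.2.2 - height β w) / (2 * β) =
          k - height β w / (2 * β) + p.2.2 / (2 * β) := fun k p => by ring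
      by_cases ha : ActsByT1 β w b
      · cases d
        · refine ⟨1, height β (w ++ [b]) - height β w / (2 * β), fun p hp => ?_⟩
          have hp' := hA hp
          rw [psi_acts h1 hp'.1 (by rw [hb p hp]; exact ha) (by simpa using hp'.2.2), hb p hp,
            hr]
        · refine ⟨0, descentBot β w b - height β w / (2 * β), fun p hp => ?_⟩
          have hp' := hA hp
          rw [psi_descends h1 hp'.1 ⟨by rw [hb p hp]; exact ha, by simpa using hp'.2.2⟩, hb p hp,
            hr]
          simp
      · refine ⟨0, height β (w ++ [b]) - height β w / (2 * β), fun p hp => ?_⟩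
        have hp' := hA hp
        rw [psi_not_acts h1 hp'.1 (by rw [hb p hp]; exact ha), hb p hp, hr]
        simp
    obtain ⟨e, C, hEq⟩ := key
    rw [hEq.image_eq, vol_image_branch h1 e C hm hb]
  · have hx : Measurable fun p : Omega × ℝ × ℝ => p.2.1 := by fun_prop
    have hdec : MeasurableSet {p : Omega × ℝ × ℝ | decide (p.2.1 < 1 / β) = i.2.2} := by
      cases i.2.2
      · have : {p : Omega × ℝ × ℝ | decide (p.2.1 < 1 / β) = false} =
            (fun p : Omega × ℝ × ℝ => p.2.1) ⁻¹' Ici (1 / β) := by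
          ext p; simp
        rw [this]
        exact hx measurableSet_Ici
      · have : {p : Omega × ℝ × ℝ | decide (p.2.1 < 1 / β) = true} =
            (fun p : Omega × ℝ × ℝ => p.2.1) ⁻¹' Iio (1 / β) := by
          ext p; simp
        rw [this]
        exact hx measurableSet_Iio
    exact (measurableSet_cell i.1).inter
      ((measurable_digit (measurableSet_singleton i.2.1)).inter hdec)
  · intro i j hij
    refine Set.disjoint_left.2 fun p hp hq => hij ?_
    exact Prod.ext (cell_unique h1 (mem_cell.1 hp.1).2 (mem_cell.1 hq.1).2)
      (Prod.ext (hp.2.1.symm.trans hq.2.1) (hp.2.2.symm.trans hq.2.2))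

lemma map_refl_vol : vol.map (refl β) = vol := by
  have hn : Measurable fun ω : Omega => (fun i => !(ω i) : Omega) :=
    measurable_pi_iff.2 fun i => (Measurable.of_discrete (f := not)).comp (measurable_pi_apply i)
  have e1 : (volume : Measure ℝ).map (fun x => 1 / (β - 1) - x) = volume :=
    (Measure.measurePreserving_sub_left volume _).map_eq
  have e2 : (volume : Measure ℝ).map (fun x => -x) = volume :=
    (Measure.measurePreserving_neg volume).map_eq
  have : refl β = Prod.map (fun ω i => !(ω i)) (Prod.map (fun x => 1 / (β - 1) - x) fun x => -x) :=
    rfl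
  rw [this, vol, ← Measure.map_prod_map _ _ hn (by fun_prop),
    ← Measure.map_prod_map _ _ (by fun_prop) (by fun_prop), e1, e2, map_not_bernoulli]

lemma vol_refl_image {A : Set (Omega × ℝ × ℝ)} (hA : MeasurableSet A) :
    vol (refl β '' A) = vol A := by
  rw [refl_image_eq_preimage, ← Measure.map_apply measurable_refl hA, map_refl_vol]

lemma vol_translate (a : ℝ) {A : Set (Omega × ℝ × ℝ)} (hA : MeasurableSet A) :
    vol ((fun p : Omega × ℝ × ℝ => (p.1, p.2.1 + a, -p.2.2)) '' A) = vol A := by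
  have e1 : (volume : Measure ℝ).map (fun x => x + -a) = volume := map_add_right_eq_self _ _
  have e2 : (volume : Measure ℝ).map (fun x => -x) = volume :=
    (Measure.measurePreserving_neg volume).map_eq
  have hm : Measurable (Prod.map id (Prod.map (fun x => x + -a) fun x => -x) :
      Omega × ℝ × ℝ → Omega × ℝ × ℝ) := by fun_prop
  have himg : (fun p : Omega × ℝ × ℝ => (p.1, p.2.1 + a, -p.2.2)) '' A =
      Prod.map id (Prod.map (fun x => x + -a) fun x => -x) ⁻¹' A := by
    ext q
    constructor
    · rintro ⟨p, hp, rfl⟩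
      simpa [Prod.map] using hp
    · intro hq
      exact ⟨_, hq, by simp [Prod.map]⟩
  have hv : vol.map (Prod.map id (Prod.map (fun x => x + -a) fun x => -x)) = vol := by
    rw [vol, ← Measure.map_prod_map _ _ measurable_id (by fun_prop),
      ← Measure.map_prod_map _ _ (by fun_prop) (by fun_prop), e1, e2, Measure.map_id]
  rw [himg, ← Measure.map_apply hm hA, hv]

lemma preservesImages_swap (h1 : 1 < β) (h2 : β < 2) :
    PreservesImages vol (swap β) univ := by
  have hM := measurableSet_mismatchImage h1 h2
  have hM' : MeasurableSet (refl β ⁻¹' mismatchImage β) := measurable_refl hM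
  let D : Option Bool → Set (Omega × ℝ × ℝ) := fun i => match i with
    | some true => mismatchImage β
    | some false => refl β ⁻¹' mismatchImage β
    | none => (mismatchImage β ∪ refl β ⁻¹' mismatchImage β)ᶜ
  have hU : (univ : Set (Omega × ℝ × ℝ)) = ⋃ i, D i := by
    refine (eq_univ_of_forall fun p => mem_iUnion.2 ?_).symm
    by_cases hp : p ∈ mismatchImage β
    · exact ⟨some true, hp⟩
    by_cases hp' : p ∈ refl β ⁻¹' mismatchImage β
    · exact ⟨some false, hp'⟩
    · exact ⟨none, fun h => h.elim hp hp'⟩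
  have hdis : Disjoint (mismatchImage β) (refl β ⁻¹' mismatchImage β) := by
    refine Set.disjoint_left.2 fun p hp hp' => ?_
    have a := one_le_y_of_mem_mismatchImage h1 h2 hp
    have b := one_le_y_of_mem_mismatchImage h1 h2 hp'
    rw [refl_y] at b
    linarith
  rw [hU]
  refine PreservesImages.iUnion ?_ ?_ ?_ (measurable_swap h1 h2)
    (Function.LeftInverse.injective (swap_swap h1 h2)).injOn
  · rintro (_ | _ | _) A hA hm
    · have : EqOn (swap β) id A := fun p hp =>
        swap_of_notMem (fun h => hA hp (Or.inl h)) (fun h => hA hp (Or.inr h))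
      rw [this.image_eq, image_id]
    · have : EqOn (swap β) (fun p => (p.1, p.2.1 + -1, -p.2.2)) A := fun p hp => by
        rw [swap_of_refl_mem h1 h2 (hA hp), sub_eq_add_neg]
      rw [this.image_eq, vol_translate _ hm]
    · have : EqOn (swap β) (fun p => (p.1, p.2.1 + 1, -p.2.2)) A := fun p hp =>
        swap_of_mem (hA hp)
      rw [this.image_eq, vol_translate _ hm]
  · rintro (_ | _ | _)
    · exact (hM.union hM').compl
    · exact hM'
    · exact hM
  · have key : ∀ s t : Set (Omega × ℝ × ℝ),
        Disjoint (s ∪ t)ᶜ s ∧ Disjoint (s ∪ t)ᶜ t := fun s t =>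
      ⟨disjoint_compl_left.mono_right subset_union_left,
        disjoint_compl_left.mono_right subset_union_right⟩
    rintro (_ | _ | _) (_ | _ | _) hij
    · exact absurd rfl hij
    · exact (key _ _).2
    · exact (key _ _).1
    · exact (key _ _).2.symm
    · exact absurd rfl hij
    · exact hdis.symm
    · exact (key _ _).1.symm
    · exact hdis
    · exact absurd rfl hij

lemma vol_y_eq_zero : vol {p : Omega × ℝ × ℝ | p.2.2 = 0} = 0 := by
  have : {p : Omega × ℝ × ℝ | p.2.2 = 0} = univ ×ˢ (univ ×ˢ {0}) := by
    ext p; simp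
  rw [this, vol, Measure.prod_prod, Measure.prod_prod]
  simp

lemma towerMeasure_eq : towerMeasure β = vol.restrict (doubleTower β) := rfl

lemma vol_doubleTower_ne_top (h1 : 1 < β) (h2 : β < 2) : vol (doubleTower β) ≠ ∞ := by
  have hsub : tower β ⊆ univ ×ˢ (Icc 0 (1 / (β - 1)) ×ˢ Icc 0 (β / (β - 1))) := by
    intro p hp
    obtain ⟨w, hw⟩ := mem_tower.1 hp
    exact ⟨mem_univ _, x_mem_of_mem_cell h1 h2 hw, y_nonneg_of_mem_cell h1 hw,
      ((y_lt_of_mem_cell h1 hw).trans (levelBot_lt h1 _)).le⟩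
  have ht : vol (tower β) ≠ ∞ := by
    refine ne_top_of_le_ne_top ?_ (measure_mono hsub)
    rw [vol, Measure.prod_prod, Measure.prod_prod, measure_univ, one_mul, Real.volume_Icc,
      Real.volume_Icc]
    exact ENNReal.mul_ne_top ENNReal.ofReal_ne_top ENNReal.ofReal_ne_top
  refine ne_top_of_le_ne_top ?_ (measure_union_le _ _)
  rw [towerBar, vol_refl_image measurableSet_tower]
  exact ENNReal.add_ne_top.2 ⟨ht, ht⟩

lemma isFiniteMeasure_towerMeasure (h1 : 1 < β) (h2 : β < 2) :
    IsFiniteMeasure (towerMeasure β) :=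
  isFiniteMeasure_restrict.2 (vol_doubleTower_ne_top h1 h2)

/-- The part of the double tower off `{y = 0}` whose image also avoids `{y = 0}`. -/
def regular (β : ℝ) : Set (Omega × ℝ × ℝ) :=
  {p | p ∈ doubleTower β ∧ p.2.2 ≠ 0 ∧ (psiDouble β p).2.2 ≠ 0}

lemma regular_subset : regular β ⊆ doubleTower β := fun _ h => h.1

lemma measurableSet_regular (h1 : 1 < β) : MeasurableSet (regular β) := by
  have hy : Measurable fun p : Omega × ℝ × ℝ => p.2.2 := by fun_prop
  have h0 : MeasurableSet {p : Omega × ℝ × ℝ | p.2.2 ≠ 0} := hy (measurableSet_singleton 0).compl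
  exact measurableSet_doubleTower.inter (h0.inter (measurable_psiDouble h1 h0))

/-- Each rule is injective on its tower, and off `{y = 0}` the sign of the height of the image tells
which tower the point came from. -/
lemma injOn_psiDouble_regular (h1 : 1 < β) (h2 : β < 2) :
    InjOn (psiDouble β) (regular β) := by
  have hsign : ∀ p ∈ regular β, p ∈ tower β → 0 < (psiDouble β p).2.2 := by
    intro p hp ht
    refine lt_of_le_of_ne ?_ (Ne.symm hp.2.2)
    rw [psiDouble_of_mem ht]
    exact y_nonneg_of_mem_tower h1 (mapsTo_psi h1 h2 ht)
  have hsign' : ∀ p ∈ regular β, p ∉ tower β → (psiDouble β p).2.2 < 0 := by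
    intro p hp ht
    refine lt_of_le_of_ne ?_ hp.2.2
    have hb := hp.1.resolve_left ht
    rw [psiDouble_of_mem_bar ht hb, refl_y]
    linarith [y_nonneg_of_mem_tower h1 (mapsTo_psi h1 h2 (mem_towerBar.1 hb))]
  intro p hp q hq hpq
  by_cases htp : p ∈ tower β <;> by_cases htq : q ∈ tower β
  · rw [psiDouble_of_mem htp, psiDouble_of_mem htq] at hpq
    exact injOn_psi h1 h2 htp htq hpq
  · have a := hsign p hp htp
    have b := hsign' q hq htq
    rw [hpq] at a
    linarith
  · have a := hsign' p hp htp
    have b := hsign q hq htq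
    rw [hpq] at a
    linarith
  · have hbp := hp.1.resolve_left htp
    have hbq := hq.1.resolve_left htq
    rw [psiDouble_of_mem_bar htp hbp, psiDouble_of_mem_bar htq hbq] at hpq
    exact refl_injective (injOn_psi h1 h2 (mem_towerBar.1 hbp) (mem_towerBar.1 hbq)
      (refl_injective hpq))

lemma preservesImages_psiBar (h1 : 1 < β) (h2 : β < 2) :
    PreservesImages vol (psiBar β) (towerBar β) := by
  intro A hA hm
  have h : psiBar β '' A = refl β '' (psi β '' (refl β '' A)) := by
    simp only [image_image]
    rfl
  have hsub : refl β '' A ⊆ tower β := by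
    rintro _ ⟨p, hp, rfl⟩
    exact mem_towerBar.1 (hA hp)
  have hm' : MeasurableSet (refl β '' A) := by
    rw [refl_image_eq_preimage]
    exact measurable_refl hm
  rw [h, vol_refl_image (hm'.image_of_measurable_injOn (measurable_psi h1)
    ((injOn_psi h1 h2).mono hsub)), preservesImages_psi h1 h2 _ hsub hm', vol_refl_image hm]

lemma preservesImages_psiDouble (h1 : 1 < β) (h2 : β < 2) :
    PreservesImages vol (psiDouble β) (regular β) := by
  let D : Bool → Set (Omega × ℝ × ℝ) := fun b =>
    if b then regular β ∩ tower β else regular β \ tower β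
  have hD : regular β = ⋃ b, D b := by
    rw [← union_eq_iUnion.trans (iUnion_congr fun b => by cases b <;> rfl), inter_union_sdiff]
  rw [hD]
  have hr := measurableSet_regular h1
  refine PreservesImages.iUnion ?_ ?_ ?_ (measurable_psiDouble h1)
    (hD ▸ injOn_psiDouble_regular h1 h2)
  · rintro (_ | _)
    · refine ((preservesImages_psiBar h1 h2).mono (fun p hp => ?_)).congr fun p hp => ?_
      · exact hp.1.1.resolve_left hp.2
      · exact (psiDouble_of_mem_bar hp.2 (hp.1.1.resolve_left hp.2)).symm
    · exact ((preservesImages_psi h1 h2).mono inter_subset_right).congr fun p hp =>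
        (psiDouble_of_mem hp.2).symm
  · rintro (_ | _)
    · exact hr.diff measurableSet_tower
    · exact hr.inter measurableSet_tower
  · have hd : Disjoint (regular β ∩ tower β) (regular β \ tower β) :=
      Set.disjoint_left.2 fun p hp hp' => hp'.2 hp.2
    rintro (_ | _) (_ | _) hij
    · exact absurd rfl hij
    · exact hd.symm
    · exact hd
    · exact absurd rfl hij

lemma injOn_psiTilde_regular (h1 : 1 < β) (h2 : β < 2) : InjOn (psiTilde β) (regular β) :=
  (Function.LeftInverse.injective (swap_swap h1 h2)).comp_injOn (injOn_psiDouble_regular h1 h2)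

lemma vol_diff_regular (h1 : 1 < β) (h2 : β < 2) : vol (doubleTower β \ regular β) = 0 := by
  have hy : Measurable fun p : Omega × ℝ × ℝ => p.2.2 := by fun_prop
  have h0 : MeasurableSet {p : Omega × ℝ × ℝ | p.2.2 = 0} := hy (measurableSet_singleton 0)
  have hE : vol (tower β ∩ psi β ⁻¹' {p | p.2.2 = 0}) = 0 := by
    rw [← preservesImages_psi h1 h2 _ inter_subset_left
      (measurableSet_tower.inter (measurable_psi h1 h0))]
    refine measure_mono_null ?_ vol_y_eq_zero
    rintro _ ⟨p, hp, rfl⟩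
    exact hp.2
  have hB : vol (towerBar β ∩ psiBar β ⁻¹' {p | p.2.2 = 0}) = 0 := by
    have hm : Measurable (psiBar β) :=
      measurable_refl.comp ((measurable_psi h1).comp measurable_refl)
    rw [← preservesImages_psiBar h1 h2 _ inter_subset_left (measurableSet_towerBar.inter (hm h0))]
    refine measure_mono_null ?_ vol_y_eq_zero
    rintro _ ⟨p, hp, rfl⟩
    exact hp.2
  refine measure_mono_null (t := {p | p.2.2 = 0} ∪ ((tower β ∩ psi β ⁻¹' {p | p.2.2 = 0}) ∪
    (towerBar β ∩ psiBar β ⁻¹' {p | p.2.2 = 0}))) ?_ ?_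
  · rintro p ⟨hp, hn⟩
    by_cases hy : p.2.2 = 0
    · exact Or.inl hy
    right
    have hz : (psiDouble β p).2.2 = 0 := by
      by_contra h
      exact hn ⟨hp, hy, h⟩
    by_cases ht : p ∈ tower β
    · rw [psiDouble_of_mem ht] at hz
      exact Or.inl ⟨ht, hz⟩
    · have hb := hp.resolve_left ht
      rw [psiDouble_of_mem_bar ht hb] at hz
      exact Or.inr ⟨hb, hz⟩
  · rw [measure_union_null_iff, measure_union_null_iff]
    exact ⟨vol_y_eq_zero, hE, hB⟩

lemma preservesImages_psiTilde (h1 : 1 < β) (h2 : β < 2) :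
    PreservesImages vol (psiTilde β) (regular β) :=
  (preservesImages_swap h1 h2).comp (preservesImages_psiDouble h1 h2) (measurable_psiDouble h1)
    (injOn_psiDouble_regular h1 h2)

lemma measurePreserving_psiTilde (h1 : 1 < β) (h2 : β < 2) :
    MeasurePreserving (psiTilde β) (towerMeasure β) (towerMeasure β) :=
  (preservesImages_psiTilde h1 h2).measurePreserving (measurable_psiTilde h1 h2)
    (vol_doubleTower_ne_top h1 h2) (mapsTo_psiTilde h1 h2) (measurableSet_regular h1)
    regular_subset (vol_diff_regular h1 h2)

lemma towerMeasure_compl_regular (h1 : 1 < β) (h2 : β < 2) :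
    towerMeasure β (regular β)ᶜ = 0 := by
  rw [towerMeasure_eq, Measure.restrict_apply (measurableSet_regular h1).compl]
  refine measure_mono_null ?_ (vol_diff_regular h1 h2)
  rintro p ⟨hp, hd⟩
  exact ⟨hd, hp⟩

/-- The inverse of `ψ̃` on an invariant set of full measure. -/
lemma exists_inverse_psiTilde (h1 : 1 < β) (h2 : β < 2) :
    ∃ (U : Omega × ℝ × ℝ → Omega × ℝ × ℝ) (X₀ : Set (Omega × ℝ × ℝ)),
      MeasurePreserving U (towerMeasure β) (towerMeasure β) ∧ X₀ ⊆ regular β ∧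
      MeasurableSet X₀ ∧ towerMeasure β X₀ᶜ = 0 ∧ MapsTo (psiTilde β) X₀ X₀ ∧ MapsTo U X₀ X₀ ∧
      LeftInvOn U (psiTilde β) X₀ ∧ LeftInvOn (psiTilde β) U X₀ :=
  have := isFiniteMeasure_towerMeasure h1 h2
  (measurePreserving_psiTilde h1 h2).exists_inverse (measurableSet_regular h1)
    (towerMeasure_compl_regular h1 h2) (injOn_psiTilde_regular h1 h2)

lemma measurable_proj : Measurable proj := by unfold proj; fun_prop

lemma vol_proj_preimage_inter {A : Set (Omega × ℝ)} (hm : MeasurableSet A) {Y : Set ℝ}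
    (hY : MeasurableSet Y) :
    vol (proj ⁻¹' A ∩ {p | p.2.2 ∈ Y}) = bernoulli.prod volume A * volume Y := by
  have hass := (measurePreserving_prodAssoc bernoulli (volume : Measure ℝ) (volume : Measure ℝ))
  have hy : Measurable fun p : Omega × ℝ × ℝ => p.2.2 := by fun_prop
  have hs : MeasurableSet (proj ⁻¹' A ∩ {p : Omega × ℝ × ℝ | p.2.2 ∈ Y}) :=
    (measurable_proj hm).inter (hy hY)
  rw [vol, ← hass.measure_preimage hs.nullMeasurableSet]
  have : MeasurableEquiv.prodAssoc ⁻¹' (proj ⁻¹' A ∩ {p : Omega × ℝ × ℝ | p.2.2 ∈ Y}) =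
      A ×ˢ Y := by
    ext ⟨⟨a, b⟩, c⟩
    simp [MeasurableEquiv.prodAssoc, proj]
  rw [this, Measure.prod_prod]

/-- The base `Ω × [0,1] × [0,1)` bounds the fibres of the double tower from below. -/
lemma towerMeasure_ge_of_unit {A : Set (Omega × ℝ)} (hA : ∀ v ∈ A, v.2 ∈ Icc (0 : ℝ) 1)
    (hm : MeasurableSet A) :
    bernoulli.prod volume A ≤ towerMeasure β (proj ⁻¹' A) := by
  have h : bernoulli.prod volume A = vol (proj ⁻¹' A ∩ {p | p.2.2 ∈ Ico (0 : ℝ) 1}) := by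
    rw [vol_proj_preimage_inter hm measurableSet_Ico]
    simp
  rw [h, towerMeasure_eq, Measure.restrict_apply (measurable_proj hm)]
  refine measure_mono ?_
  rintro p ⟨hp, hy⟩
  refine ⟨hp, Or.inl (mem_tower.2 ⟨[], mem_cell.2 ?_⟩)⟩
  rw [rightEnd_nil, height_nil, thick_nil, zero_add]
  exact ⟨hA _ hp, hy⟩

lemma towerMeasure_univ_pos : 0 < towerMeasure β univ := by
  have h := towerMeasure_ge_of_unit (β := β) (A := univ ×ˢ Icc 0 1) (fun v hv => hv.2)
    (MeasurableSet.univ.prod measurableSet_Icc)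
  rw [Measure.prod_prod] at h
  simp only [measure_univ, Real.volume_Icc, sub_zero, ENNReal.ofReal_one, mul_one] at h
  exact lt_of_lt_of_le (lt_of_lt_of_le one_pos h) (measure_mono (subset_univ _))

end volumes

/-! ### Invariant measures of product type and stationary measures -/

section stationary

variable {β : ℝ}

/-- `μ` is stationary for the random choice of the maps `R_{β,0}` and `R_{β,1}` by a fair coin. -/
def Stationary (β : ℝ) (μ : Measure ℝ) : Prop :=
  (2⁻¹ : ℝ≥0∞) • μ.map (fibreMap β false) + (2⁻¹ : ℝ≥0∞) • μ.map (fibreMap β true) = μ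

lemma measurable_fibreMap (b : Bool) : Measurable (fibreMap β b) := by
  unfold fibreMap T0 T1
  refine Measurable.ite measurableSet_Ico (by fun_prop) (Measurable.ite measurableSet_Icc ?_
    (Measurable.ite measurableSet_Ioc (by fun_prop) measurable_id))
  cases b
  · simp only [Bool.false_eq_true, if_false]; fun_prop
  · simp only [if_true]; fun_prop

lemma measurable_fibreMap_uncurry : Measurable fun p : Omega × ℝ => fibreMap β (p.1 0) p.2 := by
  have h : Measurable fun q : Bool × ℝ => fibreMap β q.1 q.2 :=
    measurable_from_prod_countable_right fun b => measurable_fibreMap b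
  have g : Measurable fun p : Omega × ℝ => (p.1 0, p.2) :=
    ((measurable_pi_apply 0).comp measurable_fst).prodMk measurable_snd
  exact h.comp g

lemma measurable_skew : Measurable (skew β) :=
  (measurable_shift.comp measurable_fst).prodMk measurable_fibreMap_uncurry

lemma measurable_randomMap : Measurable (randomMap β) := by
  have hS : MeasurableSet {p : Omega × ℝ | p.2 ∈ S β} := measurable_snd measurableSet_Icc
  exact (Measurable.ite hS (measurable_shift.comp measurable_fst) measurable_fst).prodMk
    measurable_fibreMap_uncurry

lemma bernoulli_prod_eq (μ : Measure ℝ) [IsFiniteMeasure μ] : bernoulli.prod μ =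
    (2⁻¹ : ℝ≥0∞) • (bernoulli.prod μ).map (Prod.map (cons false) id) +
    (2⁻¹ : ℝ≥0∞) • (bernoulli.prod μ).map (Prod.map (cons true) id) := by
  have (b : Bool) : IsProbabilityMeasure (bernoulli.map (cons b)) :=
    Measure.isProbabilityMeasure_map (measurable_cons b).aemeasurable
  have h : ∀ b, (bernoulli.prod μ).map (Prod.map (cons b) id) = (bernoulli.map (cons b)).prod μ :=
    fun b => by rw [← Measure.map_prod_map _ _ (measurable_cons b) measurable_id, Measure.map_id]
  rw [h, h, ← Measure.prod_smul_left, ← Measure.prod_smul_left, ← Measure.add_prod,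
    ← bernoulli_eq]

/-- The skew product moves `m × μ` to `m × (average of the images of μ)`. -/
lemma map_skew (μ : Measure ℝ) [IsFiniteMeasure μ] : (bernoulli.prod μ).map (skew β) =
    bernoulli.prod ((2⁻¹ : ℝ≥0∞) • μ.map (fibreMap β false) +
      (2⁻¹ : ℝ≥0∞) • μ.map (fibreMap β true)) := by
  have h : ∀ b, ((bernoulli.prod μ).map (Prod.map (cons b) id)).map (skew β) =
      bernoulli.prod (μ.map (fibreMap β b)) := by
    intro b
    have hc : skew β ∘ Prod.map (cons b) id = Prod.map id (fibreMap β b) := rfl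
    rw [Measure.map_map measurable_skew ((measurable_cons b).prodMap measurable_id), hc,
      ← Measure.map_prod_map _ _ measurable_id (measurable_fibreMap b), Measure.map_id]
  conv_lhs => rw [bernoulli_prod_eq μ]
  rw [Measure.map_add _ _ measurable_skew, Measure.map_smul, Measure.map_smul, h, h,
    Measure.prod_add, Measure.prod_smul_right, Measure.prod_smul_right]

/-- `K_β` and the skew product move `m × μ` to the same measure: on `Ω × S` they agree, and
elsewhere the fibre map does not depend on the digit. -/
lemma map_randomMap (μ : Measure ℝ) [IsFiniteMeasure μ] :
    (bernoulli.prod μ).map (randomMap β) = (bernoulli.prod μ).map (skew β) := by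
  have hS : MeasurableSet (S β) := measurableSet_Icc
  have hμ : μ = μ.restrict (S β) + μ.restrict (S β)ᶜ :=
    (Measure.restrict_add_restrict_compl hS).symm
  have hres : ∀ s : Set ℝ, bernoulli.prod (μ.restrict s) =
      (bernoulli.prod μ).restrict (univ ×ˢ s) := fun s => by
    rw [← Measure.prod_restrict, Measure.restrict_univ]
  have hon : (bernoulli.prod (μ.restrict (S β))).map (randomMap β) =
      (bernoulli.prod (μ.restrict (S β))).map (skew β) := by
    refine Measure.map_congr ?_
    rw [hres]
    filter_upwards [ae_restrict_mem (MeasurableSet.univ.prod hS)] with p hp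
    simp [randomMap, skew, hp.2]
  have hindep : ∀ (b d : Bool) (x : ℝ), x ∉ S β → fibreMap β b x = fibreMap β d x := by
    intro b d x hx
    simp only [fibreMap, if_neg hx]
  have hoff : (bernoulli.prod (μ.restrict (S β)ᶜ)).map (randomMap β) =
      (bernoulli.prod (μ.restrict (S β)ᶜ)).map (skew β) := by
    have e1 : (bernoulli.prod (μ.restrict (S β)ᶜ)).map (randomMap β) =
        (bernoulli.prod (μ.restrict (S β)ᶜ)).map (Prod.map id (fibreMap β false)) := by
      refine Measure.map_congr ?_
      rw [hres]
      filter_upwards [ae_restrict_mem (MeasurableSet.univ.prod hS.compl)] with p hp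
      have : p.2 ∉ S β := hp.2
      simp [randomMap, this, Prod.map, hindep (p.1 0) false _ this]
    have e2 : (μ.restrict (S β)ᶜ).map (fibreMap β true) =
        (μ.restrict (S β)ᶜ).map (fibreMap β false) := by
      refine Measure.map_congr ?_
      filter_upwards [ae_restrict_mem hS.compl] with x hx using hindep _ _ _ hx
    rw [e1, map_skew, e2, ← Measure.map_prod_map _ _ measurable_id (measurable_fibreMap false),
      Measure.map_id, ← add_smul, ENNReal.inv_two_add_inv_two, one_smul]
  rw [hμ, Measure.prod_add, Measure.map_add _ _ measurable_randomMap,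
    Measure.map_add _ _ measurable_skew, hon, hoff]

lemma stationary_of_map_skew {μ : Measure ℝ} [IsFiniteMeasure μ]
    (h : (bernoulli.prod μ).map (skew β) = bernoulli.prod μ) : Stationary β μ := by
  rw [map_skew] at h
  have := congrArg Measure.snd h
  rwa [Measure.snd_prod, Measure.snd_prod] at this

lemma Stationary.map_skew_eq {μ : Measure ℝ} [IsFiniteMeasure μ] (h : Stationary β μ) :
    (bernoulli.prod μ).map (skew β) = bernoulli.prod μ := by
  rw [map_skew, h]

lemma Stationary.measurePreserving_skew {μ : Measure ℝ} [IsFiniteMeasure μ]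
    (h : Stationary β μ) : MeasurePreserving (skew β) (bernoulli.prod μ) (bernoulli.prod μ) :=
  ⟨measurable_skew, h.map_skew_eq⟩

lemma Stationary.apply {μ : Measure ℝ} (h : Stationary β μ) {A : Set ℝ} (hA : MeasurableSet A) :
    μ A = 2⁻¹ * μ (fibreMap β false ⁻¹' A) + 2⁻¹ * μ (fibreMap β true ⁻¹' A) := by
  conv_lhs => rw [← h]
  rw [Measure.add_apply, Measure.smul_apply, Measure.smul_apply,
    Measure.map_apply (measurable_fibreMap _) hA, Measure.map_apply (measurable_fibreMap _) hA,
    smul_eq_mul, smul_eq_mul]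

lemma Stationary.real_apply {μ : Measure ℝ} [IsFiniteMeasure μ] (h : Stationary β μ) {A : Set ℝ}
    (hA : MeasurableSet A) :
    μ.real A = (μ.real (fibreMap β false ⁻¹' A) + μ.real (fibreMap β true ⁻¹' A)) / 2 := by
  rw [Measure.real, h.apply hA, ENNReal.toReal_add (by finiteness) (by finiteness),
    ENNReal.toReal_mul, ENNReal.toReal_mul]
  simp [Measure.real]
  ring

lemma Stationary.quasiMeasurePreserving {μ : Measure ℝ} (h : Stationary β μ) (b : Bool) :
    Measure.QuasiMeasurePreserving (fibreMap β b) μ μ := by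
  refine ⟨measurable_fibreMap b, Measure.AbsolutelyContinuous.mk fun A hA h0 => ?_⟩
  rw [h.apply hA] at h0
  rw [Measure.map_apply (measurable_fibreMap b) hA]
  cases b
  · simpa using (add_eq_zero.1 h0).1
  · simpa using (add_eq_zero.1 h0).2

end stationary

/-! ### Forward invariant sets contain the switch region -/

section expansion

variable {β : ℝ}

lemma volume_preimage_affine (h1 : 1 < β) (e : ℝ) (B : Set ℝ) :
    volume ((fun x => β * x - e) ⁻¹' B) = ENNReal.ofReal β⁻¹ * volume B := by
  have : (fun x => β * x - e) ⁻¹' B = (fun x => β * x) ⁻¹' ((fun x => x + -e) ⁻¹' B) := rfl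
  rw [this, Real.volume_preimage_mul_left (by linarith), measure_preimage_add_right,
    abs_of_pos (by positivity)]

lemma volume_expand_le (h1 : 1 < β) {A : Set ℝ} {d : Bool} {a b e : ℝ} (h0 : 0 ≤ a)
    (hc : b ≤ 1 / (β - 1)) (hA : ∀ᵐ x, x ∈ A → x ∈ I β → fibreMap β d x ∈ A)
    (hd : ∀ x ∈ Icc a b, fibreMap β d x = β * x - e) :
    volume (Icc (β * a - e) (β * b - e) \ A) ≤ ENNReal.ofReal β * volume (Icc a b \ A) := by
  have hβ : 0 < β := by linarith
  have h : volume ((fun x => β * x - e) ⁻¹' (Icc (β * a - e) (β * b - e) \ A)) ≤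
      volume (Icc a b \ A) := by
    refine measure_mono_ae ?_
    filter_upwards [hA] with x hx hx'
    have hm : x ∈ Icc a b := by
      have k1 := hx'.1.1
      have k2 := hx'.1.2
      simp only [sub_le_sub_iff_right] at k1 k2
      exact ⟨le_of_mul_le_mul_left k1 hβ, le_of_mul_le_mul_left k2 hβ⟩
    refine ⟨hm, fun hxA => hx'.2 ?_⟩
    have := hx hxA ⟨h0.trans hm.1, hm.2.trans hc⟩
    rwa [hd x hm] at this
  rw [volume_preimage_affine h1] at h
  calc volume (Icc (β * a - e) (β * b - e) \ A)
      = ENNReal.ofReal β * (ENNReal.ofReal β⁻¹ * volume (Icc (β * a - e) (β * b - e) \ A)) := by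
        rw [← mul_assoc, ← ENNReal.ofReal_mul hβ.le, mul_inv_cancel₀ hβ.ne']
        simp
    _ ≤ _ := by gcongr

/-- An interval which does not contain `S` is expanded by one of the two maps without being cut.
So an interval mostly contained in a forward invariant set grows until it contains `S`. -/
lemma volume_S_diff_le (h1 : 1 < β) (h2 : β < 2) {A : Set ℝ}
    (hA : ∀ᵐ x, x ∈ A → x ∈ I β → ∀ d, fibreMap β d x ∈ A) (ε : ℝ≥0∞) (n : ℕ) :
    ∀ a b : ℝ, a < b → 0 ≤ a → b ≤ 1 / (β - 1) → 1 / (β - 1) < β ^ n * (b - a) →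
      volume (Icc a b \ A) ≤ ε * ENNReal.ofReal (b - a) →
      volume (S β \ A) ≤ ε * ENNReal.ofReal (1 / (β - 1)) := by
  have hβ : 0 < β := by linarith
  have e1 := beta_mul_inv h1
  have e2 := beta_mul_c h1
  have e4 := inv_lt_S_right h1 h2
  have hA' : ∀ d, ∀ᵐ x, x ∈ A → x ∈ I β → fibreMap β d x ∈ A := fun d => by
    filter_upwards [hA] with x hx h h' using hx h h' d
  induction n with
  | zero =>
    intro a b _ h0 hc hn _
    linarith
  | succ n ih =>
    intro a b hab h0 hc hn hv
    have step : ∀ (d : Bool) (e : ℝ), (∀ x ∈ Icc a b, fibreMap β d x = β * x - e) →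
        0 ≤ β * a - e → β * b - e ≤ 1 / (β - 1) →
        volume (S β \ A) ≤ ε * ENNReal.ofReal (1 / (β - 1)) := by
      intro d e hd k0 kc
      refine ih (β * a - e) (β * b - e) (by nlinarith) k0 kc ?_ ?_
      · rw [pow_succ] at hn
        linarith
      · refine (volume_expand_le h1 h0 hc (hA' d) hd).trans ?_
        have : β * b - e - (β * a - e) = β * (b - a) := by ring
        rw [this, ENNReal.ofReal_mul hβ.le]
        calc _ ≤ ENNReal.ofReal β * (ε * ENNReal.ofReal (b - a)) := by gcongr
          _ = _ := by ring
    by_cases ha : 1 / β < a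
    · refine step true 1 (fun x hx => fibreMap_true h1 h2 (ha.le.trans hx.1) (hx.2.trans hc)) ?_ ?_
      · nlinarith
      · nlinarith
    by_cases hb : b < 1 / (β - 1) - 1 / β
    · refine step false 0 (fun x hx => ?_) ?_ ?_
      · rw [fibreMap_false h1 (h0.trans hx.1) (hx.2.trans hb.le), sub_zero]
      · nlinarith
      · nlinarith
    · have hSsub : S β ⊆ Icc a b := by
        intro x hx
        rw [S, S_right h1] at hx
        exact ⟨(not_lt.1 ha).trans hx.1, hx.2.trans (not_lt.1 hb)⟩
      calc volume (S β \ A) ≤ volume (Icc a b \ A) :=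
            measure_mono (sdiff_subset_sdiff_left hSsub)
        _ ≤ ε * ENNReal.ofReal (b - a) := hv
        _ ≤ _ := by
          gcongr
          linarith

lemma volume_S_diff_eq_zero (h1 : 1 < β) (h2 : β < 2) {A : Set ℝ} (hAm : MeasurableSet A)
    (hA : ∀ᵐ x, x ∈ A → x ∈ I β → ∀ d, fibreMap β d x ∈ A) (hpos : volume (A ∩ I β) ≠ 0) :
    volume (S β \ A) = 0 := by
  have hβ : 0 < β := by linarith
  have hc1 := one_lt_c h1 h2
  have hpos' : volume (A ∩ Ioo 0 (1 / (β - 1))) ≠ 0 := by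
    have : volume (A ∩ Ioo 0 (1 / (β - 1))) = volume (A ∩ I β) :=
      measure_congr (Filter.EventuallyEq.rfl.inter Ioo_ae_eq_Icc)
    rwa [this]
  have hd := Besicovitch.ae_tendsto_measure_inter_div (volume : Measure ℝ)
    (A ∩ Ioo 0 (1 / (β - 1)))
  obtain ⟨x, ⟨hxA, hx0, hxc⟩, hx⟩ : ∃ x, x ∈ A ∩ Ioo 0 (1 / (β - 1)) ∧
      Filter.Tendsto (fun r => volume (A ∩ Ioo 0 (1 / (β - 1)) ∩ Metric.closedBall x r) /
        volume (Metric.closedBall x r)) (nhdsWithin 0 (Ioi 0)) (nhds 1) := by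
    rw [ae_restrict_iff' (hAm.inter measurableSet_Ioo)] at hd
    by_contra hcon
    push Not at hcon
    refine hpos' (measure_mono_null ?_ hd)
    intro x hx h
    exact hcon x hx (h hx)
  -- Around the density point `x` there are intervals in which the complement of `A` has an
  -- arbitrarily small proportion `ε`.
  have key : ∀ ε : ℝ, 0 < ε → ε < 1 →
      volume (S β \ A) ≤ ENNReal.ofReal ε * ENNReal.ofReal (1 / (β - 1)) := by
    intro ε hε hε1
    have hlt : ENNReal.ofReal (1 - ε) < 1 := by
      rw [← ENNReal.ofReal_one]
      exact (ENNReal.ofReal_lt_ofReal_iff one_pos).2 (by linarith)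
    have hev := hx.eventually (lt_mem_nhds hlt)
    have hr0 : ∀ᶠ r in nhdsWithin (0 : ℝ) (Ioi 0), r < min x (1 / (β - 1) - x) :=
      Filter.Eventually.filter_mono nhdsWithin_le_nhds
        (gt_mem_nhds (lt_min hx0 (by linarith)))
    obtain ⟨r, hr, hrlt, hrpos⟩ := (hev.and (hr0.and self_mem_nhdsWithin)).exists
    have hrpos : 0 < r := hrpos
    obtain ⟨hr1, hr2⟩ := lt_min_iff.1 hrlt
    rw [Real.closedBall_eq_Icc] at hr
    have hab : x - r < x + r := by linarith
    obtain ⟨n, hn⟩ := pow_unbounded_of_one_lt (1 / (β - 1) / (x + r - (x - r))) h1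
    rw [div_lt_iff₀ (by linarith)] at hn
    refine volume_S_diff_le h1 h2 hA _ n (x - r) (x + r) hab (by linarith) (by linarith) hn ?_
    have hvol : volume (Icc (x - r) (x + r)) = ENNReal.ofReal (x + r - (x - r)) := Real.volume_Icc
    have hv0 : ENNReal.ofReal (x + r - (x - r)) ≠ 0 := by
      rw [Ne, ENNReal.ofReal_eq_zero]; linarith
    rw [hvol, ENNReal.lt_div_iff_mul_lt (Or.inl hv0) (Or.inl ENNReal.ofReal_ne_top)] at hr
    have hsum : volume (Icc (x - r) (x + r) ∩ A) + volume (Icc (x - r) (x + r) \ A) =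
        ENNReal.ofReal (x + r - (x - r)) := by
      rw [measure_inter_add_sdiff _ hAm, hvol]
    have hle : ENNReal.ofReal (1 - ε) * ENNReal.ofReal (x + r - (x - r)) ≤
        volume (Icc (x - r) (x + r) ∩ A) :=
      hr.le.trans (measure_mono fun y hy => ⟨hy.2, hy.1.1⟩)
    have hone : ENNReal.ofReal (x + r - (x - r)) =
        ENNReal.ofReal (1 - ε) * ENNReal.ofReal (x + r - (x - r)) +
        ENNReal.ofReal ε * ENNReal.ofReal (x + r - (x - r)) := by
      rw [← add_mul, ← ENNReal.ofReal_add (by linarith) hε.le]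
      simp
    have hfin : ENNReal.ofReal (1 - ε) * ENNReal.ofReal (x + r - (x - r)) ≠ ∞ :=
      ENNReal.mul_ne_top ENNReal.ofReal_ne_top ENNReal.ofReal_ne_top
    refine (ENNReal.add_le_add_iff_left hfin).1 ?_
    calc _ ≤ volume (Icc (x - r) (x + r) ∩ A) + volume (Icc (x - r) (x + r) \ A) := by gcongr
      _ = _ := hsum.trans hone
  refine le_antisymm (le_of_forall_gt fun δ hδ => ?_) bot_le
  have htend : Filter.Tendsto (fun ε : ℝ => ENNReal.ofReal ε * ENNReal.ofReal (1 / (β - 1)))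
      (nhdsWithin 0 (Ioi 0)) (nhds 0) := by
    have h := ENNReal.Tendsto.mul_const (b := ENNReal.ofReal (1 / (β - 1)))
      (ENNReal.tendsto_ofReal (Filter.tendsto_id.mono_left (nhdsWithin_le_nhds (a := (0 : ℝ))
        (s := Ioi 0)))) (Or.inr ENNReal.ofReal_ne_top)
    simpa using h
  have hsmall : ∀ᶠ ε in nhdsWithin (0 : ℝ) (Ioi 0), ε < 1 :=
    Filter.Eventually.filter_mono nhdsWithin_le_nhds (gt_mem_nhds one_pos)
  obtain ⟨ε, h3, h4, h5⟩ :=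
    ((htend.eventually (gt_mem_nhds hδ)).and (hsmall.and self_mem_nhdsWithin)).exists
  exact (key ε h5 h4).trans_lt h3

lemma volume_S_pos (h1 : 1 < β) (h2 : β < 2) : volume (S β) ≠ 0 := by
  have e4 := inv_lt_S_right h1 h2
  rw [S, S_right h1, Real.volume_Icc, Ne, ENNReal.ofReal_eq_zero]
  linarith

/-- A set which is forward invariant for a stationary absolutely continuous measure, and not null,
contains almost all of `S`. -/
lemma Stationary.volume_S_diff (h1 : 1 < β) (h2 : β < 2) {μ : Measure ℝ}
    [IsFiniteMeasure μ] (hμ : Stationary β μ) (hac : μ ≪ volume) (hI : μ (I β)ᶜ = 0) {A : Set ℝ}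
    (hAm : MeasurableSet A) (hA : ∀ᵐ x ∂μ, x ∈ A → ∀ d, fibreMap β d x ∈ A) (hpos : μ A ≠ 0) :
    volume (S β \ A) = 0 := by
  set h := μ.rnDeriv volume
  have hh : Measurable h := Measure.measurable_rnDeriv _ _
  have hwd : volume.withDensity h = μ := Measure.withDensity_rnDeriv_eq _ _ hac
  have hae : ∀ {P : ℝ → Prop}, (∀ᵐ x ∂μ, P x) → ∀ᵐ x, h x ≠ 0 → P x := fun {P} hP => by
    rw [← hwd] at hP
    exact (ae_withDensity_iff hh).1 hP
  -- Forward invariance is only known `μ`-almost everywhere, so `A` is cut down to the support of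
  -- the density, which is forward invariant by stationarity.
  let D : Set ℝ := {x | h x ≠ 0}
  have hDm : MeasurableSet D := hh (measurableSet_singleton 0).compl
  have hD : ∀ᵐ x ∂μ, x ∈ D := by
    rw [← hwd]
    exact (ae_withDensity_iff hh).2 (Filter.Eventually.of_forall fun x hx => hx)
  have hf := (hμ.quasiMeasurePreserving false).ae hD
  have ht := (hμ.quasiMeasurePreserving true).ae hD
  have hinv : ∀ᵐ x, x ∈ A ∩ D → x ∈ I β → ∀ d, fibreMap β d x ∈ A ∩ D := by
    filter_upwards [hae hA, hae hf, hae ht] with x k1 k2 k3 hx _ d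
    refine ⟨k1 hx.2 hx.1 d, ?_⟩
    cases d
    · exact k2 hx.2
    · exact k3 hx.2
  refine measure_mono_null (sdiff_subset_sdiff_right inter_subset_left)
    (volume_S_diff_eq_zero h1 h2 (hAm.inter hDm) hinv fun h0 => hpos ?_)
  have hIae : ∀ᵐ x ∂μ, x ∈ I β := hI
  refine measure_mono_null_ae ?_ (hac h0)
  filter_upwards [hD, hIae] with x k1 k2 k3 using ⟨⟨k3, k1⟩, k2⟩

/-- Two non-null forward invariant sets cannot be disjoint. -/
lemma not_disjoint_of_forward_invariant (h1 : 1 < β) (h2 : β < 2) {A B : Set ℝ}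
    (hA : volume (S β \ A) = 0) (hB : volume (S β \ B) = 0) : ¬ Disjoint A B := by
  intro hd
  refine volume_S_pos h1 h2 (measure_mono_null ?_ (measure_union_null hA hB))
  intro x hx
  by_cases h : x ∈ A
  · exact Or.inr ⟨hx, Set.disjoint_left.1 hd h⟩
  · exact Or.inl ⟨hx, h⟩

end expansion

/-! ### Uniqueness of the absolutely continuous stationary measure -/

section uniqueness

variable {β : ℝ}

lemma withDensity_real_le {h h' : ℝ → ℝ≥0∞} {μ μ' : Measure ℝ} [IsFiniteMeasure μ']
    (hμ : volume.withDensity h = μ) (hμ' : volume.withDensity h' = μ') {X : Set ℝ}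
    (hX : MeasurableSet X) (hle : ∀ x ∈ X, h x ≤ h' x) : μ.real X ≤ μ'.real X := by
  refine ENNReal.toReal_mono (by finiteness) ?_
  rw [← hμ, ← hμ', withDensity_apply _ hX, withDensity_apply _ hX]
  exact setLIntegral_mono' hX hle

/-- Where one stationary density exceeds another one is forward invariant, since the total excess
cannot grow under averaging. -/
lemma forward_invariant_of_density {h h' : ℝ → ℝ≥0∞} {μ μ' : Measure ℝ} [IsFiniteMeasure μ]
    [IsFiniteMeasure μ'] (hh : Measurable h) (hh' : Measurable h')
    (hμ : volume.withDensity h = μ) (hμ' : volume.withDensity h' = μ')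
    (hs : Stationary β μ) (hs' : Stationary β μ') :
    ∀ᵐ x ∂μ, x ∈ {x | h' x < h x} → ∀ d, fibreMap β d x ∈ {x | h' x < h x} := by
  set A : Set ℝ := {x | h' x < h x} with hA
  have hAm : MeasurableSet A := measurableSet_lt hh' hh
  have pos : ∀ X ⊆ A, MeasurableSet X → μ'.real X ≤ μ.real X := fun X hX hm =>
    withDensity_real_le hμ' hμ hm fun x hx => (hX hx).le
  have neg : ∀ X ⊆ Aᶜ, MeasurableSet X → μ.real X ≤ μ'.real X := fun X hX hm =>
    withDensity_real_le hμ hμ' hm fun x hx => not_lt.1 (hX hx)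
  have hpre : ∀ d, MeasurableSet (fibreMap β d ⁻¹' A) := fun d => measurable_fibreMap d hAm
  have split : ∀ (ν : Measure ℝ) [IsFiniteMeasure ν] (d : Bool),
      ν.real (fibreMap β d ⁻¹' A) = ν.real (fibreMap β d ⁻¹' A ∩ A) +
        ν.real (fibreMap β d ⁻¹' A \ A) ∧
      ν.real A = ν.real (A ∩ fibreMap β d ⁻¹' A) + ν.real (A \ fibreMap β d ⁻¹' A) :=
    fun ν _ d => ⟨(measureReal_inter_add_sdiff hAm).symm,
      (measureReal_inter_add_sdiff (hpre d)).symm⟩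
  -- By stationarity the excess `μ A - μ' A` is the average of the excesses of the two preimages,
  -- and the excess of a preimage is at most that of its part in `A`; so no part of `A` outside a
  -- preimage carries any excess.
  have hzero : ∀ d, μ.real (A \ fibreMap β d ⁻¹' A) = μ'.real (A \ fibreMap β d ⁻¹' A) := by
    have e := hs.real_apply hAm
    have e' := hs'.real_apply hAm
    have p := fun d => pos _ sdiff_subset (hAm.diff (hpre d))
    have n := fun d => neg (fibreMap β d ⁻¹' A \ A) (fun x hx => hx.2) ((hpre d).diff hAm)
    have s1 := fun d => split μ d
    have s2 := fun d => split μ' d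
    simp only [inter_comm A] at s1 s2
    intro d
    have a1 := s1 false
    have a2 := s1 true
    have b1 := s2 false
    have b2 := s2 true
    have p1 := p false
    have p2 := p true
    have n1 := n false
    have n2 := n true
    cases d <;> linarith
  have hnull : ∀ d, μ (A \ fibreMap β d ⁻¹' A) = 0 := by
    intro d
    have hm := hAm.diff (hpre d)
    by_contra hne
    have hvol : volume (A \ fibreMap β d ⁻¹' A) ≠ 0 := fun h0 => hne <| by
      rw [← hμ]
      exact withDensity_absolutelyContinuous _ _ h0
    have hfin : ∫⁻ x in A \ fibreMap β d ⁻¹' A, h' x ≠ ∞ := by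
      rw [← withDensity_apply _ hm, hμ']
      finiteness
    have hlt := setLIntegral_strict_mono hm hvol hh hfin
      (Filter.Eventually.of_forall fun x hx => hx.1)
    rw [← withDensity_apply _ hm, ← withDensity_apply _ hm, hμ, hμ'] at hlt
    have := (ENNReal.toReal_lt_toReal (by finiteness) (by finiteness)).2 hlt
    exact absurd (hzero d) (ne_of_gt this)
  have h0 := fun d => (measure_eq_zero_iff_ae_notMem.1 (hnull d))
  filter_upwards [h0 false, h0 true] with x k0 k1 hx d
  cases d
  · by_contra hn
    exact k0 ⟨hx, hn⟩
  · by_contra hn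
    exact k1 ⟨hx, hn⟩

lemma Stationary.unique (h1 : 1 < β) (h2 : β < 2) {μ μ' : Measure ℝ} [IsProbabilityMeasure μ]
    [IsProbabilityMeasure μ'] (hs : Stationary β μ) (hs' : Stationary β μ') (hac : μ ≪ volume)
    (hac' : μ' ≪ volume) (hI : μ (I β)ᶜ = 0) (hI' : μ' (I β)ᶜ = 0) : μ = μ' := by
  set h := μ.rnDeriv volume
  set h' := μ'.rnDeriv volume
  have hh : Measurable h := Measure.measurable_rnDeriv _ _
  have hh' : Measurable h' := Measure.measurable_rnDeriv _ _
  have hwd : volume.withDensity h = μ := Measure.withDensity_rnDeriv_eq _ _ hac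
  have hwd' : volume.withDensity h' = μ' := Measure.withDensity_rnDeriv_eq _ _ hac'
  -- If one density is nowhere larger, the measures are equal as their masses are.
  have key : ∀ {g g' : ℝ → ℝ≥0∞} {ν ν' : Measure ℝ} [IsProbabilityMeasure ν]
      [IsProbabilityMeasure ν'], Measurable g → Measurable g' → volume.withDensity g = ν →
      volume.withDensity g' = ν' → ν {x | g' x < g x} = 0 → ν = ν' := by
    intro g g' ν ν' _ _ hg hg' hν hν' h0
    have hle : g ≤ᵐ[volume] g' := by
      have h0' : ∀ᵐ x ∂ν, ¬ g' x < g x := measure_eq_zero_iff_ae_notMem.1 h0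
      rw [← hν, ae_withDensity_iff hg] at h0'
      filter_upwards [h0'] with x hx
      by_cases hz : g x = 0
      · rw [hz]; exact bot_le
      · exact not_lt.1 (hx hz)
    exact Measure.eq_of_le_of_isProbabilityMeasure (hν ▸ hν' ▸ withDensity_mono hle)
  by_cases hA : μ {x | h' x < h x} = 0
  · exact key hh hh' hwd hwd' hA
  by_cases hB : μ' {x | h x < h' x} = 0
  · exact (key hh' hh hwd' hwd hB).symm
  refine absurd ?_ (not_disjoint_of_forward_invariant h1 h2
    (hs.volume_S_diff h1 h2 hac hI (measurableSet_lt hh' hh)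
      (forward_invariant_of_density hh hh' hwd hwd' hs hs') hA)
    (hs'.volume_S_diff h1 h2 hac' hI' (measurableSet_lt hh hh')
      (forward_invariant_of_density hh' hh hwd' hwd hs' hs) hB))
  exact Set.disjoint_left.2 fun x (hx : h' x < h x) (hx' : h x < h' x) => lt_asymm hx hx'

end uniqueness

/-! ### Almost every orbit of the skew product visits a given cylinder -/

section hitting

variable {β : ℝ}

lemma bernoulli_real_eq {A : Set Omega} (hA : MeasurableSet A) : bernoulli.real A =
    (bernoulli.real (cons false ⁻¹' A) + bernoulli.real (cons true ⁻¹' A)) / 2 := by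
  have h : bernoulli A =
      2⁻¹ * bernoulli (cons false ⁻¹' A) + 2⁻¹ * bernoulli (cons true ⁻¹' A) := by
    conv_lhs => rw [bernoulli_eq]
    rw [Measure.add_apply, Measure.smul_apply, Measure.smul_apply,
      Measure.map_apply (measurable_cons _) hA, Measure.map_apply (measurable_cons _) hA,
      smul_eq_mul, smul_eq_mul]
  rw [Measure.real, h, ENNReal.toReal_add (by finiteness) (by finiteness),
    ENNReal.toReal_mul, ENNReal.toReal_mul]
  simp [Measure.real]
  ring

lemma ae_cons {P : Omega → Prop} (h : ∀ᵐ ω ∂bernoulli, P ω) (b : Bool) :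
    ∀ᵐ ω ∂bernoulli, P (cons b ω) := by
  have hac : bernoulli.map (cons b) ≪ bernoulli := by
    refine Measure.AbsolutelyContinuous.mk fun A _ h0 => ?_
    rw [bernoulli_eq, Measure.add_apply, Measure.smul_apply, Measure.smul_apply, smul_eq_mul,
      smul_eq_mul, add_eq_zero] at h0
    cases b
    · simpa using h0.1
    · simpa using h0.2
  exact ae_of_ae_map (measurable_cons b).aemeasurable (hac.ae_le h)

/-- The sequences starting with `n` digits `1`. -/
def ones (n : ℕ) : Set Omega := {ω | ∀ i < n, ω i = true}

lemma measurableSet_ones (n : ℕ) : MeasurableSet (ones n) := by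
  have : ones n = ⋂ i, ⋂ _ : i < n, (fun ω : Omega => ω i) ⁻¹' {true} := by
    ext ω; simp [ones]
  rw [this]
  exact MeasurableSet.iInter fun i => MeasurableSet.iInter fun _ =>
    measurable_pi_apply i (measurableSet_singleton true)

lemma cons_mem_ones_succ {n : ℕ} {b : Bool} {ω : Omega} :
    cons b ω ∈ ones (n + 1) ↔ b = true ∧ ω ∈ ones n := by
  constructor
  · exact fun h => ⟨h 0 (by omega), fun i hi => h (i + 1) (by omega)⟩
  · rintro ⟨rfl, h⟩ i hi
    cases i with
    | zero => rfl
    | succ i => exact h i (by omega)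

/-- The set `Z` of points that never visit `V = {ω₁ = ⋯ = ω_N = 1} × J` is invariant. With `g x`
the measure of the section of `Z` at `x`, stationarity and the strict convexity of the square give
`g ∘ R_{β,b} = g` almost everywhere, so `g` is almost everywhere `0` or almost everywhere
positive; and `g = 0` on `J`, as there the section does not meet a cylinder. -/
lemma Stationary.ae_exists_iterate_mem (h1 : 1 < β) (h2 : β < 2) {μ : Measure ℝ}
    [IsProbabilityMeasure μ] (hs : Stationary β μ) (hac : μ ≪ volume) (hI : μ (I β)ᶜ = 0) (N : ℕ)
    {J : Set ℝ} (hJ : MeasurableSet J) (hJ0 : μ J ≠ 0) :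
    ∀ᵐ v ∂(bernoulli.prod μ), ∃ n, (skew β)^[n] v ∈ ones N ×ˢ J := by
  set V : Set (Omega × ℝ) := ones N ×ˢ J with hV
  have hVm : MeasurableSet V := (measurableSet_ones N).prod hJ
  set Z : Set (Omega × ℝ) := {v | ∀ n, (skew β)^[n] v ∉ V} with hZ
  have hZm : MeasurableSet Z := by
    have : Z = ⋂ n, (skew β)^[n] ⁻¹' Vᶜ := by ext v; simp [Z]
    rw [this]
    exact MeasurableSet.iInter fun n => (measurable_skew.iterate n) hVm.compl
  have hsub : Z ⊆ skew β ⁻¹' Z := fun v hv n => by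
    simpa only [Function.iterate_succ_apply] using hv (n + 1)
  have hpre := hs.measurePreserving_skew
  have hae : ∀ᵐ v ∂(bernoulli.prod μ), v ∈ Z ↔ skew β v ∈ Z := by
    have h : Z =ᵐ[bernoulli.prod μ] skew β ⁻¹' Z :=
      ae_eq_of_subset_of_measure_ge hsub (hpre.measure_preimage hZm.nullMeasurableSet).le
        hZm.nullMeasurableSet (by finiteness)
    filter_upwards [h] with v hv
    exact iff_of_eq hv
  have hsec : ∀ᵐ x ∂μ, ∀ b, ∀ᵐ ω ∂bernoulli,
      ((cons b ω, x) ∈ Z ↔ (ω, fibreMap β b x) ∈ Z) := by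
    have hm : MeasurableSet {v : Omega × ℝ | ((v.1, v.2) ∈ Z ↔ skew β (v.1, v.2) ∈ Z)} := by
      have e : {v : Omega × ℝ | ((v.1, v.2) ∈ Z ↔ skew β (v.1, v.2) ∈ Z)} =
          (Z ∩ skew β ⁻¹' Z) ∪ (Zᶜ ∩ (skew β ⁻¹' Z)ᶜ) := by
        ext v
        simp only [Prod.mk.eta, mem_ofPred_eq, mem_union, mem_inter_iff, mem_preimage,
          mem_compl_iff]
        tauto
      rw [e]
      have : MeasurableSet (skew β ⁻¹' Z) := measurable_skew hZm
      exact (hZm.inter this).union (hZm.compl.inter this.compl)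
    have h := (Measure.ae_ae_comm (p := fun ω x => ((ω, x) ∈ Z ↔ skew β (ω, x) ∈ Z)) hm).1
      (Measure.ae_ae_of_ae_prod hae)
    filter_upwards [h] with x hx b
    exact ae_cons hx b
  -- `g 0` is the function `g` above; `g k` measures the part of the section with `k` digits `1`.
  let g : ℕ → ℝ → ℝ := fun k x => bernoulli.real {ω | ω ∈ ones k ∧ (ω, x) ∈ Z}
  have hsm : ∀ k x, MeasurableSet {ω | ω ∈ ones k ∧ (ω, x) ∈ Z} := fun k x =>
    (measurableSet_ones k).inter (measurable_prodMk_right hZm)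
  have hgm : Measurable (g 0) := by
    have : g 0 = fun x => (bernoulli ((fun ω => (ω, x)) ⁻¹' Z)).toReal := by
      funext x
      simp only [g, Measure.real]
      congr 2
      ext ω
      simp [ones]
    rw [this]
    exact (measurable_measure_prodMk_right hZm).ennreal_toReal
  have hsucc : ∀ᵐ x ∂μ, ∀ k, g (k + 1) x = g k (fibreMap β true x) / 2 := by
    filter_upwards [hsec] with x hx k
    simp only [g]
    rw [bernoulli_real_eq (hsm _ _)]
    have e0 : cons false ⁻¹' {ω | ω ∈ ones (k + 1) ∧ (ω, x) ∈ Z} = ∅ := by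
      ext ω; simp [cons_mem_ones_succ]
    have e1 : bernoulli.real (cons true ⁻¹' {ω | ω ∈ ones (k + 1) ∧ (ω, x) ∈ Z}) =
        bernoulli.real {ω | ω ∈ ones k ∧ (ω, fibreMap β true x) ∈ Z} := by
      refine measureReal_congr ?_
      filter_upwards [hx true] with ω hω
      refine propext ?_
      change (cons true ω ∈ ones (k + 1) ∧ (cons true ω, x) ∈ Z) ↔
        (ω ∈ ones k ∧ (ω, fibreMap β true x) ∈ Z)
      rw [cons_mem_ones_succ, hω]
      simp
    rw [e0, e1]
    simp
  have hmean : ∀ᵐ x ∂μ, g 0 x = (g 0 (fibreMap β false x) + g 0 (fibreMap β true x)) / 2 := by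
    filter_upwards [hsec] with x hx
    simp only [g]
    rw [bernoulli_real_eq (hsm _ _)]
    have e : ∀ b, bernoulli.real (cons b ⁻¹' {ω | ω ∈ ones 0 ∧ (ω, x) ∈ Z}) =
        bernoulli.real {ω | ω ∈ ones 0 ∧ (ω, fibreMap β b x) ∈ Z} := by
      intro b
      refine measureReal_congr ?_
      filter_upwards [hx b] with ω hω
      refine propext ?_
      change (cons b ω ∈ ones 0 ∧ (cons b ω, x) ∈ Z) ↔ (ω ∈ ones 0 ∧ (ω, fibreMap β b x) ∈ Z)
      rw [hω]
      simp [ones]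
    rw [e, e]
  have hgb : ∀ x, ‖g 0 x‖ ≤ 1 := fun x => by
    rw [Real.norm_of_nonneg measureReal_nonneg]
    exact measureReal_le_one
  have hinv : ∀ᵐ x ∂μ, ∀ b, g 0 (fibreMap β b x) = g 0 x := by
    have hi : ∀ f : ℝ → ℝ, Measurable f → (∀ x, ‖f x‖ ≤ 1) → Integrable f μ := fun f hf hb =>
      Integrable.of_bound hf.aestronglyMeasurable 1 (Filter.Eventually.of_forall hb)
    have hsq : ∀ f : ℝ → ℝ, Measurable f → (∀ x, ‖f x‖ ≤ 1) → Integrable (fun x => f x ^ 2) μ :=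
      fun f hf hb => hi _ (hf.pow_const 2) fun x => by
        rw [norm_pow]
        exact pow_le_one₀ (norm_nonneg _) (hb x)
    have hf := fun b => hsq (fun x => g 0 (fibreMap β b x)) (hgm.comp (measurable_fibreMap b))
      fun x => hgb _
    have hstat : ∫ x, g 0 x ^ 2 ∂μ = (∫ x, g 0 (fibreMap β false x) ^ 2 ∂μ +
        ∫ x, g 0 (fibreMap β true x) ^ 2 ∂μ) / 2 := by
      have hmap : ∀ b, ∫ x, g 0 (fibreMap β b x) ^ 2 ∂μ =
          ∫ x, g 0 x ^ 2 ∂(μ.map (fibreMap β b)) := fun b =>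
        (integral_map (measurable_fibreMap b).aemeasurable
          (hgm.pow_const 2).aestronglyMeasurable).symm
      have hint : ∀ b, Integrable (fun x => g 0 x ^ 2) (μ.map (fibreMap β b)) := fun b =>
        (integrable_map_measure (hgm.pow_const 2).aestronglyMeasurable
          (measurable_fibreMap b).aemeasurable).2 (hf b)
      rw [hmap, hmap]
      conv_lhs => rw [← hs]
      rw [integral_add_measure ((hint _).smul_measure (by simp))
        ((hint _).smul_measure (by simp)), integral_smul_measure, integral_smul_measure]
      simp
      ring
    -- The mean square of the difference is what Jensen's inequality loses; stationarity makes it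
    -- `0`.
    have hzero : ∫ x, (g 0 (fibreMap β false x) - g 0 (fibreMap β true x)) ^ 2 ∂μ = 0 := by
      have e : (fun x => (g 0 (fibreMap β false x) - g 0 (fibreMap β true x)) ^ 2) =ᵐ[μ]
          fun x => 2 * (g 0 (fibreMap β false x) ^ 2 + g 0 (fibreMap β true x) ^ 2) -
            4 * g 0 x ^ 2 := by
        filter_upwards [hmean] with x hx
        rw [hx]
        ring
      have hsum : Integrable (fun x => g 0 (fibreMap β false x) ^ 2 +
          g 0 (fibreMap β true x) ^ 2) μ := (hf false).add (hf true)
      rw [integral_congr_ae e, integral_sub (hsum.const_mul 2)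
        ((hsq _ hgm hgb).const_mul 4), integral_const_mul, integral_const_mul, integral_add
        (hf _) (hf _), hstat]
      ring
    have hint : Integrable
        (fun x => (g 0 (fibreMap β false x) - g 0 (fibreMap β true x)) ^ 2) μ := by
      have := ((hf false).add (hf true)).const_mul 2
      refine this.mono' ((((hgm.comp (measurable_fibreMap _)).sub
        (hgm.comp (measurable_fibreMap _))).pow_const 2).aestronglyMeasurable) ?_
      refine Filter.Eventually.of_forall fun x => ?_
      rw [Real.norm_of_nonneg (sq_nonneg _)]
      simp only [Pi.add_apply]
      nlinarith [sq_nonneg (g 0 (fibreMap β false x) + g 0 (fibreMap β true x))]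
    have hz := (integral_eq_zero_iff_of_nonneg (fun x => sq_nonneg _) hint).1 hzero
    filter_upwards [hz, hmean] with x hx hx' b
    have : g 0 (fibreMap β false x) - g 0 (fibreMap β true x) = 0 := by
      simpa using hx
    cases b <;> linarith
  -- With `g` invariant, `g (k+1) = (g k ∘ R_{β,1})/2` solves to `g k = 2^{-k} g 0`.
  have hpow : ∀ k, ∀ᵐ x ∂μ, g k x = g 0 x / 2 ^ k := by
    intro k
    induction k with
    | zero => exact Filter.Eventually.of_forall fun x => by simp
    | succ k ih =>
      filter_upwards [hsucc, (hs.quasiMeasurePreserving true).ae ih, hinv] with x a b c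
      rw [a k, b, c true, pow_succ, div_div]
  have hJg : ∀ᵐ x ∂μ, x ∈ J → g 0 x = 0 := by
    filter_upwards [hpow N] with x hx hxJ
    have : g N x = 0 := by
      have : {ω | ω ∈ ones N ∧ (ω, x) ∈ Z} = ∅ :=
        eq_empty_of_forall_notMem fun ω hω => hω.2 0 ⟨hω.1, hxJ⟩
      simp only [g, this]
      simp
    rw [this] at hx
    have h2N : (2 : ℝ) ^ N ≠ 0 := by positivity
    field_simp at hx
    linarith
  have hg0 : ∀ᵐ x ∂μ, g 0 x = 0 := by
    have mA : MeasurableSet {x | g 0 x ≠ 0} := hgm (measurableSet_singleton 0).compl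
    have mB : MeasurableSet {x | g 0 x = 0} := hgm (measurableSet_singleton 0)
    by_contra hne
    have hA : μ {x | g 0 x ≠ 0} ≠ 0 := hne
    have hB : μ {x | g 0 x = 0} ≠ 0 := fun h0 => hJ0 (measure_mono_null_ae hJg h0)
    refine absurd ?_ (not_disjoint_of_forward_invariant h1 h2
      (hs.volume_S_diff h1 h2 hac hI mA ?_ hA) (hs.volume_S_diff h1 h2 hac hI mB ?_ hB))
    · exact Set.disjoint_left.2 fun x hx hx' => hx hx'
    · filter_upwards [hinv] with x hx hxA d
      have h : g 0 (fibreMap β d x) ≠ 0 := by rw [hx d]; exact hxA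
      exact h
    · filter_upwards [hinv] with x hx hxB d
      have h : g 0 (fibreMap β d x) = 0 := by rw [hx d]; exact hxB
      exact h
  have hZ0 : bernoulli.prod μ Z = 0 := by
    rw [Measure.prod_apply_symm hZm]
    refine (lintegral_eq_zero_iff (measurable_measure_prodMk_right hZm)).2 ?_
    filter_upwards [hg0] with x hx
    have e : {ω | ω ∈ ones 0 ∧ (ω, x) ∈ Z} = (fun ω => (ω, x)) ⁻¹' Z := by
      ext ω; simp [ones]
    simp only [g, e] at hx
    exact (measureReal_eq_zero_iff).1 hx
  filter_upwards [measure_eq_zero_iff_ae_notMem.1 hZ0] with v hv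
  by_contra hn
  push Not at hn
  exact hv hn

end hitting

end RandomBeta

/-! ### First backward entry times -/

namespace MeasureTheory

variable {X Y : Type*} {T U : X → X} {X₀ : Set X} {π : X → Y} {s : Y → Y} {V : Set Y}

/-- The first time `n` at which the backward orbit of a point visits `π⁻¹ V`. -/
def IsBackwardEntry (U : X → X) (π : X → Y) (V : Set Y) (p : X) (n : ℕ) : Prop :=
  π (U^[n] p) ∈ V ∧ ∀ i < n, π (U^[i] p) ∉ V

lemma iterate_leftInvOn (hU₀ : MapsTo U X₀ X₀) (hTU : LeftInvOn T U X₀) {p : X} (hp : p ∈ X₀)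
    (n k : ℕ) : T^[n] (U^[n + k] p) = U^[k] p := by
  induction n with
  | zero => simp
  | succ n ih =>
    have : n + 1 + k = (n + k) + 1 := by ring
    rw [this, Function.iterate_succ_apply, Function.iterate_succ_apply',
      hTU (hU₀.iterate _ hp), ih]

lemma iterate_semiconj (hT₀ : MapsTo T X₀ X₀) (hπ : ∀ p ∈ X₀, π (T p) = s (π p)) {p : X}
    (hp : p ∈ X₀) (n : ℕ) : π (T^[n] p) = s^[n] (π p) := by
  induction n with
  | zero => rfl
  | succ n ih =>
    rw [Function.iterate_succ_apply', Function.iterate_succ_apply', hπ _ (hT₀.iterate _ hp), ih]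

variable [MeasurableSpace X] [MeasurableSpace Y] {ν : Measure X}

/-- Whether the first backward entry to `π⁻¹ V` happens at time `n` depends only on the projection
of the point of entry. So if over every part of `V` a set `B` has proportion at most `ε`, then the
point of entry lies in `B` with probability at most `ε`. -/
lemma measure_backwardEntry_le (hU : MeasurePreserving U ν ν) (hX₀ : ν X₀ᶜ = 0)
    (hT₀ : MapsTo T X₀ X₀) (hU₀ : MapsTo U X₀ X₀) (hTU : LeftInvOn T U X₀)
    (hπ : ∀ p ∈ X₀, π (T p) = s (π p)) (hπm : Measurable π) (hs : Measurable s)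
    (hV : MeasurableSet V) {B : Set X} (hB : MeasurableSet B) {ε : ℝ≥0∞}
    (hε : ∀ C ⊆ V, MeasurableSet C → ν (π ⁻¹' C ∩ B) ≤ ε * ν (π ⁻¹' C)) :
    ν {p | ∃ n, IsBackwardEntry U π V p n ∧ U^[n] p ∈ B} ≤ ε * ν univ := by
  have hae : ∀ᵐ p ∂ν, p ∈ X₀ := hX₀
  -- `P n` is the event of first entry at time `n`. As `U` is inverted by `T`, which covers `s`, it
  -- is the preimage under `Uⁿ` of `π⁻¹ (C n)`.
  let P : ℕ → Set X := fun n => {p | IsBackwardEntry U π V p n}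
  let C : ℕ → Set Y := fun n => {v | v ∈ V ∧ ∀ i < n, s^[n - i] v ∉ V}
  have hCm : ∀ n, MeasurableSet (C n) := fun n => by
    have : C n = V ∩ ⋂ i, ⋂ _ : i < n, s^[n - i] ⁻¹' Vᶜ := by ext v; simp [C]
    rw [this]
    exact hV.inter (MeasurableSet.iInter fun i => MeasurableSet.iInter fun _ =>
      (hs.iterate _) hV.compl)
  have hPm : ∀ n, MeasurableSet (P n) := fun n => by
    have : P n = (π ∘ U^[n]) ⁻¹' V ∩ ⋂ i, ⋂ _ : i < n, (π ∘ U^[i]) ⁻¹' Vᶜ := by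
      ext v; simp [P, IsBackwardEntry]
    rw [this]
    have hm := fun i => hπm.comp (hU.measurable.iterate i)
    exact (hm n hV).inter (MeasurableSet.iInter fun i => MeasurableSet.iInter fun _ =>
      hm i hV.compl)
  have hPC : ∀ n, ∀ p ∈ X₀, p ∈ P n ↔ U^[n] p ∈ π ⁻¹' C n := by
    intro n p hp
    refine and_congr Iff.rfl (forall₂_congr fun i hi => ?_)
    have h1 : U^[i] p = T^[n - i] (U^[n] p) := by
      have := iterate_leftInvOn hU₀ hTU hp (n - i) i
      rwa [Nat.sub_add_cancel hi.le, eq_comm] at this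
    rw [h1, iterate_semiconj hT₀ hπ (hU₀.iterate n hp)]
  have hν : ∀ n, ν (P n) = ν (π ⁻¹' C n) := fun n => by
    rw [← (hU.iterate n).measure_preimage (hπm (hCm n)).nullMeasurableSet]
    refine measure_congr ?_
    filter_upwards [hae] with p hp using propext (hPC n p hp)
  have hνB : ∀ n, ν (P n ∩ U^[n] ⁻¹' B) = ν (π ⁻¹' C n ∩ B) := fun n => by
    rw [← (hU.iterate n).measure_preimage ((hπm (hCm n)).inter hB).nullMeasurableSet]
    refine measure_congr ?_
    filter_upwards [hae] with p hp using propext (and_congr (hPC n p hp) Iff.rfl)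
  have hd : Pairwise (Function.onFun Disjoint P) := by
    intro i j hij
    refine Set.disjoint_left.2 fun p hp hq => ?_
    rcases lt_or_gt_of_ne hij with h | h
    · exact hq.2 i h hp.1
    · exact hp.2 j h hq.1
  calc ν {p | ∃ n, IsBackwardEntry U π V p n ∧ U^[n] p ∈ B}
      = ν (⋃ n, P n ∩ U^[n] ⁻¹' B) := by
        congr 1
        ext p
        simp [P]
    _ ≤ ∑' n, ν (P n ∩ U^[n] ⁻¹' B) := measure_iUnion_le _
    _ ≤ ∑' n, ε * ν (P n) := by
        refine ENNReal.tsum_le_tsum fun n => ?_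
        rw [hνB, hν]
        exact hε _ (fun v hv => hv.1) (hCm n)
    _ = ε * ν (⋃ n, P n) := by rw [ENNReal.tsum_mul_left, measure_iUnion hd hPm]
    _ ≤ ε * ν univ := by gcongr; exact subset_univ _

/-- If almost every forward orbit visits a set, then so does almost every backward orbit. -/
lemma ae_exists_backward_visit [IsFiniteMeasure ν] (hT : MeasurePreserving T ν ν)
    (hU : MeasurePreserving U ν ν) (hX₀ : ν X₀ᶜ = 0) (hUT : LeftInvOn U T X₀) {A : Set X}
    (hA : MeasurableSet A) (h : ∀ᵐ p ∂ν, ∃ n, T^[n] p ∈ A) : ∀ᵐ p ∂ν, ∃ n, U^[n] p ∈ A := by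
  have hae : ∀ᵐ p ∂ν, p ∈ X₀ := hX₀
  set W : Set X := {p | ∃ n, U^[n] p ∈ A} with hW
  have hWm : MeasurableSet W := by
    have : W = ⋃ n, U^[n] ⁻¹' A := by ext p; simp [W]
    rw [this]
    exact MeasurableSet.iUnion fun n => (hU.measurable.iterate n) hA
  have hsub : W ≤ᵐ[ν] T ⁻¹' W := by
    filter_upwards [hae] with p hp hpW
    obtain ⟨n, hn⟩ := hpW
    refine ⟨n + 1, ?_⟩
    rw [Function.iterate_succ_apply, hUT hp]
    exact hn
  have heq : W =ᵐ[ν] T ⁻¹' W :=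
    ae_eq_of_ae_subset_of_measure_ge hsub (hT.measure_preimage hWm.nullMeasurableSet).le
      hWm.nullMeasurableSet (by finiteness)
  have hall : ∀ n, ∀ᵐ p ∂ν, T^[n] p ∈ W → p ∈ W := by
    intro n
    induction n with
    | zero => exact Filter.Eventually.of_forall fun p hp => hp
    | succ n ih =>
      filter_upwards [hT.quasiMeasurePreserving.ae ih, heq] with p h1 h2 hp
      rw [Function.iterate_succ_apply] at hp
      exact (iff_of_eq h2).2 (h1 hp)
  filter_upwards [h, ae_all_iff.2 hall] with p ⟨n, hn⟩ hp
  exact hp n ⟨0, hn⟩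

end MeasureTheory

namespace RandomBeta

/-! ### The invariant measure is the projection of the tower measure -/

section marginal

variable {β : ℝ}

/-- The planar section of the double tower, which is the same for all sequences. -/
def planarTower (β : ℝ) : Set (ℝ × ℝ) :=
  {q | ((fun _ => false, q) : Omega × ℝ × ℝ) ∈ doubleTower β}

lemma mem_doubleTower_iff (ω ω' : Omega) (q : ℝ × ℝ) :
    (ω, q) ∈ doubleTower β ↔ (ω', q) ∈ doubleTower β := by
  have h : ∀ (ω ω' : Omega) (q : ℝ × ℝ), (ω, q) ∈ tower β ↔ (ω', q) ∈ tower β := by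
    intro ω ω' q
    simp only [mem_tower, mem_cell]
  exact or_congr (h _ _ _) (by rw [mem_towerBar, mem_towerBar]; exact h _ _ _)

lemma doubleTower_eq : doubleTower β = univ ×ˢ planarTower β := by
  ext ⟨ω, q⟩
  rw [mem_prod]
  simp only [mem_univ, true_and]
  exact mem_doubleTower_iff _ _ _

/-- The distribution of the second coordinate under the normalised tower measure. -/
noncomputable def marginal (β : ℝ) : Measure ℝ :=
  (towerMeasure β univ)⁻¹ • ((volume.prod volume).restrict (planarTower β)).map Prod.fst

instance : SFinite (marginal β) := by unfold marginal; infer_instance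

lemma map_proj_towerMeasure :
    ((towerMeasure β univ)⁻¹ • towerMeasure β).map proj = bernoulli.prod (marginal β) := by
  have : towerMeasure β = bernoulli.prod ((volume.prod volume).restrict (planarTower β)) := by
    rw [towerMeasure_eq, doubleTower_eq, vol, ← Measure.prod_restrict, Measure.restrict_univ]
  have hp : proj = Prod.map (id : Omega → Omega) (Prod.fst : ℝ × ℝ → ℝ) := rfl
  rw [marginal, Measure.prod_smul_right, Measure.map_smul]
  congr 1
  rw [this, hp, ← Measure.map_prod_map _ _ measurable_id measurable_fst, Measure.map_id]

lemma marginal_apply {A : Set ℝ} (hA : MeasurableSet A) :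
    marginal β A = (towerMeasure β univ)⁻¹ * towerMeasure β (proj ⁻¹' (univ ×ˢ A)) := by
  have h : bernoulli.prod (marginal β) (univ ×ˢ A) = marginal β A := by
    rw [Measure.prod_prod, measure_univ, one_mul]
  rw [← h, ← map_proj_towerMeasure, Measure.map_apply measurable_proj
    (MeasurableSet.univ.prod hA), Measure.smul_apply, smul_eq_mul]

lemma isProbabilityMeasure_marginal (h1 : 1 < β) (h2 : β < 2) :
    IsProbabilityMeasure (marginal β) := by
  have := isFiniteMeasure_towerMeasure h1 h2
  refine ⟨?_⟩
  rw [marginal_apply MeasurableSet.univ, univ_prod_univ, preimage_univ]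
  exact ENNReal.inv_mul_cancel towerMeasure_univ_pos.ne' (by finiteness)

lemma marginal_compl_I (h1 : 1 < β) (h2 : β < 2) : marginal β (I β)ᶜ = 0 := by
  have hm : MeasurableSet (I β)ᶜ := measurableSet_Icc.compl
  rw [marginal_apply hm, towerMeasure_eq,
    Measure.restrict_apply (measurable_proj (MeasurableSet.univ.prod hm))]
  have : proj ⁻¹' (univ ×ˢ (I β)ᶜ) ∩ doubleTower β = ∅ := by
    refine eq_empty_of_forall_notMem ?_
    rintro p ⟨hp, hd⟩
    exact hp.2 (x_mem_I h1 h2 hd)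
  rw [this, measure_empty, mul_zero]

lemma marginal_absolutelyContinuous : marginal β ≪ volume := by
  refine Measure.AbsolutelyContinuous.mk fun A hA h0 => ?_
  have hm : MeasurableSet ((univ : Set Omega) ×ˢ A) := MeasurableSet.univ.prod hA
  have : vol (proj ⁻¹' (univ ×ˢ A)) = 0 := by
    have h := vol_proj_preimage_inter hm (MeasurableSet.univ (α := ℝ))
    rw [Measure.prod_prod, h0, mul_zero, zero_mul] at h
    simpa using h
  rw [marginal_apply hA, towerMeasure_eq]
  rw [Measure.restrict_le_self.absolutelyContinuous this, mul_zero]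

lemma ae_mem_doubleTower : ∀ᵐ p ∂towerMeasure β, p ∈ doubleTower β :=
  ae_restrict_mem measurableSet_doubleTower

lemma measurePreserving_normalized {T : Omega × ℝ × ℝ → Omega × ℝ × ℝ}
    (h : MeasurePreserving T (towerMeasure β) (towerMeasure β)) :
    MeasurePreserving T ((towerMeasure β univ)⁻¹ • towerMeasure β)
      ((towerMeasure β univ)⁻¹ • towerMeasure β) :=
  ⟨h.measurable, by rw [Measure.map_smul, h.map_eq]⟩

lemma stationary_marginal (h1 : 1 < β) (h2 : β < 2) : Stationary β (marginal β) := by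
  have := isProbabilityMeasure_marginal h1 h2
  have hT := measurePreserving_normalized (measurePreserving_psiTilde h1 h2)
  refine stationary_of_map_skew ?_
  rw [← map_proj_towerMeasure, Measure.map_map measurable_skew measurable_proj]
  have : skew β ∘ proj =ᵐ[(towerMeasure β univ)⁻¹ • towerMeasure β] proj ∘ psiTilde β :=
    Measure.ae_smul_measure
      (ae_mem_doubleTower.mono fun p hp => (proj_psiTilde h1 h2 hp).symm) _
  rw [Measure.map_congr this, ← Measure.map_map measurable_proj (measurable_psiTilde h1 h2),
    hT.map_eq]

lemma isInvariantDensityMeasure_marginal (h1 : 1 < β) (h2 : β < 2) :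
    IsInvariantDensityMeasure β (marginal β) := by
  have hp := isProbabilityMeasure_marginal h1 h2
  refine ⟨hp, marginal_compl_I h1 h2, marginal_absolutelyContinuous, measurable_randomMap, ?_⟩
  rw [map_randomMap, (stationary_marginal h1 h2).map_skew_eq]

lemma IsInvariantDensityMeasure.eq_marginal (h1 : 1 < β) (h2 : β < 2) {μ : Measure ℝ}
    (h : IsInvariantDensityMeasure β μ) : μ = marginal β := by
  have := h.isProbabilityMeasure
  have := isProbabilityMeasure_marginal h1 h2
  have hs : Stationary β μ := stationary_of_map_skew (by rw [← map_randomMap, h.invariant.map_eq])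
  exact hs.unique h1 h2 (stationary_marginal h1 h2) h.absolutelyContinuous
    marginal_absolutelyContinuous h.compl_null (marginal_compl_I h1 h2)

lemma marginal_ne_zero (h1 : 1 < β) (h2 : β < 2) {J : Set ℝ} (hJ : MeasurableSet J)
    (hJ1 : J ⊆ Icc 0 1) (h0 : volume J ≠ 0) : marginal β J ≠ 0 := by
  have := isFiniteMeasure_towerMeasure h1 h2
  rw [marginal_apply hJ]
  refine mul_ne_zero (ENNReal.inv_ne_zero.2 (by finiteness)) fun h => h0 ?_
  have hle := towerMeasure_ge_of_unit (β := β) (A := univ ×ˢ J) (fun v hv => hJ1 hv.2)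
    (MeasurableSet.univ.prod hJ)
  rw [h, Measure.prod_prod, measure_univ, one_mul] at hle
  exact le_antisymm hle bot_le

/-- Almost every forward orbit of the tower map visits the points over a given cylinder. -/
lemma ae_exists_iterate_psiTilde_mem (h1 : 1 < β) (h2 : β < 2) (N : ℕ) {J : Set ℝ}
    (hJ : MeasurableSet J) (hJ1 : J ⊆ Icc 0 1) (h0 : volume J ≠ 0) :
    ∀ᵐ p ∂towerMeasure β, ∃ n, (psiTilde β)^[n] p ∈ proj ⁻¹' (ones N ×ˢ J) := by
  have := isFiniteMeasure_towerMeasure h1 h2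
  have := isProbabilityMeasure_marginal h1 h2
  have h := (stationary_marginal h1 h2).ae_exists_iterate_mem h1 h2
    marginal_absolutelyContinuous (marginal_compl_I h1 h2) N hJ (marginal_ne_zero h1 h2 hJ hJ1 h0)
  rw [← map_proj_towerMeasure] at h
  have h' := ae_of_ae_map measurable_proj.aemeasurable h
  have h'' := (Measure.ae_ennreal_smul_measure_iff (ENNReal.inv_ne_zero.2
    (measure_ne_top (towerMeasure β) univ))).1 h'
  filter_upwards [h'', ae_mem_doubleTower] with p ⟨n, hn⟩ hp
  refine ⟨n, ?_⟩
  rw [mem_preimage, iterate_semiconj (mapsTo_psiTilde h1 h2)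
    (fun q hq => proj_psiTilde h1 h2 hq) hp]
  exact hn

end marginal

/-! ### Transitions between sublevels under the tower map -/

section transitions

variable {β : ℝ}

lemma psiTilde_fst (h1 : 1 < β) (h2 : β < 2) {p : Omega × ℝ × ℝ} (hp : p ∈ doubleTower β) :
    (psiTilde β p).1 = shift p.1 :=
  congrArg Prod.fst (proj_psiTilde h1 h2 hp)

lemma psiTilde_x (h1 : 1 < β) (h2 : β < 2) {p : Omega × ℝ × ℝ} (hp : p ∈ doubleTower β) :
    (psiTilde β p).2.1 = fibreMap β (p.1 0) p.2.1 :=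
  congrArg Prod.snd (proj_psiTilde h1 h2 hp)

lemma notMem_tower_of_y_neg (h1 : 1 < β) {p : Omega × ℝ × ℝ} (hy : p.2.2 < 0) :
    p ∉ tower β := fun h => absurd (y_nonneg_of_mem_tower h1 h) (not_le.2 hy)

lemma one_le_psi_y (h1 : 1 < β) (h2 : β < 2) {w : List Bool} {p : Omega × ℝ × ℝ}
    (hp : p ∈ cell β w) (hd : ¬ Descends β w p) : 1 ≤ (psi β p).2.2 :=
  (one_le_height h1 (by simp)).trans (mem_cell.1 (psi_mem_up h1 h2 hp hd)).2.1

lemma not_descends_of_mismatch {w : List Bool} {p : Omega × ℝ × ℝ} (hm : p ∈ mismatch β w) :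
    ¬ Descends β w p := fun h => absurd h.2 (not_lt.2 hm.2.2.2.1)

lemma mismatch_acts (h1 : 1 < β) (h2 : β < 2) {w : List Bool} {b : Bool}
    (hr : rightEnd β w ∈ R β) : ActsByT1 β w b :=
  (actsByT1_iff h1 h2 _ _).2 (Or.inr (by rw [← S_right h1]; exact hr.1))

/-- After the exchange a mismatched point of `E_w` lies in the other copy of `E_{w0}`. -/
lemma mismatch_swap_mem_cell (h1 : 1 < β) (h2 : β < 2) {w : List Bool} {p : Omega × ℝ × ℝ}
    (hm : p ∈ mismatch β w) (ω : Omega) :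
    ((ω, 1 / (β - 1) - (psi β p).2.1 - 1, (psi β p).2.2) : Omega × ℝ × ℝ) ∈
      cell β (w ++ [false]) := by
  have e1 := beta_mul_inv h1
  have e2 := beta_mul_c h1
  have hc := psi_mem_up h1 h2 hm.1 (not_descends_of_mismatch hm)
  have hx := ((psi_x h1 h2 hm.1).1 hm).2
  obtain ⟨-, hr, hb, hxl, hxr⟩ := hm
  rw [hb] at hc
  have hR := hr.1
  rw [S_right h1] at hR hxr
  rw [mem_cell] at hc ⊢
  refine ⟨⟨?_, ?_⟩, hc.2⟩
  · simp only
    rw [hx]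
    nlinarith
  · simp only
    rw [rightEnd_snoc_of_acts (mismatch_acts h1 h2 hr), hx]
    nlinarith

lemma notMem_mismatch_of_digit {w : List Bool} {p : Omega × ℝ × ℝ} (hb : p.1 0 = true) :
    p ∉ mismatch β w := fun h => by
  have := h.2.2.1
  rw [hb] at this
  exact absurd this (by simp)

lemma psiTilde_mem_base (h1 : 1 < β) (h2 : β < 2) {w : List Bool} {p : Omega × ℝ × ℝ}
    (hp : p ∈ cell β w) (hb : p.1 0 = true) (hx : p.2.1 < 1 / β) (hr : 1 / β ≤ rightEnd β w) :
    psiTilde β p ∈ cell β [] := by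
  rw [psiTilde_of_notMem_mismatch h1 h2 hp (notMem_mismatch_of_digit hb)]
  exact psi_mem_base h1 h2 hp ⟨(actsByT1_iff h1 h2 _ _).2 (Or.inl ⟨hb, hr⟩), hx⟩

lemma psiTilde_mem_up (h1 : 1 < β) (h2 : β < 2) {w : List Bool} {p : Omega × ℝ × ℝ}
    (hp : p ∈ cell β w) (hb : p.1 0 = true) (hd : 1 / β ≤ p.2.1 ∨ rightEnd β w < 1 / β) :
    psiTilde β p ∈ cell β (w ++ [true]) := by
  rw [psiTilde_of_notMem_mismatch h1 h2 hp (notMem_mismatch_of_digit hb), ← hb]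
  refine psi_mem_up h1 h2 hp fun h => ?_
  rcases hd with k | k
  · exact absurd h.2 (not_lt.2 k)
  · exact absurd (h.1.inv_le h1 h2) (not_le.2 k)

lemma rightEnd_snoc_true (h1 : 1 < β) (h2 : β < 2) {w : List Bool} (hr : 1 / β ≤ rightEnd β w) :
    rightEnd β (w ++ [true]) = β * rightEnd β w - 1 := by
  rw [rightEnd_snoc, fibreMap_true h1 h2 hr (rightEnd_mem_I h1 h2 w).2]

lemma rightEnd_snoc_of_lt (h1 : 1 < β) (h2 : β < 2) {w : List Bool} {b : Bool}
    (hr : rightEnd β w < 1 / β) : rightEnd β (w ++ [b]) = β * rightEnd β w := by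
  rw [rightEnd_snoc, fibreMap_of_lt (rightEnd_mem_I h1 h2 w).1 hr]

/-- The point lies only in the second tower, in the reflection of a full sublevel
`Ω × [0, 1/(β-1)] × …`. -/
def InFullBar (β : ℝ) (p : Omega × ℝ × ℝ) : Prop :=
  p ∉ tower β ∧ ∃ w, refl β p ∈ cell β w ∧ rightEnd β w = 1 / (β - 1)

lemma rightEnd_full_snoc (h1 : 1 < β) (h2 : β < 2) {w : List Bool} {b : Bool}
    (hr : rightEnd β w = 1 / (β - 1)) : rightEnd β (w ++ [b]) = 1 / (β - 1) := by
  have e2 := beta_mul_c h1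
  have := inv_pos' h1
  rw [rightEnd_snoc, hr, fibreMap_of_gt h1 h2 (by linarith) le_rfl]
  linarith

lemma InFullBar.stays (h1 : 1 < β) (h2 : β < 2) {p : Omega × ℝ × ℝ} (hp : InFullBar β p)
    (hx : p.2.1 < 1 / β) : InFullBar β (psiTilde β p) := by
  obtain ⟨ht, w, hw, hr⟩ := hp
  have e4 := inv_lt_S_right h1 h2
  have hm : refl β p ∉ mismatch β w := fun h => by
    have := h.2.2.2.2
    rw [S_right h1, refl_x] at this
    linarith
  have hd : ¬ Descends β w (refl β p) := fun h => by
    have := h.2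
    rw [refl_x] at this
    linarith
  rw [psiTilde_of_refl_notMem_mismatch h1 h2 ht hw hm]
  refine ⟨notMem_tower_of_y_neg h1 ?_, w ++ [(refl β p).1 0], ?_, rightEnd_full_snoc h1 h2 hr⟩
  · rw [refl_y]
    linarith [one_le_psi_y h1 h2 hw hd]
  · rw [refl_refl]
    exact psi_mem_up h1 h2 hw hd

/-- Over `S` with digit `1` a full sublevel of the second tower is mismatched, so it is moved to the
first tower. -/
lemma InFullBar.crosses (h1 : 1 < β) (h2 : β < 2) {p : Omega × ℝ × ℝ} (hp : InFullBar β p)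
    (hb : p.1 0 = true) (hx : 1 / β ≤ p.2.1) (hx' : p.2.1 ≤ 1 / (β - 1) - 1 / β) :
    ∃ w, psiTilde β p ∈ cell β w ∧ rightEnd β w = 1 / (β - 1) := by
  obtain ⟨ht, w, hw, hr⟩ := hp
  have hu := inv_pos' h1
  have hm : refl β p ∈ mismatch β w := by
    refine ⟨hw, ⟨?_, hr.le⟩, by simp [refl, hb], ?_, ?_⟩
    · rw [S_right h1, hr]; linarith
    · rw [refl_x]; linarith
    · rw [S_right h1, refl_x]; linarith
  rw [psiTilde_of_refl_mem_mismatch h1 h2 ht hm]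
  exact ⟨w ++ [false], mismatch_swap_mem_cell h1 h2 hm _, rightEnd_full_snoc h1 h2 hr⟩

end transitions

/-! ### Synchronisation by the digit `1` -/

section sync

variable {β : ℝ}

lemma shift_mem_ones {n : ℕ} {ω : Omega} (h : ω ∈ ones (n + 1)) : shift ω ∈ ones n :=
  fun i hi => h (i + 1) (by omega)

lemma ones_mono {m n : ℕ} (h : m ≤ n) {ω : Omega} (hω : ω ∈ ones n) : ω ∈ ones m :=
  fun i hi => hω i (hi.trans_le h)

lemma iterate_shift_apply (n i : ℕ) (ω : Omega) : shift^[n] ω i = ω (i + n) := by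
  induction n generalizing ω with
  | zero => rfl
  | succ n ih =>
    rw [Function.iterate_succ_apply, ih]
    simp only [shift]
    congr 1

/-- As long as the second coordinate stays in `L` it is multiplied by `β`. -/
lemma iterate_in_L (h1 : 1 < β) (h2 : β < 2) (n : ℕ) :
    ∀ p ∈ doubleTower β, β ^ n * p.2.1 < 1 →
      ((psiTilde β)^[n] p).1 = shift^[n] p.1 ∧ ((psiTilde β)^[n] p).2.1 = β ^ n * p.2.1 := by
  induction n with
  | zero => exact fun p _ _ => ⟨rfl, by simp⟩
  | succ n ih =>
    intro p hp hx
    have hx0 := (x_mem_I h1 h2 hp).1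
    have hlt : p.2.1 < 1 / β := by
      rw [lt_div_iff₀ (by linarith)]
      refine lt_of_le_of_lt ?_ hx
      rw [mul_comm]
      gcongr
      exact le_self_pow₀ h1.le (by omega)
    have e : (psiTilde β p).2.1 = β * p.2.1 := by
      rw [psiTilde_x h1 h2 hp, fibreMap_of_lt hx0 hlt]
    have h := ih (psiTilde β p) (mapsTo_psiTilde h1 h2 hp) (by
      rw [e, ← mul_assoc, ← pow_succ]; exact hx)
    rw [Function.iterate_succ_apply, Function.iterate_succ_apply, h.1, h.2, e,
      psiTilde_fst h1 h2 hp, pow_succ]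
    exact ⟨rfl, by ring⟩

/-- While the digit is `1` and the second coordinate stays in `L`, every sublevel climbs until its
right end point leaves `L`, descends to the base, and then remains in the base. -/
lemma iterate_mem_base (h1 : 1 < β) (h2 : β < 2) (n : ℕ) :
    ∀ (w : List Bool) (p : Omega × ℝ × ℝ), p ∈ cell β w → p.1 ∈ ones n → β ^ n * p.2.1 < 1 →
      (w = [] ∨ (n ≠ 0 ∧ 1 ≤ β ^ n * rightEnd β w)) → (psiTilde β)^[n] p ∈ cell β [] := by
  induction n with
  | zero =>
    intro w p hp _ _ hw
    rcases hw with rfl | h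
    · exact hp
    · exact absurd rfl h.1
  | succ n ih =>
    intro w p hp ho hx hw
    have hpd : p ∈ doubleTower β := Or.inl (mem_tower.2 ⟨w, hp⟩)
    have hx0 := (x_mem_I h1 h2 hpd).1
    have hlt : p.2.1 < 1 / β := by
      rw [lt_div_iff₀ (by linarith)]
      refine lt_of_le_of_lt ?_ hx
      rw [mul_comm]
      gcongr
      exact le_self_pow₀ h1.le (by omega)
    have e : (psiTilde β p).2.1 = β * p.2.1 := by
      rw [psiTilde_x h1 h2 hpd, fibreMap_of_lt hx0 hlt]
    have hx' : β ^ n * (psiTilde β p).2.1 < 1 := by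
      rw [e, ← mul_assoc, ← pow_succ]; exact hx
    have ho' : (psiTilde β p).1 ∈ ones n := by
      rw [psiTilde_fst h1 h2 hpd]; exact shift_mem_ones ho
    have hb : p.1 0 = true := ho 0 (by omega)
    rw [Function.iterate_succ_apply]
    rcases le_or_gt (1 / β) (rightEnd β w) with hr | hr
    · exact ih [] _ (psiTilde_mem_base h1 h2 hp hb hlt hr) ho' hx' (Or.inl rfl)
    · refine ih (w ++ [true]) _ (psiTilde_mem_up h1 h2 hp hb (Or.inr hr)) ho' hx' (Or.inr ?_)
      have hw' : 1 ≤ β ^ (n + 1) * rightEnd β w := by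
        rcases hw with rfl | h
        · rw [rightEnd_nil] at hr
          exact absurd (inv_lt_one' h1) (not_lt.2 hr.le)
        · exact h.2
      rw [rightEnd_snoc_of_lt h1 h2 hr]
      refine ⟨?_, by rw [← mul_assoc, ← pow_succ]; exact hw'⟩
      rintro rfl
      rw [lt_div_iff₀ (by linarith)] at hr
      simp only [zero_add, pow_one] at hw'
      linarith

lemma iterate_inFullBar (h1 : 1 < β) (h2 : β < 2) (n : ℕ) :
    ∀ p ∈ doubleTower β, InFullBar β p → β ^ n * p.2.1 < 1 →
      InFullBar β ((psiTilde β)^[n] p) := by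
  induction n with
  | zero => exact fun p _ h _ => h
  | succ n ih =>
    intro p hp h hx
    have hx0 := (x_mem_I h1 h2 hp).1
    have hlt : p.2.1 < 1 / β := by
      rw [lt_div_iff₀ (by linarith)]
      refine lt_of_le_of_lt ?_ hx
      rw [mul_comm]
      gcongr
      exact le_self_pow₀ h1.le (by omega)
    rw [Function.iterate_succ_apply]
    refine ih _ (mapsTo_psiTilde h1 h2 hp) (h.stays h1 h2 hlt) ?_
    rw [psiTilde_x h1 h2 hp, fibreMap_of_lt hx0 hlt, ← mul_assoc, ← pow_succ]
    exact hx

lemma exists_pos_le_of_finite {F : Set ℝ} (hF : F.Finite) : ∃ η > 0, ∀ t ∈ F, 0 < t → η ≤ t := by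
  have hfin : (insert 1 {t ∈ F | 0 < t}).Finite := (hF.subset (sep_subset _ _)).insert 1
  obtain ⟨η, hη, hmin⟩ := exists_min_image _ id hfin ⟨1, mem_insert _ _⟩
  refine ⟨η, ?_, fun t ht h0 => hmin t (mem_insert_of_mem _ ⟨ht, h0⟩)⟩
  rcases hη with rfl | h
  · exact one_pos
  · exact h.2

/-- A cylinder over which all sublevels of words of length at most `M` are brought to the base at
the same time. The digits are all `1`. The second coordinate starts so close to `0` that, when it
leaves `L`, the sublevels of `E` have reached the base, and those of the second tower that are
still present are the full ones. It leaves `L` next to the left end point of `S`; then the full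
sublevels cross to `E`, and the second coordinate returns so close to `0` that the two remaining
kinds of sublevels reach the base as well. -/
lemma exists_synchronising_cylinder (h1 : 1 < β) (h2 : β < 2) (M : ℕ) :
    ∃ (N : ℕ) (J : Set ℝ), MeasurableSet J ∧ J ⊆ Icc 0 1 ∧ volume J ≠ 0 ∧
      ∀ p ∈ doubleTower β, p.1 ∈ ones N → p.2.1 ∈ J → |p.2.2| < levelBot β (M + 1) →
        (psiTilde β)^[N] p ∈ cell β [] := by
  have hβ : 0 < β := by linarith
  have e1 := beta_mul_inv h1
  have e2 := beta_mul_c h1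
  have e3 := one_lt_c h1 h2
  have e4 := inv_lt_S_right h1 h2
  have e5 := inv_lt_one' h1
  have e6 := inv_pos' h1
  -- the length of the second stay in `L`, in which the right end point `β - 1` climbs out of `L`
  obtain ⟨k', hk'⟩ := pow_unbounded_of_one_lt (1 / (β - 1)) h1
  have hk'1 : 1 ≤ β ^ k' * (β - 1) := by
    rw [div_lt_iff₀ (by linarith)] at hk'
    exact hk'.le
  have hk'0 : k' ≠ 0 := by
    rintro rfl
    rw [pow_zero, one_mul] at hk'1
    linarith
  -- the width of the window next to the left end point of `S`
  obtain ⟨δ, hδ0, hδ1, hδ2, hδ3⟩ : ∃ δ > 0, 1 / β + δ ≤ 1 ∧ 1 / β + δ ≤ 1 / (β - 1) - 1 / β ∧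
      β ^ k' * (β * δ) ≤ 1 := by
    refine ⟨min (1 - 1 / β) (min (1 / (β - 1) - 1 / β - 1 / β) (1 / (β ^ k' * β))),
      lt_min (by linarith) (lt_min (by linarith) (by positivity)), ?_, ?_, ?_⟩
    · linarith [min_le_left (1 - 1 / β) (min (1 / (β - 1) - 1 / β - 1 / β) (1 / (β ^ k' * β)))]
    · have := (min_le_right (1 - 1 / β) (min (1 / (β - 1) - 1 / β - 1 / β)
        (1 / (β ^ k' * β)))).trans (min_le_left _ _)
      linarith
    · have := (min_le_right (1 - 1 / β) (min (1 / (β - 1) - 1 / β - 1 / β)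
        (1 / (β ^ k' * β)))).trans (min_le_right _ _)
      rw [le_div_iff₀ (by positivity)] at this
      calc _ = _ * (β ^ k' * β) := by ring
        _ ≤ 1 := this
  -- a lower bound for the non-zero end points of the sublevels, in both towers
  obtain ⟨η, hη0, hη⟩ := exists_pos_le_of_finite
    (((List.finite_length_le Bool M).image (rightEnd β)).union
      ((List.finite_length_le Bool M).image fun w => 1 / (β - 1) - rightEnd β w))
  obtain ⟨k, hk⟩ := pow_unbounded_of_one_lt (max (1 / η) 1) h1
  obtain ⟨hk1, hk2⟩ := max_lt_iff.1 hk
  have hkη : 1 < β ^ k * η := by rwa [div_lt_iff₀ hη0] at hk1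
  have hk0 : k ≠ 0 := by
    rintro rfl
    simp at hk2
  have hpos : 0 < β ^ k := by positivity
  refine ⟨k + 1 + k', Ioo (1 / β / β ^ k) ((1 / β + δ) / β ^ k), measurableSet_Ioo, ?_, ?_, ?_⟩
  · intro x hx
    refine ⟨(by positivity : 0 ≤ 1 / β / β ^ k).trans hx.1.le, hx.2.le.trans ?_⟩
    rw [div_le_one hpos]
    linarith
  · rw [Real.volume_Ioo, Ne, ENNReal.ofReal_eq_zero, not_le, sub_pos]
    exact div_lt_div_of_pos_right (by linarith) hpos
  intro p hp ho hx hy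
  have hxl : 1 / β < β ^ k * p.2.1 := by
    have := hx.1
    rwa [div_lt_iff₀ hpos, mul_comm] at this
  have hxu : β ^ k * p.2.1 < 1 / β + δ := by
    have := hx.2
    rwa [lt_div_iff₀ hpos, mul_comm] at this
  have hxη : p.2.1 < η := by
    have h : β ^ k * p.2.1 < β ^ k * η := by linarith
    exact lt_of_mul_lt_mul_left h hpos.le
  have hx0 : 0 < p.2.1 := by
    have := hx.1
    have : 0 < 1 / β / β ^ k := by positivity
    linarith
  have hlen : ∀ (w : List Bool) (q : Omega × ℝ × ℝ), q ∈ cell β w → q.2.2 < levelBot β (M + 1) →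
      w.length ≤ M := by
    intro w q hq hqy
    by_contra hcon
    have := levelBot_mono h1 (show M + 1 ≤ w.length by omega)
    linarith [levelBot_le_height h1 w, (mem_cell.1 hq).2.1]
  -- the state when the second coordinate leaves `L`
  obtain ⟨hs1, hsx⟩ := iterate_in_L h1 h2 k p hp (by linarith)
  set q := (psiTilde β)^[k] p with hq
  have hqd : q ∈ doubleTower β := (mapsTo_psiTilde h1 h2).iterate k hp
  have hqo : q.1 ∈ ones (1 + k') := by
    intro i hi
    rw [hs1, iterate_shift_apply]
    exact ho _ (by omega)
  have hqb : q.1 0 = true := hqo 0 (by omega)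
  have hstate : q ∈ cell β [] ∨ InFullBar β q := by
    by_cases ht : p ∈ tower β
    · left
      obtain ⟨w, hw⟩ := mem_tower.1 ht
      have hl := hlen w p hw ((le_abs_self _).trans_lt hy)
      refine iterate_mem_base h1 h2 k w p hw (ones_mono (by omega) ho) (by linarith)
        (Or.inr ⟨hk0, ?_⟩)
      have hr := hη (rightEnd β w) (Or.inl ⟨w, hl, rfl⟩)
        (hx0.trans_le (mem_cell.1 hw).1.2)
      nlinarith
    · right
      obtain ⟨w, hw⟩ := mem_tower.1 (mem_towerBar.1 (hp.resolve_left ht))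
      have hl := hlen w _ hw (by rw [refl_y]; exact (neg_le_abs _).trans_lt hy)
      refine iterate_inFullBar h1 h2 k p hp ⟨ht, w, hw, ?_⟩ (by linarith)
      by_contra hne
      have hc := (rightEnd_mem_I h1 h2 w).2
      have hpos' : 0 < 1 / (β - 1) - rightEnd β w := by
        rw [sub_pos]
        exact lt_of_le_of_ne hc hne
      have := hη _ (Or.inr ⟨w, hl, rfl⟩) hpos'
      have h' := (mem_cell.1 hw).1.2
      rw [refl_x] at h'
      linarith
  -- one step through the window
  have hqx : (psiTilde β q).2.1 = β * q.2.1 - 1 := by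
    rw [psiTilde_x h1 h2 hqd, hqb, fibreMap_true h1 h2 (by rw [hsx]; exact hxl.le)
      (x_mem_I h1 h2 hqd).2]
  have hmid : ∃ w, psiTilde β q ∈ cell β w ∧ β - 1 ≤ rightEnd β w := by
    rcases hstate with h | h
    · refine ⟨[] ++ [true], psiTilde_mem_up h1 h2 h hqb (Or.inl (by rw [hsx]; exact hxl.le)), ?_⟩
      rw [rightEnd_snoc_true h1 h2 (by rw [rightEnd_nil]; exact e5.le), rightEnd_nil]
      linarith
    · obtain ⟨w, hw, hr⟩ := h.crosses h1 h2 hqb (by rw [hsx]; exact hxl.le)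
        (by rw [hsx]; linarith)
      exact ⟨w, hw, by rw [hr]; linarith⟩
  obtain ⟨w, hw, hr⟩ := hmid
  have hiter : (psiTilde β)^[k + 1 + k'] p = (psiTilde β)^[k'] (psiTilde β q) := by
    rw [show k + 1 + k' = k' + (k + 1) by ring, Function.iterate_add_apply,
      Function.iterate_succ_apply']
  rw [hiter]
  refine iterate_mem_base h1 h2 k' w _ hw ?_ ?_ (Or.inr ⟨hk'0, ?_⟩)
  · rw [psiTilde_fst h1 h2 hqd]
    exact shift_mem_ones (by rw [add_comm]; exact hqo)
  · have h : (psiTilde β q).2.1 < β * δ := by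
      rw [hqx, hsx]
      nlinarith
    have hk'pos : 0 < β ^ k' := by positivity
    have := mul_lt_mul_of_pos_left h hk'pos
    linarith
  · refine hk'1.trans ?_
    gcongr

end sync

/-! ### Points in the same sublevel with the same projections -/

section together

variable {β : ℝ}

/-- The two points have the same projection and lie in the same sublevel of the first tower, or
off the first tower in the same sublevel of the second tower. -/
def Together (β : ℝ) (p q : Omega × ℝ × ℝ) : Prop :=
  proj p = proj q ∧ ((∃ w, p ∈ cell β w ∧ q ∈ cell β w) ∨
    (p ∉ tower β ∧ q ∉ tower β ∧ ∃ w, refl β p ∈ cell β w ∧ refl β q ∈ cell β w))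

lemma psi_together (h1 : 1 < β) (h2 : β < 2) {w : List Bool} {p q : Omega × ℝ × ℝ}
    (hp : p ∈ cell β w) (hq : q ∈ cell β w) (hd : p.1 0 = q.1 0) (hx : p.2.1 = q.2.1) :
    (∃ u, psi β p ∈ cell β u ∧ psi β q ∈ cell β u) ∧
      (psi β p).2.2 - (psi β q).2.2 = (p.2.2 - q.2.2) / (2 * β) := by
  have hD : Descends β w p ↔ Descends β w q := by rw [Descends, Descends, hd, hx]
  by_cases h : Descends β w p
  · refine ⟨⟨[], psi_mem_base h1 h2 hp h, psi_mem_base h1 h2 hq (hD.1 h)⟩, ?_⟩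
    rw [psi_descends h1 hp h, psi_descends h1 hq (hD.1 h), hd]
    simp only
    ring
  · have h' : ¬ Descends β w q := fun k => h (hD.2 k)
    refine ⟨⟨w ++ [p.1 0], psi_mem_up h1 h2 hp h, hd ▸ psi_mem_up h1 h2 hq h'⟩, ?_⟩
    by_cases ha : ActsByT1 β w (p.1 0)
    · have ha' : ActsByT1 β w (q.1 0) := hd ▸ ha
      rw [psi_acts h1 hp ha (not_lt.1 fun k => h ⟨ha, k⟩),
        psi_acts h1 hq ha' (not_lt.1 fun k => h' ⟨ha', k⟩), hd]
      simp only
      ring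
    · have ha' : ¬ ActsByT1 β w (q.1 0) := hd ▸ ha
      rw [psi_not_acts h1 hp ha, psi_not_acts h1 hq ha', hd]
      simp only
      ring

lemma mismatch_congr {w : List Bool} {p q : Omega × ℝ × ℝ}
    (hp : p ∈ cell β w) (hq : q ∈ cell β w) (hd : p.1 0 = q.1 0) (hx : p.2.1 = q.2.1) :
    p ∈ mismatch β w ↔ q ∈ mismatch β w := by
  simp only [mismatch, mem_ofPred_eq, hp, hq, hd, hx]

/-- The tower map keeps such points together and contracts their distance by `2β`. -/
lemma Together.step (h1 : 1 < β) (h2 : β < 2) {p q : Omega × ℝ × ℝ} (h : Together β p q)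
    (hpd : p ∈ doubleTower β) (hqd : q ∈ doubleTower β) (hp0 : (psiTilde β p).2.2 ≠ 0)
    (hq0 : (psiTilde β q).2.2 ≠ 0) : Together β (psiTilde β p) (psiTilde β q) ∧
      |(psiTilde β p).2.2 - (psiTilde β q).2.2| = |p.2.2 - q.2.2| / (2 * β) := by
  obtain ⟨hproj, h⟩ := h
  have hproj' : proj (psiTilde β p) = proj (psiTilde β q) := by
    rw [proj_psiTilde h1 h2 hpd, proj_psiTilde h1 h2 hqd, hproj]
  have hω : p.1 = q.1 := congrArg (fun v : Omega × ℝ => v.1) hproj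
  have hx : p.2.1 = q.2.1 := congrArg (fun v : Omega × ℝ => v.2) hproj
  have habs : ∀ s t : ℝ, s = t / (2 * β) → |s| = |t| / (2 * β) := by
    rintro s t rfl
    rw [abs_div, abs_of_pos (show 0 < 2 * β by linarith)]
  rcases h with ⟨w, hp, hq⟩ | ⟨hpt, hqt, w, hp, hq⟩
  · have hm := mismatch_congr hp hq (congrFun hω 0) hx
    obtain ⟨hu, hy⟩ := psi_together h1 h2 hp hq (congrFun hω 0) hx
    by_cases hmp : p ∈ mismatch β w
    · have hmq := hm.1 hmp
      have k1 := one_le_psi_y h1 h2 hp (not_descends_of_mismatch hmp)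
      have k2 := one_le_psi_y h1 h2 hq (not_descends_of_mismatch hmq)
      rw [psiTilde_of_mem_mismatch h1 h2 hmp, psiTilde_of_mem_mismatch h1 h2 hmq] at hproj' ⊢
      have hcell : ∀ r ∈ mismatch β w,
          refl β ((psi β r).1, (psi β r).2.1 + 1, -(psi β r).2.2) ∈ cell β (w ++ [false]) := by
        intro r hr
        have := mismatch_swap_mem_cell h1 h2 hr (refl β ((psi β r).1, (psi β r).2.1 + 1,
          -(psi β r).2.2)).1
        rw [mem_cell, refl_x, refl_y, ← sub_sub, neg_neg]
        exact mem_cell.1 this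
      refine ⟨⟨hproj', Or.inr ⟨notMem_tower_of_y_neg h1 ?_, notMem_tower_of_y_neg h1 ?_, _,
        hcell p hmp, hcell q hmq⟩⟩, ?_⟩
      · simp only; linarith
      · simp only; linarith
      · refine (abs_sub_comm _ _).trans (habs _ _ ?_)
        rw [← hy]
        simp only
        ring
    · have hmq : q ∉ mismatch β w := fun k => hmp (hm.2 k)
      rw [psiTilde_of_notMem_mismatch h1 h2 hp hmp,
        psiTilde_of_notMem_mismatch h1 h2 hq hmq] at hproj' ⊢
      exact ⟨⟨hproj', Or.inl hu⟩, habs _ _ hy⟩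
  · have hd' : (refl β p).1 0 = (refl β q).1 0 := by rw [refl_digit, refl_digit, hω]
    have hx' : (refl β p).2.1 = (refl β q).2.1 := by rw [refl_x, refl_x, hx]
    have hm := mismatch_congr hp hq hd' hx'
    obtain ⟨hu, hy⟩ := psi_together h1 h2 hp hq hd' hx'
    rw [refl_y, refl_y] at hy
    by_cases hmp : refl β p ∈ mismatch β w
    · have hmq := hm.1 hmp
      rw [psiTilde_of_refl_mem_mismatch h1 h2 hpt hmp,
        psiTilde_of_refl_mem_mismatch h1 h2 hqt hmq] at hproj' ⊢
      refine ⟨⟨hproj', Or.inl ⟨_, mismatch_swap_mem_cell h1 h2 hmp _,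
        mismatch_swap_mem_cell h1 h2 hmq _⟩⟩, ?_⟩
      refine (habs _ _ hy).trans ?_
      rw [abs_sub_comm (-p.2.2)]
      congr 2
      ring
    · have hmq : refl β q ∉ mismatch β w := fun k => hmp (hm.2 k)
      rw [psiTilde_of_refl_notMem_mismatch h1 h2 hpt hp hmp] at hproj' hp0 ⊢
      rw [psiTilde_of_refl_notMem_mismatch h1 h2 hqt hq hmq] at hproj' hq0 ⊢
      have hneg : ∀ r : Omega × ℝ × ℝ, refl β r ∈ cell β w →
          (refl β (psi β (refl β r))).2.2 ≠ 0 → refl β (psi β (refl β r)) ∉ tower β := by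
        intro r hr h0
        refine notMem_tower_of_y_neg h1 (lt_of_le_of_ne ?_ h0)
        rw [refl_y]
        linarith [y_nonneg_of_mem_tower h1 (mapsTo_psi h1 h2 (mem_tower.2 ⟨w, hr⟩))]
      refine ⟨⟨hproj', Or.inr ⟨hneg p hp hp0, hneg q hq hq0, ?_⟩⟩, ?_⟩
      · simpa only [refl_refl] using hu
      · rw [refl_y, refl_y]
        refine (abs_sub_comm _ _).trans ?_
        rw [neg_sub_neg]
        refine (habs _ _ hy).trans ?_
        rw [abs_sub_comm (-p.2.2)]
        congr 2
        ring

lemma Together.iterate (h1 : 1 < β) (h2 : β < 2) {X₀ : Set (Omega × ℝ × ℝ)}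
    (hX : X₀ ⊆ regular β) (hT : MapsTo (psiTilde β) X₀ X₀) (n : ℕ) {p q : Omega × ℝ × ℝ}
    (hp : p ∈ X₀) (hq : q ∈ X₀) (h : Together β p q) :
    |((psiTilde β)^[n] p).2.2 - ((psiTilde β)^[n] q).2.2| = |p.2.2 - q.2.2| / (2 * β) ^ n := by
  induction n generalizing p q with
  | zero => simp
  | succ n ih =>
    obtain ⟨k1, k2⟩ := h.step h1 h2 (hX hp).1 (hX hq).1 (hX (hT hp)).2.1 (hX (hT hq)).2.1
    rw [Function.iterate_succ_apply, Function.iterate_succ_apply, ih (hT hp) (hT hq) k1, k2,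
      pow_succ', div_div]

end together

end RandomBeta

/-! ### Almost every point is determined by its projected backward orbit -/

namespace RandomBeta

section history

variable {β : ℝ}

/-- On the double tower all but a small proportion of every fibre is bounded away in height from
the ends of the two towers, so there are cylinders over which all but a small proportion of the
points land together in the base. -/
lemma exists_synchronising_set (h1 : 1 < β) (h2 : β < 2) {ε : ℝ≥0∞} (hε : ε ≠ 0) :
    ∃ (N : ℕ) (J : Set ℝ), MeasurableSet J ∧ J ⊆ Icc 0 1 ∧ volume J ≠ 0 ∧
      ∀ C ⊆ ones N ×ˢ J, MeasurableSet C →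
        towerMeasure β (proj ⁻¹' C ∩ {q | (psiTilde β)^[N] q ∉ cell β []}) ≤
          ε * towerMeasure β (proj ⁻¹' C) := by
  obtain ⟨δ, hδ, hδε⟩ := ENNReal.lt_iff_exists_nnreal_btwn.1 (pos_iff_ne_zero.2 hε)
  have hδ0 : (0 : ℝ) < δ := by exact_mod_cast hδ
  have hT : 0 < β / (β - 1) := div_pos (by linarith) (by linarith)
  have hb1 : 1 / β < 1 := (div_lt_one (by linarith)).2 h1
  have hb0 : 0 < 1 / β := by positivity
  obtain ⟨M, hM⟩ := exists_pow_lt_of_lt_one (div_pos hδ0 (mul_pos two_pos hT)) hb1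
  have hM' : 2 * (β / (β - 1) - levelBot β (M + 1)) ≤ δ := by
    have h : (1 / β) ^ (M + 1) ≤ (1 / β) ^ M := pow_le_pow_of_le_one hb0.le hb1.le (Nat.le_succ M)
    rw [lt_div_iff₀ (by positivity)] at hM
    rw [levelBot_eq h1]
    nlinarith
  have htop := levelBot_lt h1 (M + 1)
  obtain ⟨N, J, hJ, hJ1, hJ0, hsync⟩ := exists_synchronising_cylinder h1 h2 M
  refine ⟨N, J, hJ, hJ1, hJ0, fun C hC hm => ?_⟩
  -- The heights at which a point of the double tower need not be brought to the base.
  set t := levelBot β (M + 1)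
  set Y : Set ℝ := Icc t (β / (β - 1)) ∪ Icc (-(β / (β - 1))) (-t)
  have hYm : MeasurableSet Y := measurableSet_Icc.union measurableSet_Icc
  have hYv : volume Y ≤ ε := by
    refine (measure_union_le _ _).trans (le_trans ?_ hδε.le)
    rw [Real.volume_Icc, Real.volume_Icc, ← ENNReal.ofReal_add (by linarith) (by linarith)]
    refine ENNReal.ofReal_le_of_le_toReal ?_
    simp only [ENNReal.coe_toReal]
    linarith
  have hsub : proj ⁻¹' C ∩ {q | (psiTilde β)^[N] q ∉ cell β []} ∩ doubleTower β ⊆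
      proj ⁻¹' C ∩ {p | p.2.2 ∈ Y} := by
    rintro p ⟨⟨hp, hb⟩, hd⟩
    refine ⟨hp, ?_⟩
    have hty : t ≤ |p.2.2| := by
      by_contra! h
      exact hb (hsync p hd (hC hp).1 (hC hp).2 h)
    rcases hd with h | h
    · obtain ⟨w, hw⟩ := mem_tower.1 h
      have hy := y_nonneg_of_mem_tower h1 h
      have hy' := (y_lt_of_mem_cell h1 hw).trans (levelBot_lt h1 _)
      rw [abs_of_nonneg hy] at hty
      exact Or.inl ⟨hty, hy'.le⟩
    · have h := mem_towerBar.1 h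
      obtain ⟨w, hw⟩ := mem_tower.1 h
      have hy := y_nonneg_of_mem_tower h1 h
      have hy' := (y_lt_of_mem_cell h1 hw).trans (levelBot_lt h1 _)
      rw [refl_y] at hy hy'
      rw [abs_of_nonpos (by linarith)] at hty
      exact Or.inr ⟨by linarith, by linarith⟩
  calc towerMeasure β (proj ⁻¹' C ∩ {q | (psiTilde β)^[N] q ∉ cell β []})
      = vol (proj ⁻¹' C ∩ {q | (psiTilde β)^[N] q ∉ cell β []} ∩ doubleTower β) := by
        rw [towerMeasure_eq, Measure.restrict_apply' measurableSet_doubleTower]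
    _ ≤ vol (proj ⁻¹' C ∩ {p | p.2.2 ∈ Y}) := measure_mono hsub
    _ = volume Y * bernoulli.prod volume C := by rw [vol_proj_preimage_inter hm hYm, mul_comm]
    _ ≤ ε * towerMeasure β (proj ⁻¹' C) :=
        mul_le_mul' hYv (towerMeasure_ge_of_unit (fun v hv => hJ1 (hC hv).2) hm)

/-- Two points with the same projected backward orbit have been together in the base arbitrarily
long ago, except for a null set: the `j`-th exceptional set has measure at most a multiple of
`2^{-j}`. As `ψ̃` contracts heights within a sublevel, the points coincide. -/
lemma exists_injOn_history (h1 : 1 < β) (h2 : β < 2)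
    {U : Omega × ℝ × ℝ → Omega × ℝ × ℝ} {X₀ : Set (Omega × ℝ × ℝ)}
    (hU : MeasurePreserving U (towerMeasure β) (towerMeasure β)) (hX : X₀ ⊆ regular β)
    (hX₀ : towerMeasure β X₀ᶜ = 0) (hT₀ : MapsTo (psiTilde β) X₀ X₀) (hU₀ : MapsTo U X₀ X₀)
    (hUT : LeftInvOn U (psiTilde β) X₀) (hTU : LeftInvOn (psiTilde β) U X₀) :
    ∃ X₁ ⊆ X₀, MeasurableSet X₁ ∧ towerMeasure β X₁ᶜ = 0 ∧
      InjOn (fun p (n : ℕ) => proj (U^[n] p)) X₁ := by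
  have := isFiniteMeasure_towerMeasure h1 h2
  have hae : ∀ᵐ p ∂towerMeasure β, p ∈ X₀ := hX₀
  have hε : ∀ j : ℕ, (2⁻¹ : ℝ≥0∞) ^ j ≠ 0 := fun j => pow_ne_zero _ (by simp)
  choose N J hJ hJ1 hJ0 hbad using fun j => exists_synchronising_set h1 h2 (hε j)
  set V : ℕ → Set (Omega × ℝ) := fun j => ones (N j) ×ˢ J j
  have hVm : ∀ j, MeasurableSet (V j) := fun j => (measurableSet_ones _).prod (hJ j)
  -- Backward entry to `V j` is looked for from time `N j + j` on, so that `N j` steps after the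
  -- entry there are still at least `j` steps to go.
  set E : ℕ → Set (Omega × ℝ × ℝ) := fun j => {p | ∃ n, IsBackwardEntry U proj (V j) p n ∧
    U^[n] p ∈ {q | (psiTilde β)^[N j] q ∉ cell β []}}
  have hEle : ∀ j, towerMeasure β (U^[N j + j] ⁻¹' E j) ≤ 2⁻¹ ^ j * towerMeasure β univ := by
    intro j
    have hm : MeasurableSet {q | (psiTilde β)^[N j] q ∉ cell β []} :=
      (((measurable_psiTilde h1 h2).iterate _) (measurableSet_cell [])).compl
    have hi := hU.iterate (N j + j)
    have hle := Measure.le_map_apply hi.aemeasurable (E j)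
    rw [hi.map_eq] at hle
    exact hle.trans (measure_backwardEntry_le hU hX₀ hT₀ hU₀ hTU
      (fun p hp => proj_psiTilde h1 h2 (regular_subset (hX hp))) measurable_proj measurable_skew
      (hVm j) hm (hbad j))
  have hsum : ∑' j, towerMeasure β (U^[N j + j] ⁻¹' E j) ≠ ∞ := by
    refine ne_top_of_le_ne_top ?_ (ENNReal.tsum_le_tsum hEle)
    rw [ENNReal.tsum_mul_right, ENNReal.tsum_geometric, ENNReal.one_sub_inv_two, inv_inv]
    exact ENNReal.mul_ne_top (by simp) (by finiteness)
  have hvisit : ∀ j, ∀ᵐ p ∂towerMeasure β, ∃ n, U^[n] (U^[N j + j] p) ∈ proj ⁻¹' V j := fun j =>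
    (hU.iterate (N j + j)).quasiMeasurePreserving.ae
      (ae_exists_backward_visit (measurePreserving_psiTilde h1 h2) hU hX₀ hUT
        (measurable_proj (hVm j))
        (ae_exists_iterate_psiTilde_mem h1 h2 (N j) (hJ j) (hJ1 j) (hJ0 j)))
  have hgood : ∀ᵐ p ∂towerMeasure β, p ∈ X₀ ∧
      (∀ᶠ j in Filter.atTop, p ∉ U^[N j + j] ⁻¹' E j) ∧
      ∀ j, ∃ n, U^[n] (U^[N j + j] p) ∈ proj ⁻¹' V j := by
    filter_upwards [hae, ae_eventually_notMem hsum, ae_all_iff.2 hvisit] with p a b c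
      using ⟨a, b, c⟩
  obtain ⟨Z, hZ, hZm, hZ0⟩ := exists_measurable_superset_of_null (ae_iff.1 hgood)
  have hsubset : ∀ p ∈ Zᶜ, p ∈ X₀ ∧ (∀ᶠ j in Filter.atTop, p ∉ U^[N j + j] ⁻¹' E j) ∧
      ∀ j, ∃ n, U^[n] (U^[N j + j] p) ∈ proj ⁻¹' V j := fun p hp => by
    by_contra h
    exact hp (hZ h)
  refine ⟨Zᶜ, fun p hp => (hsubset p hp).1, hZm.compl, by rwa [compl_compl], ?_⟩
  intro p hp q hq hpq
  obtain ⟨hp0, hpE, hpV⟩ := hsubset p hp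
  obtain ⟨hq0, hqE, -⟩ := hsubset q hq
  have hproj : ∀ n, proj (U^[n] p) = proj (U^[n] q) := fun n => congrFun hpq n
  have hy : |p.2.2 - q.2.2| ≤ 0 := by
    refine ge_of_tendsto (tendsto_pow_atTop_nhds_zero_of_lt_one (r := (1 / 2 : ℝ)) (by norm_num)
      (by norm_num)) ?_
    filter_upwards [hpE, hqE] with j hpj hqj
    classical
    have hent : ∃ n, IsBackwardEntry U proj (V j) (U^[N j + j] p) n :=
      ⟨Nat.find (hpV j), Nat.find_spec (hpV j), fun i hi => Nat.find_min (hpV j) hi⟩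
    obtain ⟨n, hn⟩ := hent
    -- The entry time is read off from the projections, so it is the same for both points.
    have hn' : IsBackwardEntry U proj (V j) (U^[N j + j] q) n := by
      have h : ∀ i, proj (U^[i] (U^[N j + j] q)) = proj (U^[i] (U^[N j + j] p)) := fun i => by
        rw [← Function.iterate_add_apply, ← Function.iterate_add_apply, hproj]
      exact ⟨by rw [h]; exact hn.1, fun i hi => by rw [h]; exact hn.2 i hi⟩
    have hbase : ∀ r ∈ X₀, IsBackwardEntry U proj (V j) (U^[N j + j] r) n →
        r ∉ U^[N j + j] ⁻¹' E j → U^[j + n] r ∈ cell β [] := by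
      intro r hr he hE'
      by_contra hc
      refine hE' ⟨n, he, ?_⟩
      have hs : n + (N j + j) = N j + (j + n) := by ring
      rw [← Function.iterate_add_apply, hs]
      change (psiTilde β)^[N j] _ ∉ _
      rwa [iterate_leftInvOn hU₀ hTU hr]
    have ha := hbase p hp0 hn hpj
    have hb := hbase q hq0 hn' hqj
    have ht := Together.iterate h1 h2 hX hT₀ (j + n) (hU₀.iterate (j + n) hp0)
      (hU₀.iterate (j + n) hq0) ⟨hproj _, Or.inl ⟨[], ha, hb⟩⟩
    have hback := fun r hr => iterate_leftInvOn (p := r) hU₀ hTU hr (j + n) 0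
    simp only [add_zero, Function.iterate_zero, id_eq] at hback
    rw [hback p hp0, hback q hq0] at ht
    rw [ht]
    have hya := (mem_cell.1 ha).2
    have hyb := (mem_cell.1 hb).2
    rw [height_nil, thick_nil, zero_add] at hya hyb
    have habs : |(U^[j + n] p).2.2 - (U^[j + n] q).2.2| ≤ 1 := by
      rw [abs_le]
      constructor <;> linarith [hya.1, hya.2, hyb.1, hyb.2]
    have hpow : (2 : ℝ) ^ j ≤ (2 * β) ^ (j + n) :=
      (pow_le_pow_right₀ one_le_two (Nat.le_add_right j n)).trans
        (pow_le_pow_left₀ zero_le_two (by linarith) _)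
    rw [one_div_pow]
    exact div_le_div₀ zero_le_one habs (by positivity) hpow
  have hyeq : p.2.2 = q.2.2 := sub_eq_zero.1 (abs_nonpos_iff.1 hy)
  have h0 : proj p = proj q := hproj 0
  exact Prod.ext (congrArg (fun v : Omega × ℝ => v.1) h0) (Prod.ext
    (congrArg (fun v : Omega × ℝ => v.2) h0) hyeq)

end history

end RandomBeta

namespace MeasureTheory

/-- If the orbit map `p ↦ (π (Uⁿ p))ₙ` is injective off a null set, then every measurable set
agrees almost everywhere with one of the σ-algebra generated by the maps `π ∘ Uⁿ`: the preimage of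
its image, which is measurable by the Lusin–Souslin theorem. -/
lemma exists_ae_eq_of_injOn_orbit {X Y : Type*} [MeasurableSpace X] [StandardBorelSpace X]
    [mY : MeasurableSpace Y] [StandardBorelSpace Y] {ν : Measure X} {U : X → X} {π : X → Y}
    (hU : Measurable U) (hπ : Measurable π) {X₁ : Set X} (hm : MeasurableSet X₁)
    (h0 : ν X₁ᶜ = 0) (hinj : InjOn (fun p (n : ℕ) => π (U^[n] p)) X₁) {A : Set X}
    (hA : MeasurableSet A) :
    ∃ B : Set X, MeasurableSet[⨆ n : ℕ, mY.comap (π ∘ U^[n])] B ∧ A =ᵐ[ν] B := by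
  set Φ : X → ℕ → Y := fun p n => π (U^[n] p)
  have hΦm : Measurable Φ := measurable_pi_lambda _ fun n => hπ.comp (hU.iterate n)
  have himg : MeasurableSet (Φ '' (A ∩ X₁)) :=
    (hA.inter hm).image_of_measurable_injOn hΦm (hinj.mono inter_subset_right)
  refine ⟨Φ ⁻¹' (Φ '' (A ∩ X₁)), ?_, ?_⟩
  · have hc : (⨆ n : ℕ, mY.comap (π ∘ U^[n])) = MeasurableSpace.pi.comap Φ := by
      rw [MeasurableSpace.pi, MeasurableSpace.comap_iSup]
      simp only [MeasurableSpace.comap_comp]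
      rfl
    rw [hc]
    exact ⟨_, himg, rfl⟩
  · have hae : ∀ᵐ p ∂ν, p ∈ X₁ := h0
    filter_upwards [hae] with p hp
    refine propext ⟨fun h => ⟨p, ⟨h, hp⟩, rfl⟩, ?_⟩
    rintro ⟨q, ⟨hq, hq1⟩, he⟩
    rwa [hinj hq1 hp he] at hq

end MeasureTheory

/-! ### The natural extension -/

theorem mainTheorem2 (β : ℝ) (h1 : 1 < β) (h2 : β < 2) :
    -- the map acts on the double tower, which has positive finite measure
    MapsTo (RandomBeta.psiTilde β) (RandomBeta.doubleTower β) (RandomBeta.doubleTower β) ∧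
    0 < RandomBeta.towerMeasure β univ ∧ RandomBeta.towerMeasure β univ < ∞ ∧
    -- it preserves the measure and is bijective almost everywhere
    MeasurePreserving (RandomBeta.psiTilde β)
      (RandomBeta.towerMeasure β) (RandomBeta.towerMeasure β) ∧
    (∃ X₀ ⊆ RandomBeta.doubleTower β, MeasurableSet X₀ ∧
      RandomBeta.towerMeasure β X₀ᶜ = 0 ∧ BijOn (RandomBeta.psiTilde β) X₀ X₀) ∧
    -- it acts as `R_β` on the first two coordinates
    (∀ p ∈ RandomBeta.doubleTower β, RandomBeta.proj p ∈ univ ×ˢ RandomBeta.I β ∧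
      RandomBeta.proj (RandomBeta.psiTilde β p) = RandomBeta.skew β (RandomBeta.proj p)) ∧
    -- `μ_β` exists, and the normalised system is a natural extension of `(R_β, m × μ_β)`
    (∃ μ : Measure ℝ, RandomBeta.IsInvariantDensityMeasure β μ) ∧
    (∀ μ : Measure ℝ, RandomBeta.IsInvariantDensityMeasure β μ →
      RandomBeta.IsNaturalExtension (RandomBeta.psiTilde β)
        ((RandomBeta.towerMeasure β univ)⁻¹ • RandomBeta.towerMeasure β)
        RandomBeta.proj (RandomBeta.skew β) (RandomBeta.bernoulli.prod μ)) := by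
  have hfin := RandomBeta.isFiniteMeasure_towerMeasure h1 h2
  obtain ⟨U, X₀, hU, hX, hm, hX₀, hT₀, hU₀, hUT, hTU⟩ := RandomBeta.exists_inverse_psiTilde h1 h2
  have hT := RandomBeta.measurePreserving_psiTilde h1 h2
  refine ⟨RandomBeta.mapsTo_psiTilde h1 h2, RandomBeta.towerMeasure_univ_pos, measure_lt_top _ _,
    hT, ⟨X₀, hX.trans RandomBeta.regular_subset, hm, hX₀, InvOn.bijOn ⟨hUT, hTU⟩ hT₀ hU₀⟩,
    fun p hp => ⟨⟨mem_univ _, RandomBeta.x_mem_I h1 h2 hp⟩, RandomBeta.proj_psiTilde h1 h2 hp⟩,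
    ⟨_, RandomBeta.isInvariantDensityMeasure_marginal h1 h2⟩, fun μ hμ => ?_⟩
  obtain rfl := RandomBeta.IsInvariantDensityMeasure.eq_marginal h1 h2 hμ
  have := hμ.isProbabilityMeasure
  have hae : ∀ᵐ p ∂(RandomBeta.towerMeasure β), p ∈ X₀ := hX₀
  obtain ⟨X₁, -, hm₁, hX₁, hinj⟩ :=
    RandomBeta.exists_injOn_history h1 h2 hU hX hX₀ hT₀ hU₀ hUT hTU
  exact {
    base_preserving := (RandomBeta.stationary_marginal h1 h2).measurePreserving_skew
    preserving := RandomBeta.measurePreserving_normalized hT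
    factor := ⟨RandomBeta.measurable_proj, RandomBeta.map_proj_towerMeasure⟩
    semiconj := Measure.ae_smul_measure (RandomBeta.ae_mem_doubleTower.mono fun p hp =>
      RandomBeta.proj_psiTilde h1 h2 hp) _
    invertible_generating := ⟨U, RandomBeta.measurePreserving_normalized hU,
      Measure.ae_smul_measure (hae.mono fun p hp => hUT hp) _,
      Measure.ae_smul_measure (hae.mono fun p hp => hTU hp) _, fun A hA =>
        exists_ae_eq_of_injOn_orbit hU.measurable RandomBeta.measurable_proj hm₁
          (by rw [Measure.smul_apply, hX₁, smul_zero]) hinj hA⟩ }
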